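/- Let $d\in\{2,3\}$ and let $\Omega\subset\mathbb{R}^d$ be a bounded domain (open, connected, non-empty) with polygonal (polyhedral) Lipschitz boundary. Let $(\mathcal{T}^h)_{0<h<1}$ be a regular and quasi-uniform family of conforming triangulations of $\overline\Omega$ with mesh size $h$; that is, each $\mathcal{T}^h$ is a finite set of nondegenerate closed $d$-simplices with union $\overline\Omega$, any two of which meet in a common face or not at all, and there are constants $\kappa,\tau>0$ such that for all $h\in(0,1)$ and all $T\in\mathcal{T}^h$ one has $\tau h\le\operatorname{diam}T\le h$ and $T$ contains a ball of radius $r$ with $\operatorname{diam}T\le\kappa r$. Let $\underline q,\overline q>0$ be constants and put $$\mathcal{Q}:=\{q\in L^\infty(\Omega)\mid \underline q\le q(x)\le\overline q\text{ for a.e. }x\in\Omega\},$$ $$TV(q):=\int_\Omega|\nabla q|:=\sup\Big\{\int_\Omega q\,\operatorname{div}\Xi\ \Big|\ \Xi\in C^1_c(\Omega)^d,\ \max_{1\le i\le d}|\Xi_i(x)|\le1\text{ for all }x\in\Omega\Big\}\in[0,\infty],$$ $$\mathcal{Q}_{ad}:=\mathcal{Q}\cap BV(\Omega)=\{q\in\mathcal{Q}\mid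 TV(q)<\infty\},$$ $$\mathcal{V}^h_1:=\{v\in C(\overline\Omega)\mid v|_T\text{ is a polynomial of degree at most }1\text{ for all }T\in\mathcal{T}^h\},\qquad \mathcal{Q}^h_{ad}:=\mathcal{Q}\cap\mathcal{V}^h_1 .$$ Then for every fixed $q\in\mathcal{Q}_{ad}$ there are elements $\widehat q^h\in\mathcal{Q}^h_{ad}$, $0<h<1$, such that for every $h_0\in(0,1)$ there is a constant $C>0$, independent of $h$, with $$\|\widehat q^h-q\|_{L^1(\Omega)}\le C\,h\,|\log h|\quad\text{for all }0<h\le h_0,$$ and such that $$\lim_{h\to0}\int_\Omega|\nabla\widehat q^h|=\int_\Omega|\nabla q| .$$ If moreover $q\in W^{1,p}(\Omega)$ for some $p>d$ ($p=\infty$ allowed), then $q$ has a representative $\tilde q\in C(\overline\Omega)$, and one can take $\widehat q^h=I^h_1\tilde q$, the nodal interpolant, i.e. the element of $\mathcal{V}^h_1$ that coincides with $\tilde q$ at all vertices of $\mathcal{T}^h$. -/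

import Mathlib

open MeasureTheory Set Filter Topology
open scoped ENNReal ContDiff

namespace TVFEM

noncomputable section

/-! ### Domains -/

/-- `Ω` has a Lipschitz boundary: near each boundary point, `Ω` is the region strictly above the
graph, in some unit direction `ν`, of a Lipschitz function `φ` of the components orthogonal to `ν`
(encoded as a function on the whole space that is invariant under translation along `ν`). -/
def HasLipschitzBoundary {d : ℕ} (Ω : Set (EuclideanSpace ℝ (Fin d))) : Prop :=
  ∀ x ∈ frontier Ω, ∃ (ν : EuclideanSpace ℝ (Fin d)) (r : ℝ) (L : NNReal)
      (φ : EuclideanSpace ℝ (Fin d) → ℝ),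
    ‖ν‖ = 1 ∧ 0 < r ∧ LipschitzWith L φ ∧ (∀ (y : EuclideanSpace ℝ (Fin d)) (t : ℝ),
      φ (y + t • ν) = φ y) ∧
    ∀ y ∈ Metric.ball x r, (y ∈ Ω ↔ φ y < inner ℝ ν y)

/-- Bounded domains with a Lipschitz boundary which is polygonal (polyhedral), i.e. a finite union
of convex hulls of finite sets of points. -/
structure IsPolygonalDomain {d : ℕ} (Ω : Set (EuclideanSpace ℝ (Fin d))) : Prop where
  isOpen : IsOpen Ω
  isConnected : IsConnected Ω
  isBounded : Bornology.IsBounded Ω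
  lipschitz : HasLipschitzBoundary Ω
  polygonal : ∃ F : Set (Finset (EuclideanSpace ℝ (Fin d))), F.Finite ∧
    frontier Ω = ⋃ s ∈ F, convexHull ℝ (s : Set (EuclideanSpace ℝ (Fin d)))

/-! ### Functions of bounded variation, Sobolev functions -/

/-- Vector fields of class `C^1` with compact support in `Ω`, bounded by `1` in the `ℓ^∞` norm. -/
structure IsTVTestField {d : ℕ} (Ω : Set (EuclideanSpace ℝ (Fin d)))
    (Ξ : EuclideanSpace ℝ (Fin d) → EuclideanSpace ℝ (Fin d)) : Prop where
  contDiff : ContDiff ℝ 1 Ξ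
  hasCompactSupport : HasCompactSupport Ξ
  tsupport_subset : tsupport Ξ ⊆ Ω
  bound : ∀ x i, |Ξ x i| ≤ 1

/-- The divergence of a vector field. -/
def divergence {d : ℕ} (Ξ : EuclideanSpace ℝ (Fin d) → EuclideanSpace ℝ (Fin d))
    (x : EuclideanSpace ℝ (Fin d)) : ℝ :=
  ∑ i : Fin d, (fderiv ℝ Ξ x (EuclideanSpace.single i (1 : ℝ))) i

/-- The total variation of `q` on `Ω`, with values in `[0, ∞]`. (The zero field is admissible, so
the supremum is nonnegative and nothing is lost by truncating the integrals at `0`.) -/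
def TV {d : ℕ} (Ω : Set (EuclideanSpace ℝ (Fin d))) (q : EuclideanSpace ℝ (Fin d) → ℝ) : ℝ≥0∞ :=
  ⨆ (Ξ : EuclideanSpace ℝ (Fin d) → EuclideanSpace ℝ (Fin d)) (_ : IsTVTestField Ω Ξ),
    ENNReal.ofReal (∫ x in Ω, q x * divergence Ξ x)

/-- `q ∈ BV(Ω)`. -/
def MemBV {d : ℕ} (Ω : Set (EuclideanSpace ℝ (Fin d))) (q : EuclideanSpace ℝ (Fin d) → ℝ) : Prop :=
  Integrable q (volume.restrict Ω) ∧ TV Ω q < (⊤ : ℝ≥0∞)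

/-- `g` is the weak partial derivative of `q` on `Ω` in the `i`-th coordinate direction. -/
def IsWeakPartialDeriv {d : ℕ} (Ω : Set (EuclideanSpace ℝ (Fin d))) (i : Fin d)
    (q g : EuclideanSpace ℝ (Fin d) → ℝ) : Prop :=
  ∀ φ : EuclideanSpace ℝ (Fin d) → ℝ, ContDiff ℝ ∞ φ → HasCompactSupport φ → tsupport φ ⊆ Ω →
    ∫ x in Ω, q x * fderiv ℝ φ x (EuclideanSpace.single i (1 : ℝ)) = - ∫ x in Ω, g x * φ x

/-- `q ∈ W^{1,p}(Ω)`. -/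
def MemW1p {d : ℕ} (Ω : Set (EuclideanSpace ℝ (Fin d))) (p : ℝ≥0∞)
    (q : EuclideanSpace ℝ (Fin d) → ℝ) : Prop :=
  MemLp q p (volume.restrict Ω) ∧
    ∀ i : Fin d, ∃ g : EuclideanSpace ℝ (Fin d) → ℝ,
      MemLp g p (volume.restrict Ω) ∧ IsWeakPartialDeriv Ω i q g

/-! ### Admissible conductivities -/

/-- The set `Q` of functions in `L^∞(Ω)` with values in `[qlo, qhi]` almost everywhere in `Ω`. -/
def MemQ {d : ℕ} (Ω : Set (EuclideanSpace ℝ (Fin d))) (qlo qhi : ℝ)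
    (q : EuclideanSpace ℝ (Fin d) → ℝ) : Prop :=
  MemLp q (⊤ : ℝ≥0∞) (volume.restrict Ω) ∧ ∀ᵐ x ∂(volume.restrict Ω), qlo ≤ q x ∧ q x ≤ qhi

/-- The admissible set `Q_ad = Q ∩ BV(Ω)`. -/
def MemQad {d : ℕ} (Ω : Set (EuclideanSpace ℝ (Fin d))) (qlo qhi : ℝ)
    (q : EuclideanSpace ℝ (Fin d) → ℝ) : Prop :=
  MemQ Ω qlo qhi q ∧ MemBV Ω q

/-! ### Triangulations and piecewise linear finite elements -/

/-- The cells (triangles for `d = 2`, tetrahedra for `d = 3`) of a simplicial complex in `ℝ^d`,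
given by their vertex sets. -/
def cells {d : ℕ} (K : Geometry.SimplicialComplex ℝ (EuclideanSpace ℝ (Fin d))) :
    Set (Finset (EuclideanSpace ℝ (Fin d))) :=
  {s | s ∈ K.faces ∧ s.card = d + 1}

/-- `K` is a (conforming) triangulation of the closure of `Ω`: finitely many simplices, any two of
which meet in a common face (part of the notion of a simplicial complex), each of them a face of a
`d`-dimensional one, and whose union is the closure of `Ω`. -/
structure IsTriangulation {d : ℕ} (Ω : Set (EuclideanSpace ℝ (Fin d)))
    (K : Geometry.SimplicialComplex ℝ (EuclideanSpace ℝ (Fin d))) : Prop where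
  finite : K.faces.Finite
  space_eq : K.space = closure Ω
  pure : ∀ s ∈ K.faces, ∃ t ∈ cells K, s ⊆ t

/-- A family, indexed by the mesh size `h ∈ (0, 1)`, of regular and quasi-uniform triangulations
of the closure of `Ω`. The diameters of the cells of the triangulation with index `h` are at most
`h` and (quasi-uniformity) at least a fixed fraction of `h`; each cell contains a ball whose radius
is at least a fixed fraction of the diameter of that cell (regularity). -/
structure IsRegularQuasiUniformFamily {d : ℕ} (Ω : Set (EuclideanSpace ℝ (Fin d)))
    (K : ℝ → Geometry.SimplicialComplex ℝ (EuclideanSpace ℝ (Fin d))) : Prop where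
  isTriangulation : ∀ h ∈ Ioo (0 : ℝ) 1, IsTriangulation Ω (K h)
  meshSize : ∀ h ∈ Ioo (0 : ℝ) 1, ∀ s ∈ cells (K h),
    Metric.diam (convexHull ℝ (s : Set (EuclideanSpace ℝ (Fin d)))) ≤ h
  regular : ∃ κ : ℝ, 0 < κ ∧ ∀ h ∈ Ioo (0 : ℝ) 1, ∀ s ∈ cells (K h),
    ∃ (c : EuclideanSpace ℝ (Fin d)) (r : ℝ),
      Metric.closedBall c r ⊆ convexHull ℝ (s : Set (EuclideanSpace ℝ (Fin d))) ∧
      Metric.diam (convexHull ℝ (s : Set (EuclideanSpace ℝ (Fin d)))) ≤ κ * r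
  quasiUniform : ∃ τ : ℝ, 0 < τ ∧ ∀ h ∈ Ioo (0 : ℝ) 1, ∀ s ∈ cells (K h),
    τ * h ≤ Metric.diam (convexHull ℝ (s : Set (EuclideanSpace ℝ (Fin d))))

/-- The space of functions that are continuous on the closure of `Ω` and coincide on each cell
with a polynomial of degree at most one. -/
def MemV1 {d : ℕ} (Ω : Set (EuclideanSpace ℝ (Fin d)))
    (K : Geometry.SimplicialComplex ℝ (EuclideanSpace ℝ (Fin d)))
    (v : EuclideanSpace ℝ (Fin d) → ℝ) : Prop :=
  ContinuousOn v (closure Ω) ∧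
    ∀ s ∈ cells K, ∃ a : EuclideanSpace ℝ (Fin d) →ᵃ[ℝ] ℝ,
      EqOn v a (convexHull ℝ (s : Set (EuclideanSpace ℝ (Fin d))))

/-- The discrete admissible set: finite element functions that belong to `Q`. -/
def MemQadh {d : ℕ} (Ω : Set (EuclideanSpace ℝ (Fin d))) (qlo qhi : ℝ)
    (K : Geometry.SimplicialComplex ℝ (EuclideanSpace ℝ (Fin d)))
    (v : EuclideanSpace ℝ (Fin d) → ℝ) : Prop :=
  MemQ Ω qlo qhi v ∧ MemV1 Ω K v

/-- `v` is the nodal value interpolant of the function `w` (continuous on the closure of `Ω`): the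
finite element function, unique on the closure of `Ω`, that takes the values of `w` at the nodes. -/
def IsNodalInterpolant {d : ℕ} (Ω : Set (EuclideanSpace ℝ (Fin d)))
    (K : Geometry.SimplicialComplex ℝ (EuclideanSpace ℝ (Fin d)))
    (w v : EuclideanSpace ℝ (Fin d) → ℝ) : Prop :=
  MemV1 Ω K v ∧ ∀ x ∈ K.vertices, v x = w x

/-! ### Approximating families -/

/-- `qh h ∈ Q^h_ad` for all mesh sizes `h`, the `L^1` error is at most `C h |log h|` (with `C`
uniform for `h` away from `1`, where the right-hand side degenerates), and the total variations
converge as `h` tends to `0`. -/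
structure IsApproximatingFamily {d : ℕ} (Ω : Set (EuclideanSpace ℝ (Fin d))) (qlo qhi : ℝ)
    (K : ℝ → Geometry.SimplicialComplex ℝ (EuclideanSpace ℝ (Fin d)))
    (q : EuclideanSpace ℝ (Fin d) → ℝ) (qh : ℝ → EuclideanSpace ℝ (Fin d) → ℝ) : Prop where
  mem : ∀ h ∈ Ioo (0 : ℝ) 1, MemQadh Ω qlo qhi (K h) (qh h)
  rate : ∀ h₀ ∈ Ioo (0 : ℝ) 1, ∃ C : ℝ, 0 < C ∧ ∀ h ∈ Ioc (0 : ℝ) h₀,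
    eLpNorm (fun x => qh h x - q x) 1 (volume.restrict Ω) ≤ ENNReal.ofReal (C * h * |Real.log h|)
  tendsto_TV : Tendsto (fun h => TV Ω (qh h)) (𝓝[>] 0) (𝓝 (TV Ω q))

end

end TVFEM

/-! The approximants are nodal interpolants of smoothings of `q` at the scale `ε = h |log h|`.

Smoothing near the boundary needs no extension of `q`, because the averages are shifted inwards. A
Lipschitz boundary gives a finite partition of unity `ψ_j` on the closure of `Ω` and directions
`w_j` such that points of the closure in the support of `ψ_j` enter `Ω` when moved by `s z`, for
small `s > 0` and `|z - w_j| ≤ 2` (`exists_inwardCover`). Let `A_j` at `x` be a smooth average of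
`q` over the points `x + ε z` with `|z - w_j| ≤ 1`. The smoothing `q_ε = Σ ψ_j A_j` sees only values
of `q` in `Ω`, so it keeps the bounds on `q`; interpolation keeps them as well.

Three estimates carry the first part. Each moves a derivative or a difference onto a smooth test
function and then uses the definition of the total variation. (1) `‖q_ε - q‖_1 ≤ C ε`
(`exists_integral_abs_smoothing_sub_le`): an average of translates differs from `q` by the length of
the translation times the variation. (2) `TV(q_ε) ≤ (1 + C ε) TV(q)` (`exists_TV_smoothing_le`):
since `Σ ∇ψ_j = 0` in `Ω`, the terms with a derivative on `ψ_j` become `Σ (A_j - q) ∇ψ_j`, which is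
of order `ε` by the argument of (1). (3) The oscillations of `∇q_ε` over the cells, weighted by
volume, sum up to `C h / ε` (`exists_sum_osc_fderiv_le`). By (3) the interpolation error is of order
`h / ε` in total variation and `h² / ε` in `L¹` (`interpolation_error`). With `ε = h |log h|` the
former is `1 / |log h| → 0`, and all `L¹` errors are of order `h |log h|`. Thus the upper limit of
the variations is at most `TV(q)`; lower semicontinuity (`TV_le_liminf`) gives the other inequality.

For `q ∈ W^{1,p}` with `p > d`, lower `p` to a finite exponent. The gradients of the smoothings are
then Cauchy in `L^p`, and Morrey's inequality on each cell gives `Σ |T| osc_T w ≤ C h ‖∇w‖_p`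
(`exists_sum_osc_le`). On one fixed triangulation this yields uniform convergence, hence a
continuous representative. On the whole family it yields an `L¹` error of order `h` and stability of
interpolation from `W^{1,p}` into `BV`; the latter reduces convergence of the variations to
interpolants of one fixed smooth function. -/

namespace TVFEM

/-- Euclidean space of dimension `d`. -/
abbrev Eucl (d : ℕ) : Type := EuclideanSpace ℝ (Fin d)

/-! ### Total variation: pairings with test fields, subadditivity, lower semicontinuity. -/

section TotalVariation

variable {d : ℕ} {Ω : Set (Eucl d)} {q f g : Eucl d → ℝ} {Ξ : Eucl d → Eucl d}

lemma continuous_divergence (hΞ : ContDiff ℝ 1 Ξ) : Continuous (divergence Ξ) := by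
  unfold divergence
  have h := hΞ.continuous_fderiv one_ne_zero
  fun_prop

lemma hasCompactSupport_divergence (hΞ : HasCompactSupport Ξ) :
    HasCompactSupport (divergence Ξ) := by
  refine (hΞ.fderiv (𝕜 := ℝ)).mono fun x hx => ?_
  contrapose! hx
  simp only [Function.mem_support, not_not] at hx ⊢
  simp [divergence, hx]

lemma exists_abs_divergence_le (h1 : ContDiff ℝ 1 Ξ) (h2 : HasCompactSupport Ξ) :
    ∃ C : ℝ, ∀ x, ‖divergence Ξ x‖ ≤ C :=
  (continuous_divergence h1).bounded_above_of_compact_support (hasCompactSupport_divergence h2)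

lemma integrableOn_mul_divergence (hf : IntegrableOn f Ω) (h1 : ContDiff ℝ 1 Ξ)
    (h2 : HasCompactSupport Ξ) : IntegrableOn (fun x => f x * divergence Ξ x) Ω := by
  obtain ⟨C, hC⟩ := exists_abs_divergence_le h1 h2
  exact hf.mul_bdd (c := C) (continuous_divergence h1).aestronglyMeasurable
    (Eventually.of_forall hC)

lemma TV_le_ofReal {C : ℝ}
    (h : ∀ Ξ, IsTVTestField Ω Ξ → ∫ x in Ω, q x * divergence Ξ x ≤ C) :
    TV Ω q ≤ ENNReal.ofReal C :=
  iSup₂_le fun Ξ hΞ => ENNReal.ofReal_le_ofReal (h Ξ hΞ)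

lemma ofReal_integral_le_TV (hΞ : IsTVTestField Ω Ξ) :
    ENNReal.ofReal (∫ x in Ω, q x * divergence Ξ x) ≤ TV Ω q :=
  le_iSup₂ (f := fun (Ξ : Eucl d → Eucl d) (_ : IsTVTestField Ω Ξ) =>
    ENNReal.ofReal (∫ x in Ω, q x * divergence Ξ x)) Ξ hΞ

lemma integral_mul_divergence_le_toReal (hTV : TV Ω q ≠ ⊤) (hΞ : IsTVTestField Ω Ξ) :
    ∫ x in Ω, q x * divergence Ξ x ≤ (TV Ω q).toReal :=
  (ENNReal.ofReal_le_iff_le_toReal hTV).1 (ofReal_integral_le_TV hΞ)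

lemma divergence_const_smul (c : ℝ) (hΞ : ContDiff ℝ 1 Ξ) (x : Eucl d) :
    divergence (fun y => c • Ξ y) x = c * divergence Ξ x := by
  have h : DifferentiableAt ℝ Ξ x := (hΞ.differentiable one_ne_zero) x
  unfold divergence
  rw [fderiv_fun_const_smul h, Finset.mul_sum]
  simp

lemma integral_mul_divergence_le_mul (hTV : TV Ω q ≠ ⊤) {M : ℝ} (hM : 0 ≤ M)
    (h1 : ContDiff ℝ 1 Ξ) (h2 : HasCompactSupport Ξ) (h3 : tsupport Ξ ⊆ Ω)
    (h4 : ∀ x i, |Ξ x i| ≤ M) :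
    ∫ x in Ω, q x * divergence Ξ x ≤ M * (TV Ω q).toReal := by
  -- The field is rescaled by `M⁻¹`; `M = 0` is separate and forces the field to vanish.
  rcases hM.eq_or_lt with rfl | hM
  · have h0 : Ξ = fun _ => 0 := by
      ext x i
      simpa using h4 x i
    have h5 : divergence Ξ = fun _ => 0 := by
      ext x
      simp [h0, divergence]
    simp [h5]
  · have key := integral_mul_divergence_le_toReal (Ξ := fun y => M⁻¹ • Ξ y) hTV
      { contDiff := contDiff_const.smul (f := fun _ : Eucl d => M⁻¹) h1
        hasCompactSupport := h2.smul_left (f := fun _ => M⁻¹)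
        tsupport_subset := (tsupport_smul_subset_right (fun _ => M⁻¹) Ξ).trans h3
        bound := fun x i => by
          have := h4 x i
          simp only [PiLp.smul_apply, smul_eq_mul, abs_mul, abs_inv, abs_of_pos hM]
          rw [inv_mul_le_iff₀ hM]
          simpa using this }
    simp only [divergence_const_smul _ h1, mul_left_comm _ M⁻¹] at key
    rw [integral_const_mul, inv_mul_le_iff₀ hM] at key
    exact key

lemma divergence_smul_const {φ : Eucl d → ℝ} (hφ : ContDiff ℝ 1 φ) (v x : Eucl d) :
    divergence (fun y => φ y • v) x = fderiv ℝ φ x v := by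
  have h : DifferentiableAt ℝ φ x := (hφ.differentiable one_ne_zero) x
  unfold divergence
  have h5 : v = ∑ i, v i • EuclideanSpace.single i (1 : ℝ) := by
    ext j
    simp [Finset.sum_apply, Pi.single_apply]
  conv_rhs => rw [h5, map_sum]
  refine Finset.sum_congr rfl fun i _ => ?_
  rw [(h.hasFDerivAt.smul_const v).fderiv]
  simp [mul_comm]

/-- The field `φ v` has components bounded by `‖v‖ M`, and its divergence is the derivative of `φ`
along `v`. -/
lemma integral_mul_fderiv_le (hTV : TV Ω q ≠ ⊤) {M : ℝ} (hM : 0 ≤ M) {φ : Eucl d → ℝ}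
    (h1 : ContDiff ℝ 1 φ) (h2 : HasCompactSupport φ) (h3 : tsupport φ ⊆ Ω)
    (h4 : ∀ x, |φ x| ≤ M) (v : Eucl d) :
    ∫ x in Ω, q x * fderiv ℝ φ x v ≤ ‖v‖ * M * (TV Ω q).toReal := by
  have key := integral_mul_divergence_le_mul (Ξ := fun y => φ y • v) (M := ‖v‖ * M) hTV
    (by positivity) (h1.smul contDiff_const) h2.smul_right
    ((tsupport_smul_subset_left φ fun _ => v).trans h3) fun x i => by
      have h5 : |v i| ≤ ‖v‖ := by simpa using PiLp.norm_apply_le v i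
      simp only [PiLp.smul_apply, smul_eq_mul, abs_mul]
      rw [mul_comm]
      exact mul_le_mul h5 (h4 x) (abs_nonneg _) (norm_nonneg _)
  simpa only [divergence_smul_const h1] using key

lemma abs_integral_mul_fderiv_le (hTV : TV Ω q ≠ ⊤) {M : ℝ} (hM : 0 ≤ M) {φ : Eucl d → ℝ}
    (h1 : ContDiff ℝ 1 φ) (h2 : HasCompactSupport φ) (h3 : tsupport φ ⊆ Ω)
    (h4 : ∀ x, |φ x| ≤ M) (v : Eucl d) :
    |∫ x in Ω, q x * fderiv ℝ φ x v| ≤ ‖v‖ * M * (TV Ω q).toReal := by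
  rw [abs_le']
  refine ⟨integral_mul_fderiv_le hTV hM h1 h2 h3 h4 v, ?_⟩
  have := integral_mul_fderiv_le hTV hM h1 h2 h3 h4 (-v)
  simpa [integral_neg] using this

lemma TV_add_le (hf : IntegrableOn f Ω) (hg : IntegrableOn g Ω) :
    TV Ω (fun x => f x + g x) ≤ TV Ω f + TV Ω g := by
  refine iSup₂_le fun Ξ hΞ => ?_
  have h1 := integrableOn_mul_divergence hf hΞ.contDiff hΞ.hasCompactSupport
  have h2 := integrableOn_mul_divergence hg hΞ.contDiff hΞ.hasCompactSupport
  simp only [add_mul]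
  rw [integral_add h1 h2]
  exact ENNReal.ofReal_add_le.trans
    (add_le_add (ofReal_integral_le_TV hΞ) (ofReal_integral_le_TV hΞ))

lemma tendsto_integral_mul_divergence {ι : Type*} {l : Filter ι} {F : ι → Eucl d → ℝ}
    (hF : ∀ᶠ n in l, IntegrableOn (F n) Ω) (hq : IntegrableOn q Ω)
    (hlim : Tendsto (fun n => eLpNorm (fun x => F n x - q x) 1 (volume.restrict Ω)) l (𝓝 0))
    (h1 : ContDiff ℝ 1 Ξ) (h2 : HasCompactSupport Ξ) :
    Tendsto (fun n => ∫ x in Ω, F n x * divergence Ξ x) l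
      (𝓝 (∫ x in Ω, q x * divergence Ξ x)) := by
  obtain ⟨C, hC⟩ := exists_abs_divergence_le h1 h2
  refine tendsto_integral_of_L1 _ (integrableOn_mul_divergence hq h1 h2).aestronglyMeasurable
    (hF.mono fun n hn => integrableOn_mul_divergence hn h1 h2) ?_
  have h3 : Tendsto (fun n => ENNReal.ofReal C *
      eLpNorm (fun x => F n x - q x) 1 (volume.restrict Ω)) l (𝓝 0) := by
    simpa using ENNReal.Tendsto.const_mul hlim (Or.inr ENNReal.ofReal_ne_top)
  refine tendsto_of_tendsto_of_tendsto_of_le_of_le tendsto_const_nhds h3 (fun _ => zero_le)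
    fun n => ?_
  simp only [eLpNorm_one_eq_lintegral_enorm]
  rw [← lintegral_const_mul' _ _ ENNReal.ofReal_ne_top]
  refine lintegral_mono fun x => ?_
  rw [← sub_mul, enorm_mul, mul_comm]
  gcongr
  rw [← ofReal_norm]
  exact ENNReal.ofReal_le_ofReal (hC x)

/-- Lower semicontinuity of the total variation under convergence in `L¹`. -/
lemma TV_le_liminf {ι : Type*} {l : Filter ι} [l.NeBot] {F : ι → Eucl d → ℝ}
    (hF : ∀ᶠ n in l, IntegrableOn (F n) Ω) (hq : IntegrableOn q Ω)
    (hlim : Tendsto (fun n => eLpNorm (fun x => F n x - q x) 1 (volume.restrict Ω)) l (𝓝 0)) :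
    TV Ω q ≤ liminf (fun n => TV Ω (F n)) l := by
  refine iSup₂_le fun Ξ hΞ => ?_
  have h := tendsto_integral_mul_divergence hF hq hlim hΞ.contDiff hΞ.hasCompactSupport
  rw [← (ENNReal.tendsto_ofReal h).liminf_eq]
  exact liminf_le_liminf (Eventually.of_forall fun n => ofReal_integral_le_TV hΞ)

end TotalVariation

end TVFEM

namespace TVFEM

/-! ### Convolution averages, their adjoint, and translations of test functions. -/

section Averages

variable {d : ℕ} {Ω : Set (Eucl d)} {q f : Eucl d → ℝ} {k θ : Eucl d → ℝ}
variable {F : Type*} [NormedAddCommGroup F] [NormedSpace ℝ F] {Ξ : Eucl d → F}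

/-- The convolution of `f` with the kernel `k`. -/
noncomputable def avg (k f : Eucl d → ℝ) (x : Eucl d) : ℝ := ∫ t, f t * k (x - t)

/-- The adjoint of the convolution with the kernel `k`, on functions with values in a vector
space. -/
noncomputable def coavg (k : Eucl d → ℝ) (Ξ : Eucl d → F) (t : Eucl d) : F :=
  ∫ u, k u • Ξ (t + u)

lemma avg_eq_convolution :
    avg k f = MeasureTheory.convolution f k (ContinuousLinearMap.mul ℝ ℝ) volume := rfl

lemma avg_eq_swap (k f : Eucl d → ℝ) (x : Eucl d) : avg k f x = ∫ u, f (x - u) * k u := by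
  rw [avg, ← integral_sub_left_eq_self _ volume x]
  simp

lemma contDiff_avg {n : ℕ∞} (hf : LocallyIntegrable f) (hk : ContDiff ℝ n k)
    (hkc : HasCompactSupport k) : ContDiff ℝ n (avg k f) := by
  rw [avg_eq_convolution]
  exact hkc.contDiff_convolution_right _ hf hk

lemma fderiv_avg (hf : LocallyIntegrable f) (hk : ContDiff ℝ 1 k)
    (hkc : HasCompactSupport k) (x v : Eucl d) :
    fderiv ℝ (avg k f) x v = avg (fun u => fderiv ℝ k u v) f x := by
  rw [avg_eq_convolution, (hkc.hasFDerivAt_convolution_right _ hf hk x).fderiv,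
    convolution_precompR_apply _ hf (hkc.fderiv (𝕜 := ℝ)) (hk.continuous_fderiv one_ne_zero)]
  rfl

lemma coavg_eq_convolution :
    coavg k Ξ = MeasureTheory.convolution (fun u => k (-u)) Ξ
      (ContinuousLinearMap.lsmul ℝ ℝ) volume := by
  ext t
  rw [coavg, ← integral_neg_eq_self]
  simp [MeasureTheory.convolution, sub_eq_add_neg]

lemma contDiff_coavg {n : ℕ∞} (hk : Continuous k)
    (hΞ : ContDiff ℝ n Ξ) (hΞc : HasCompactSupport Ξ) : ContDiff ℝ n (coavg k Ξ) := by
  rw [coavg_eq_convolution]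
  have h1 : LocallyIntegrable (fun u => k (-u)) (volume : Measure (Eucl d)) :=
    (hk.comp continuous_neg).locallyIntegrable
  exact hΞc.contDiff_convolution_right _ h1 hΞ

lemma fderiv_coavg [CompleteSpace F] (hk : Continuous k) (hΞ : ContDiff ℝ 1 Ξ)
    (hΞc : HasCompactSupport Ξ) (t v : Eucl d) :
    fderiv ℝ (coavg k Ξ) t v = coavg k (fun x => fderiv ℝ Ξ x v) t := by
  have h1 : LocallyIntegrable (fun u => k (-u)) (volume : Measure (Eucl d)) :=
    (hk.comp continuous_neg).locallyIntegrable
  rw [coavg_eq_convolution, (hΞc.hasFDerivAt_convolution_right _ h1 hΞ t).fderiv,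
    convolution_precompR_apply _ h1 (hΞc.fderiv (𝕜 := ℝ)) (hΞ.continuous_fderiv one_ne_zero),
    coavg_eq_convolution]

/-- The set is the image of a compact product under subtraction, hence closed, so a bound on the
support bounds the topological support. Being explicit, it later places the support inside `Ω`. -/
lemma tsupport_coavg_subset (hkc : HasCompactSupport k) (hΞc : HasCompactSupport Ξ) :
    IsCompact {t : Eucl d | ∃ u ∈ tsupport k, t + u ∈ tsupport Ξ} ∧
    tsupport (coavg k Ξ) ⊆ {t : Eucl d | ∃ u ∈ tsupport k, t + u ∈ tsupport Ξ} := by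
  have h1 : {t : Eucl d | ∃ u ∈ tsupport k, t + u ∈ tsupport Ξ} =
      (fun p : Eucl d × Eucl d => p.1 - p.2) '' (tsupport Ξ ×ˢ tsupport k) := by
    ext t
    constructor
    · rintro ⟨u, hu, htu⟩
      exact ⟨(t + u, u), ⟨htu, hu⟩, by simp⟩
    · rintro ⟨⟨a, b⟩, ⟨ha, hb⟩, rfl⟩
      exact ⟨b, hb, by simpa using ha⟩
  have h2 : IsCompact {t : Eucl d | ∃ u ∈ tsupport k, t + u ∈ tsupport Ξ} := by
    rw [h1]
    exact (hΞc.isCompact.prod hkc.isCompact).image (by fun_prop)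
  refine ⟨h2, closure_minimal (fun t ht => ?_) h2.isClosed⟩
  by_contra hcon
  refine ht (integral_eq_zero_of_ae (Eventually.of_forall fun u => ?_))
  by_cases hu : k u = 0
  · simp [hu]
  · have : Ξ (t + u) = 0 := by
      by_contra hne
      exact hcon ⟨u, subset_tsupport _ hu, subset_tsupport _ hne⟩
    simp [this]

lemma hasCompactSupport_coavg (hkc : HasCompactSupport k) (hΞc : HasCompactSupport Ξ) :
    HasCompactSupport (coavg k Ξ) :=
  HasCompactSupport.of_support_subset_isCompact (tsupport_coavg_subset hkc hΞc).1
    ((subset_tsupport _).trans (tsupport_coavg_subset hkc hΞc).2)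

lemma integrable_pairing (hf : Integrable f) (hk : Continuous k) (hkc : HasCompactSupport k)
    (hθ : Continuous θ) (hθc : HasCompactSupport θ) :
    Integrable (fun p : Eucl d × Eucl d => f p.1 * (k p.2 * θ (p.1 + p.2)))
      (volume.prod volume) := by
  obtain ⟨C, hC⟩ := hθ.bounded_above_of_compact_support hθc
  have h1 : Integrable (fun p : Eucl d × Eucl d => f p.1 * k p.2) (volume.prod volume) :=
    hf.mul_prod (hk.integrable_of_hasCompactSupport hkc)
  have h2 : Continuous fun p : Eucl d × Eucl d => θ (p.1 + p.2) := by fun_prop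
  simpa only [mul_assoc] using h1.mul_bdd (c := C) h2.aestronglyMeasurable
    (Eventually.of_forall fun p => hC _)

lemma integral_mul_coavg (hf : Integrable f) (hk : Continuous k) (hkc : HasCompactSupport k)
    (hθ : Continuous θ) (hθc : HasCompactSupport θ) :
    ∫ t, f t * coavg k θ t = ∫ u, k u * ∫ t, f t * θ (t + u) := by
  have h := integral_integral_swap (f := fun t u => f t * (k u * θ (t + u)))
    (integrable_pairing hf hk hkc hθ hθc)
  simp only [integral_const_mul] at h
  simp only [coavg, smul_eq_mul]
  rw [h]
  refine integral_congr_ae (Eventually.of_forall fun u => ?_)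
  simp only
  rw [← integral_const_mul]
  simp only [mul_left_comm]

/-- Fubini: averaging is moved from `f` to the test function, so that `f` itself can be tested. -/
lemma integral_avg_mul (hf : Integrable f) (hk : Continuous k) (hkc : HasCompactSupport k)
    (hθ : Continuous θ) (hθc : HasCompactSupport θ) :
    ∫ x, avg k f x * θ x = ∫ t, f t * coavg k θ t := by
  rw [integral_mul_coavg hf hk hkc hθ hθc]
  obtain ⟨C, hC⟩ := hθ.bounded_above_of_compact_support hθc
  have h1 := Integrable.convolution_integrand (μ := volume) (ν := volume)
    (ContinuousLinearMap.mul ℝ ℝ) (hk.integrable_of_hasCompactSupport hkc) hf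
  have h2 : Integrable (fun p : Eucl d × Eucl d => k p.2 * f (p.1 - p.2) * θ p.1)
      (volume.prod volume) :=
    h1.mul_bdd (c := C)
      (by fun_prop : Continuous fun p : Eucl d × Eucl d => θ p.1).aestronglyMeasurable
      (Eventually.of_forall fun p => hC _)
  have h3 := integral_integral_swap (f := fun x u => k u * f (x - u) * θ x) h2
  simp only [integral_mul_const] at h3
  simp only [avg_eq_swap, mul_comm (f _) (k _)]
  rw [h3]
  refine integral_congr_ae (Eventually.of_forall fun u => ?_)
  simp only [mul_assoc]
  rw [integral_const_mul, ← integral_add_right_eq_self _ u]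
  simp

/-- As a function of the translation the pairing is a convolution with the reflected `θ`, hence
differentiable. -/
lemma avg_add_eq (f θ : Eucl d → ℝ) (u : Eucl d) :
    ∫ t, f t * θ (t + u) = avg (fun y => θ (-y)) f (-u) := by
  simp only [avg]
  congr 1
  ext t
  congr 2
  abel

/-- Translating the test function by `v` changes its integral against a function of bounded
variation by at most `‖v‖` times the total variation. -/
lemma abs_integral_translate_sub_le (hq : IntegrableOn q Ω) (hΩ : MeasurableSet Ω)
    (hTV : TV Ω q ≠ ⊤) {M : ℝ} (hM : 0 ≤ M)
    (h1 : ContDiff ℝ 1 θ) (h2 : HasCompactSupport θ) (h4 : ∀ x, |θ x| ≤ M) (v : Eucl d)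
    (h3 : ∀ x ∈ tsupport θ, ∀ s ∈ Icc (0 : ℝ) 1, x - s • v ∈ Ω) :
    |(∫ t, Ω.indicator q t * θ (t + v)) - ∫ t, Ω.indicator q t * θ t| ≤
      ‖v‖ * M * (TV Ω q).toReal := by
  set f := Ω.indicator q with hf
  have hfi : Integrable f := (integrable_indicator_iff hΩ).2 hq
  set θ' : Eucl d → ℝ := fun y => θ (-y) with hθ'
  have h1' : ContDiff ℝ 1 θ' := h1.comp contDiff_neg
  have h2' : HasCompactSupport θ' := h2.comp_homeomorph (Homeomorph.neg (Eucl d))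
  set G := avg θ' f with hG
  have hGd : ContDiff ℝ 1 G := contDiff_avg hfi.locallyIntegrable h1' h2'
  have hθd : Differentiable ℝ θ := h1.differentiable one_ne_zero
  have e1 : ∀ u, ∫ t, f t * θ (t + u) = G (-u) := fun u => avg_add_eq f θ u
  have e2 : ∫ t, f t * θ t = G (-0) := by simpa using e1 0
  rw [e1, e2]
  have hderiv : ∀ s : ℝ, HasDerivAt (fun s : ℝ => G (-(s • v))) (fderiv ℝ G (-(s • v)) (-v)) s := by
    intro s
    have ha : HasDerivAt (fun s : ℝ => -(s • v)) (-v) s := by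
      simpa using ((hasDerivAt_id s).smul_const v).fun_neg
    exact ((hGd.differentiable one_ne_zero) _).hasFDerivAt.comp_hasDerivAt s ha
  -- The derivative along the path pairs `q` with the derivative along `v` of `θ (· + s • v)`. By
  -- `h3` this translate is still supported in `Ω`, so the total variation controls it for every
  -- `s`.
  have hb : ∀ s ∈ Ico (0 : ℝ) 1, ‖fderiv ℝ G (-(s • v)) (-v)‖ ≤ ‖v‖ * M * (TV Ω q).toReal := by
    intro s hs
    have e3 : fderiv ℝ G (-(s • v)) (-v) =
        ∫ x in Ω, q x * fderiv ℝ (fun t => θ (t + s • v)) x v := by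
      rw [hG, fderiv_avg hfi.locallyIntegrable h1' h2', avg, ← integral_indicator hΩ]
      congr 1
      ext t
      have e4 : fderiv ℝ θ' (-(s • v) - t) (-v) = fderiv ℝ θ (t + s • v) v := by
        have : HasFDerivAt θ' ((fderiv ℝ θ (t + s • v)).comp
            (-ContinuousLinearMap.id ℝ (Eucl d))) (-(s • v) - t) := by
          refine HasFDerivAt.comp _ ?_ (hasFDerivAt_id _).fun_neg
          rw [show - (-(s • v) - t) = t + s • v by abel]
          exact (hθd _).hasFDerivAt
        rw [this.fderiv]
        simp
      simp only [e4, fderiv_comp_add_right]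
      by_cases ht : t ∈ Ω <;> simp [hf, ht]
    rw [e3, Real.norm_eq_abs]
    have hco : HasCompactSupport fun t => θ (t + s • v) :=
      h2.comp_homeomorph (Homeomorph.addRight (s • v))
    refine abs_integral_mul_fderiv_le hTV hM (h1.comp (contDiff_id.add contDiff_const)) hco ?_
      (fun x => h4 _) v
    intro t ht
    have ht' : t + s • v ∈ tsupport θ := by
      have := tsupport_comp_subset_preimage θ (f := fun t => t + s • v) (by fun_prop) ht
      exact this
    have := h3 _ ht' s ⟨hs.1, hs.2.le⟩
    simpa using this
  have key := norm_image_sub_le_of_norm_deriv_le_segment' (f := fun s : ℝ => G (-(s • v)))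
    (a := 0) (b := 1) (fun s _ => (hderiv s).hasDerivWithinAt) hb 1 (by simp)
  simpa using key

/-- Duality estimate for the error of the averages of a function of bounded variation. -/
lemma abs_integral_avg_sub_mul_le (hq : IntegrableOn q Ω) (hΩ : MeasurableSet Ω)
    (hTV : TV Ω q ≠ ⊤) {M R : ℝ} (hM : 0 ≤ M) (hk : Continuous k) (hkc : HasCompactSupport k)
    (hk0 : ∀ u, 0 ≤ k u) (hk1 : ∫ u, k u = 1) (hR : ∀ u, k u ≠ 0 → ‖u‖ ≤ R)
    (h1 : ContDiff ℝ 1 θ) (h2 : HasCompactSupport θ) (h4 : ∀ x, |θ x| ≤ M)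
    (h3 : ∀ u, k u ≠ 0 → ∀ x ∈ tsupport θ, ∀ s ∈ Icc (0 : ℝ) 1, x - s • u ∈ Ω) :
    |∫ x, (avg k (Ω.indicator q) x - Ω.indicator q x) * θ x| ≤ R * M * (TV Ω q).toReal := by
  set f := Ω.indicator q with hf
  have hfi : Integrable f := (integrable_indicator_iff hΩ).2 hq
  have hki : Integrable k := hk.integrable_of_hasCompactSupport hkc
  obtain ⟨C, hC⟩ := h1.continuous.bounded_above_of_compact_support h2
  have hfθ : Integrable fun x => f x * θ x :=
    hfi.mul_bdd (c := C) h1.continuous.aestronglyMeasurable (Eventually.of_forall hC)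
  have haθ : Integrable fun x => avg k f x * θ x := by
    have h5 : Integrable (avg k f) := by
      rw [avg_eq_convolution]
      exact hfi.integrable_convolution _ hki
    exact h5.mul_bdd (c := C) h1.continuous.aestronglyMeasurable (Eventually.of_forall hC)
  have hGi : Integrable fun u => k u * ∫ t, f t * θ (t + u) := by
    have h6 := (integrable_pairing hfi hk hkc h1.continuous h2).swap.integral_prod_left
    simp only [Function.comp_def, Prod.swap, mul_left_comm (f _)] at h6
    simpa only [integral_const_mul] using h6
  simp only [sub_mul]
  rw [integral_sub haθ hfθ, integral_avg_mul hfi hk hkc h1.continuous h2,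
    integral_mul_coavg hfi hk hkc h1.continuous h2]
  -- As `k` has integral one, the error is the `k`-mean of the errors made by the single
  -- translations.
  have e1 : ∫ t, f t * θ t = ∫ u, k u * ∫ t, f t * θ t := by
    rw [integral_mul_const, hk1, one_mul]
  rw [e1, ← integral_sub hGi (hki.mul_const _), ← Real.norm_eq_abs]
  have e2 : R * M * (TV Ω q).toReal = ∫ u, k u * (R * M * (TV Ω q).toReal) := by
    rw [integral_mul_const, hk1, one_mul]
  rw [e2]
  refine norm_integral_le_of_norm_le (hki.mul_const _) (Eventually.of_forall fun u => ?_)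
  rw [← mul_sub, norm_mul, Real.norm_of_nonneg (hk0 u)]
  by_cases hu : k u = 0
  · simp [hu]
  refine mul_le_mul_of_nonneg_left ?_ (hk0 u)
  refine (abs_integral_translate_sub_le hq hΩ hTV hM h1 h2 h4 u (h3 u hu)).trans ?_
  gcongr
  exact hR u hu

end Averages

end TVFEM

namespace TVFEM

/-! ### The `L¹` norm by duality with smooth functions. -/

section AverageBounds

variable {d : ℕ} {Ω : Set (Eucl d)} {q f g : Eucl d → ℝ} {k θ : Eucl d → ℝ}

lemma abs_avg_le {B : ℝ} (hf : ∀ t, |f t| ≤ B) (hk : Integrable k) (x : Eucl d) :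
    |avg k f x| ≤ B * ∫ u, |k u| := by
  rw [avg_eq_swap, ← integral_const_mul, ← Real.norm_eq_abs]
  refine norm_integral_le_of_norm_le (hk.abs.const_mul _) (Eventually.of_forall fun u => ?_)
  rw [norm_mul]
  exact mul_le_mul_of_nonneg_right (hf _) (abs_nonneg _)

lemma exists_of_avg_ne_zero {x : Eucl d} (h : avg k f x ≠ 0) : ∃ u, k u ≠ 0 ∧ f (x - u) ≠ 0 := by
  by_contra! hcon
  refine h ?_
  rw [avg_eq_swap]
  refine integral_eq_zero_of_ae (Eventually.of_forall fun u => ?_)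
  by_cases hu : k u = 0
  · simp [hu]
  · simp [hcon u hu]

/-- Mollifications of `σ` are admissible tests. They converge to `σ` almost everywhere by Lebesgue
differentiation, and the integrands are dominated by `|g|`. -/
lemma integral_mul_le_of_forall_test {σ : Eucl d → ℝ} {C : ℝ} (hΩo : IsOpen Ω)
    (hg : IntegrableOn g Ω)
    (h : ∀ θ : Eucl d → ℝ, ContDiff ℝ 1 θ → HasCompactSupport θ → tsupport θ ⊆ Ω →
      (∀ x, |θ x| ≤ 1) → ∫ x in Ω, g x * θ x ≤ C)
    (hσm : Measurable σ) (hσ : ∀ x, |σ x| ≤ 1) {K : Set (Eucl d)} (hK : IsCompact K)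
    (hKΩ : K ⊆ Ω) (hσK : ∀ x ∉ K, σ x = 0) : ∫ x in Ω, g x * σ x ≤ C := by
  obtain ⟨δ, hδ, hδΩ⟩ := hK.exists_cthickening_subset_open hΩo hKΩ
  -- Outer radii at most `δ` keep the supports in `Ω`; the fixed ratio 2 of the radii is what the
  -- differentiation theorem asks for.
  set φ : ℕ → ContDiffBump (0 : Eucl d) := fun n =>
    ⟨δ / (n + 1) / 2, δ / (n + 1), by positivity, half_lt_self (by positivity)⟩ with hφ
  have hσi : Integrable σ := by
    have h1 : IntegrableOn σ K := by
      refine Measure.integrableOn_of_bounded (M := 1) hK.measure_lt_top.ne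
        hσm.aestronglyMeasurable (Eventually.of_forall hσ)
    rw [← integrable_indicator_iff hK.measurableSet] at h1
    have h2 : K.indicator σ = σ := by
      ext x
      by_cases hx : x ∈ K <;> simp [hx, hσK]
    rwa [h2] at h1
  have hlim : Tendsto (fun n => (φ n).rOut) atTop (𝓝 0) := by
    have h2 := tendsto_one_div_add_atTop_nhds_zero_nat (𝕜 := ℝ)
    simpa [hφ, div_eq_mul_inv] using h2.const_mul δ
  have hae := ContDiffBump.ae_convolution_tendsto_right_of_locallyIntegrable (K := 2) hlim
    (Eventually.of_forall fun n => by simp only [hφ]; linarith) (hσi.locallyIntegrable)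
  have heq : ∀ n x, MeasureTheory.convolution ((φ n).normed volume) σ
      (ContinuousLinearMap.lsmul ℝ ℝ) volume x = avg ((φ n).normed volume) σ x := by
    intro n x
    rw [avg_eq_swap]
    simp [MeasureTheory.convolution, mul_comm]
  simp only [heq] at hae
  have hb : ∀ n x, |avg ((φ n).normed volume) σ x| ≤ 1 := by
    intro n x
    have h3 := abs_avg_le hσ ((φ n).integrable_normed (μ := volume)) x
    simpa only [abs_of_nonneg ((φ n).nonneg_normed _), (φ n).integral_normed, one_mul] using h3
  have hsm : ∀ n, ContDiff ℝ 1 (avg ((φ n).normed volume) σ) := fun n =>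
    contDiff_avg (n := 1) hσi.locallyIntegrable (φ n).contDiff_normed
      (φ n).hasCompactSupport_normed
  have hts : ∀ n, Function.support (avg ((φ n).normed volume) σ) ⊆ Metric.cthickening δ K := by
    intro n x hx
    obtain ⟨u, hu, hxu⟩ := exists_of_avg_ne_zero hx
    have hu' : u ∈ Function.support ((φ n).normed volume) := hu
    rw [(φ n).support_normed_eq, mem_ball_zero_iff] at hu'
    have hmem : x - u ∈ K := by
      by_contra hcon
      exact hxu (hσK _ hcon)
    refine Metric.mem_cthickening_of_dist_le x (x - u) δ K hmem ?_
    rw [dist_eq_norm, sub_sub_cancel]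
    refine hu'.le.trans ?_
    simp only [hφ]
    exact div_le_self hδ.le (by linarith [Nat.cast_nonneg (α := ℝ) n])
  have hKδ : IsCompact (Metric.cthickening δ K) := hK.cthickening
  have hle : ∀ n, ∫ x in Ω, g x * avg ((φ n).normed volume) σ x ≤ C := fun n =>
    h _ (hsm n) (HasCompactSupport.of_support_subset_isCompact hKδ (hts n))
      ((closure_minimal (hts n) hKδ.isClosed).trans hδΩ) (hb n)
  refine le_of_tendsto' (x := atTop)
    (f := fun n => ∫ x in Ω, g x * avg ((φ n).normed volume) σ x) ?_ hle
  refine tendsto_integral_of_dominated_convergence (fun x => |g x|)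
    (fun n => hg.aestronglyMeasurable.mul (hsm n).continuous.aestronglyMeasurable) hg.abs
    (fun n => Eventually.of_forall fun x => ?_) ?_
  · rw [norm_mul, Real.norm_eq_abs, Real.norm_eq_abs]
    exact mul_le_of_le_one_right (abs_nonneg _) (hb n x)
  · filter_upwards [ae_restrict_of_ae hae] with x hx
    exact hx.const_mul _

/-- The `L¹` norm on a bounded open set is determined by duality with smooth functions with compact
support. -/
lemma integral_abs_le_of_forall_test {C : ℝ} (hΩo : IsOpen Ω) (hΩb : Bornology.IsBounded Ω)
    (hg : IntegrableOn g Ω)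
    (h : ∀ θ : Eucl d → ℝ, ContDiff ℝ 1 θ → HasCompactSupport θ → tsupport θ ⊆ Ω →
      (∀ x, |θ x| ≤ 1) → ∫ x in Ω, g x * θ x ≤ C) : ∫ x in Ω, |g x| ≤ C := by
  obtain ⟨F, hFc, hFΩ, hFU, hFm⟩ := hΩo.exists_iUnion_isClosed
  have hlim := tendsto_setIntegral_of_monotone (f := fun x => |g x|) (μ := volume)
    (fun n => (hFc n).measurableSet) hFm (by rw [hFU]; exact hg.abs)
  rw [hFU] at hlim
  refine le_of_tendsto' hlim fun n => ?_
  obtain ⟨g', hg'm, hgg'⟩ := hg.aestronglyMeasurable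
  have hKc : IsCompact (F n) := Metric.isCompact_of_isClosed_isBounded (hFc n) (hΩb.subset (hFΩ n))
  -- The sign of `g`, cut off to a compact member of an exhaustion of `Ω`; the representative `g'`
  -- makes it measurable.
  set σ : Eucl d → ℝ := (F n).indicator (fun x => if 0 ≤ g' x then 1 else -1) with hσ
  have hσm : Measurable σ := Measurable.indicator
    (Measurable.ite (hg'm.measurable measurableSet_Ici) measurable_const measurable_const)
    (hFc n).measurableSet
  have key := integral_mul_le_of_forall_test (σ := σ) hΩo hg h hσm (fun x => by
    by_cases hx : x ∈ F n
    · simp only [hσ, hx, indicator_of_mem]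
      split_ifs <;> simp
    · simp [hσ, hx]) hKc (hFΩ n) (fun x hx => by simp [hσ, hx])
  refine le_trans (le_of_eq ?_) key
  have e1 : ∫ x in Ω, g x * σ x = ∫ x in Ω, (F n).indicator (fun x => |g x|) x := by
    refine integral_congr_ae ?_
    filter_upwards [hgg'] with x hx
    by_cases hxF : x ∈ F n
    · simp only [hσ, hxF, indicator_of_mem, hx]
      split_ifs with h0
      · rw [abs_of_nonneg h0, mul_one]
      · rw [abs_of_neg (not_le.1 h0), mul_neg_one]
    · simp [hσ, hxF]
  rw [e1, setIntegral_indicator (hFc n).measurableSet, inter_eq_self_of_subset_right (hFΩ n)]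

end AverageBounds

/-! ### Shifted and rescaled mollifiers. -/

section Kernel

variable {d : ℕ} {w : Eucl d} {ε : ℝ}

/-- A smooth nonnegative function of integral one supported in the unit ball. -/
noncomputable def mollifier (d : ℕ) : Eucl d → ℝ :=
  (⟨1 / 2, 1, by norm_num, by norm_num⟩ : ContDiffBump (0 : Eucl d)).normed volume

lemma contDiff_mollifier : ContDiff ℝ ∞ (mollifier d) := ContDiffBump.contDiff_normed _

lemma hasCompactSupport_mollifier : HasCompactSupport (mollifier d) :=
  ContDiffBump.hasCompactSupport_normed _

lemma norm_le_one_of_mollifier_ne_zero {x : Eucl d} (hx : mollifier d x ≠ 0) : ‖x‖ ≤ 1 := by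
  have h : x ∈ Function.support (mollifier d) := hx
  rw [mollifier, ContDiffBump.support_normed_eq, mem_ball_zero_iff] at h
  exact h.le

lemma exists_mollifier_lipschitz (d : ℕ) :
    ∃ L : ℝ, 0 < L ∧ ∀ x y, |mollifier d x - mollifier d y| ≤ L * ‖x - y‖ := by
  obtain ⟨C, hC⟩ := (contDiff_mollifier (d := d)).lipschitzWith_of_hasCompactSupport
    hasCompactSupport_mollifier (by simp)
  refine ⟨C + 1, by positivity, fun x y => ?_⟩
  have := hC.norm_sub_le x y
  rw [Real.norm_eq_abs] at this
  refine this.trans ?_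
  gcongr
  simp

/-- The mollifier rescaled to size `ε` and shifted: averages with respect to it involve
the values at the points `x + ε • z` with `z` in the unit ball around `w`. -/
noncomputable def kernel (w : Eucl d) (ε : ℝ) (u : Eucl d) : ℝ :=
  (ε ^ d)⁻¹ * mollifier d (ε⁻¹ • u + w)

lemma contDiff_kernel : ContDiff ℝ ∞ (kernel w ε) := by
  unfold kernel
  exact contDiff_const.mul (contDiff_mollifier.comp (by fun_prop))

lemma kernel_nonneg (hε : 0 < ε) (u : Eucl d) : 0 ≤ kernel w ε u :=
  mul_nonneg (by positivity) (ContDiffBump.nonneg_normed _ _)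

lemma integral_kernel (hε : 0 < ε) : ∫ u, kernel w ε u = 1 := by
  unfold kernel
  rw [integral_const_mul, Measure.integral_comp_inv_smul volume
    (fun x => mollifier d (x + w)) ε, integral_add_right_eq_self (mollifier d) w]
  have : ∫ x, mollifier d x = 1 := ContDiffBump.integral_normed _
  rw [this, finrank_euclideanSpace, Fintype.card_fin, abs_of_pos (by positivity)]
  simp [hε.ne']

/-- The average at `x` evaluates the kernel at `u = x - t`; hence the minus sign: the points `t`
involved are `x + ε • z` with `z` near `w`. -/
lemma exists_of_mem_tsupport_kernel (hε : 0 < ε) {u : Eucl d}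
    (hu : u ∈ tsupport (kernel w ε)) :
    ∃ z ∈ Metric.closedBall w 1, u = -(ε • z) := by
  have hcl : IsClosed {u : Eucl d | ‖ε⁻¹ • u + w‖ ≤ 1} :=
    isClosed_le (by fun_prop) continuous_const
  have hsub : Function.support (kernel w ε) ⊆ {u : Eucl d | ‖ε⁻¹ • u + w‖ ≤ 1} := by
    intro u hu
    exact norm_le_one_of_mollifier_ne_zero (right_ne_zero_of_mul hu)
  have h := closure_minimal hsub hcl hu
  refine ⟨-(ε⁻¹ • u), ?_, ?_⟩
  · rw [mem_closedBall_iff_norm, norm_sub_rev, sub_neg_eq_add, add_comm]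
    exact h
  · rw [smul_neg, neg_neg, smul_smul, mul_inv_cancel₀ hε.ne', one_smul]

lemma exists_of_kernel_ne_zero (hε : 0 < ε) {u : Eucl d} (hu : kernel w ε u ≠ 0) :
    ∃ z ∈ Metric.closedBall w 1, u = -(ε • z) :=
  exists_of_mem_tsupport_kernel hε (subset_tsupport _ hu)

lemma norm_le_of_mem_closedBall {z : Eucl d} {r : ℝ} (hz : z ∈ Metric.closedBall w r) :
    ‖z‖ ≤ ‖w‖ + r := by
  rw [mem_closedBall_iff_norm] at hz
  linarith [norm_sub_norm_le z w]

lemma norm_le_of_mem_tsupport_kernel (hε : 0 < ε) {u : Eucl d}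
    (hu : u ∈ tsupport (kernel w ε)) : ‖u‖ ≤ ε * (‖w‖ + 1) := by
  obtain ⟨z, hz, rfl⟩ := exists_of_mem_tsupport_kernel hε hu
  rw [norm_neg, norm_smul, Real.norm_of_nonneg hε.le]
  gcongr
  exact norm_le_of_mem_closedBall hz

lemma norm_le_of_kernel_ne_zero (hε : 0 < ε) {u : Eucl d}
    (hu : kernel w ε u ≠ 0) : ‖u‖ ≤ ε * (‖w‖ + 1) :=
  norm_le_of_mem_tsupport_kernel hε (subset_tsupport _ hu)

lemma hasCompactSupport_kernel (hε : 0 < ε) : HasCompactSupport (kernel w ε) := by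
  refine HasCompactSupport.of_support_subset_isCompact
    (isCompact_closedBall (0 : Eucl d) (ε * (‖w‖ + 1))) fun u hu => ?_
  rw [mem_closedBall_zero_iff]
  exact norm_le_of_kernel_ne_zero hε hu

lemma integrable_kernel (hε : 0 < ε) : Integrable (kernel w ε) :=
  contDiff_kernel.continuous.integrable_of_hasCompactSupport (hasCompactSupport_kernel hε)

lemma abs_kernel_sub_le {L : ℝ}
    (hL : ∀ x y, |mollifier d x - mollifier d y| ≤ L * ‖x - y‖) (hε : 0 < ε) (u v : Eucl d) :
    |kernel w ε u - kernel w ε v| ≤ L * (ε ^ (d + 1))⁻¹ * ‖u - v‖ := by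
  unfold kernel
  rw [← mul_sub, abs_mul, abs_of_pos (by positivity : 0 < (ε ^ d)⁻¹)]
  have h := hL (ε⁻¹ • u + w) (ε⁻¹ • v + w)
  rw [add_sub_add_right_eq_sub, ← smul_sub, norm_smul, norm_inv, Real.norm_of_nonneg hε.le] at h
  calc (ε ^ d)⁻¹ * |mollifier d (ε⁻¹ • u + w) - mollifier d (ε⁻¹ • v + w)|
      ≤ (ε ^ d)⁻¹ * (L * (ε⁻¹ * ‖u - v‖)) := by gcongr
    _ = L * (ε ^ (d + 1))⁻¹ * ‖u - v‖ := by rw [pow_succ, mul_inv]; ring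

/-- The averages of a bounded function are Lipschitz with a constant of order `ε⁻¹`. -/
lemma exists_integral_abs_fderiv_kernel_le (d : ℕ) :
    ∃ C : ℝ, 0 < C ∧ ∀ (w : Eucl d) (ε : ℝ), 0 < ε → ∀ v : Eucl d,
      ∫ u, |fderiv ℝ (kernel w ε) u v| ≤ C * ε⁻¹ * ‖v‖ := by
  have hc : Continuous fun u => ‖fderiv ℝ (mollifier d) u‖ :=
    ((contDiff_mollifier (d := d)).continuous_fderiv (by simp)).norm
  have hi : Integrable fun u => ‖fderiv ℝ (mollifier d) u‖ :=
    hc.integrable_of_hasCompactSupport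
      ((hasCompactSupport_mollifier (d := d)).fderiv (𝕜 := ℝ)).norm
  refine ⟨(∫ u, ‖fderiv ℝ (mollifier d) u‖) + 1, by positivity, fun w ε hε v => ?_⟩
  have hd : ∀ u, fderiv ℝ (kernel w ε) u v =
      (ε ^ d)⁻¹ * (ε⁻¹ * fderiv ℝ (mollifier d) (ε⁻¹ • u + w) v) := by
    intro u
    have h1 : HasFDerivAt (fun u : Eucl d => ε⁻¹ • u + w)
        (ε⁻¹ • ContinuousLinearMap.id ℝ (Eucl d)) u :=
      ((hasFDerivAt_id u).fun_const_smul ε⁻¹).add_const w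
    have h2 := (((contDiff_mollifier (d := d)).differentiable (by simp)
      (ε⁻¹ • u + w)).hasFDerivAt.comp u h1).const_mul (ε ^ d)⁻¹
    have h3 : HasFDerivAt (kernel w ε) _ u := h2
    rw [h3.fderiv]
    simp
  have hle : ∀ u, |fderiv ℝ (kernel w ε) u v| ≤
      (ε ^ d)⁻¹ * (ε⁻¹ * ‖v‖) * ‖fderiv ℝ (mollifier d) (ε⁻¹ • u + w)‖ := by
    intro u
    rw [hd, abs_mul, abs_mul, abs_of_pos (by positivity : 0 < (ε ^ d)⁻¹),
      abs_of_pos (by positivity : 0 < ε⁻¹), mul_assoc, mul_assoc]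
    gcongr
    rw [mul_comm]
    exact (fderiv ℝ (mollifier d) (ε⁻¹ • u + w)).le_opNorm v
  have hi2 : Integrable fun u => (ε ^ d)⁻¹ * (ε⁻¹ * ‖v‖) *
      ‖fderiv ℝ (mollifier d) (ε⁻¹ • u + w)‖ :=
    ((hi.comp_add_right w).comp_smul (inv_ne_zero hε.ne')).const_mul _
  refine (integral_mono_of_nonneg (Eventually.of_forall fun u => abs_nonneg _) hi2
    (Eventually.of_forall hle)).trans ?_
  rw [integral_const_mul, Measure.integral_comp_inv_smul volume
    (fun x => ‖fderiv ℝ (mollifier d) (x + w)‖) ε,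
    integral_add_right_eq_self (fun x => ‖fderiv ℝ (mollifier d) x‖) w,
    finrank_euclideanSpace, Fintype.card_fin, abs_of_pos (by positivity : 0 < ε ^ d), smul_eq_mul]
  rw [show (ε ^ d)⁻¹ * (ε⁻¹ * ‖v‖) * (ε ^ d * ∫ x, ‖fderiv ℝ (mollifier d) x‖) =
    (∫ x, ‖fderiv ℝ (mollifier d) x‖) * ε⁻¹ * ‖v‖ by field_simp]
  gcongr
  linarith

end Kernel

/-! ### Inward directions on a Lipschitz domain. -/

section Cover

variable {d : ℕ} {Ω : Set (Eucl d)}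

/-- A finite smooth partition of unity on the closure of `Ω`, and for each of its members a
direction such that the points of the support can be moved into `Ω` along all vectors close to it,
by a uniform amount. -/
structure InwardCover (Ω : Set (Eucl d)) (ι : Type) [Fintype ι] where
  /-- the partition of unity -/
  ψ : ι → Eucl d → ℝ
  /-- the directions -/
  w : ι → Eucl d
  /-- the maximal size of the translations -/
  ε₀ : ℝ
  pos : 0 < ε₀
  contDiff : ∀ j, ContDiff ℝ ∞ (ψ j)
  hasCompactSupport : ∀ j, HasCompactSupport (ψ j)
  nonneg : ∀ j x, 0 ≤ ψ j x
  sum_le_one : ∀ x, ∑ j, ψ j x ≤ 1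
  sum_eq_one : ∀ x ∈ closure Ω, ∑ j, ψ j x = 1
  -- The kernels need only radius 1; radius 2 leaves room for changing the base point by at most
  -- `s`.
  inward : ∀ j, ∀ x ∈ closure Ω, x ∈ tsupport (ψ j) → ∀ s ∈ Ioc (0 : ℝ) ε₀,
    ∀ z ∈ Metric.closedBall (w j) 2, x + s • z ∈ Ω

/-- The uniform interior cone property of domains with a Lipschitz boundary. -/
lemma exists_local_cone (hΩo : IsOpen Ω) (hΩ : HasLipschitzBoundary Ω) {x : Eucl d}
    (hx : x ∈ closure Ω) :
    ∃ (r s₀ : ℝ) (w : Eucl d), 0 < r ∧ 0 < s₀ ∧ ∀ y ∈ closure Ω, y ∈ Metric.ball x r →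
      ∀ s ∈ Ioc (0 : ℝ) s₀, ∀ z ∈ Metric.closedBall w 2, y + s • z ∈ Ω := by
  by_cases hxΩ : x ∈ Ω
  · obtain ⟨r, hr, hrΩ⟩ := Metric.isOpen_iff.1 hΩo x hxΩ
    refine ⟨r / 2, r / 4, 0, by positivity, by positivity, fun y _ hy s hs z hz => hrΩ ?_⟩
    rw [mem_ball_iff_norm] at hy ⊢
    rw [mem_closedBall_zero_iff] at hz
    calc ‖y + s • z - x‖ = ‖(y - x) + s • z‖ := by congr 1; abel
      _ ≤ ‖y - x‖ + ‖s • z‖ := norm_add_le _ _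
      _ = ‖y - x‖ + s * ‖z‖ := by rw [norm_smul, Real.norm_of_nonneg hs.1.le]
      _ ≤ ‖y - x‖ + r / 4 * 2 := by gcongr; exact hs.2
      _ < r := by linarith
  · have hxf : x ∈ frontier Ω := ⟨hx, by rwa [hΩo.interior_eq]⟩
    obtain ⟨ν, r, L, φ, hν, hr, hφ, hφν, hΩr⟩ := hΩ x hxf
    -- Moving by `s • z` with `‖z - c • ν‖ ≤ 2` raises `φ` by at most `2 L s` and the height along
    -- `ν` by at least `(c - 2) s = (2 L + 1) s`. The weak inequality valid on the closure thus
    -- becomes strict.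
    set c : ℝ := 2 * L + 3 with hc
    have hc0 : 0 < c := by positivity
    refine ⟨r / 2, r / (2 * (c + 2)), c • ν, by positivity, by positivity,
      fun y hyc hy s hs z hz => ?_⟩
    have hyr : φ y ≤ inner ℝ ν y := by
      have h1 : y ∈ closure (Metric.ball x r ∩ Ω) :=
        Metric.isOpen_ball.inter_closure ⟨Metric.ball_subset_ball (by linarith) hy, hyc⟩
      have h2 : IsClosed {y : Eucl d | φ y ≤ inner ℝ ν y} :=
        isClosed_le hφ.continuous (by fun_prop)
      refine closure_minimal (fun z hz => ?_) h2 h1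
      exact ((hΩr z hz.1).1 hz.2).le
    have hs0 := hs.1
    have hzn : ‖z - c • ν‖ ≤ 2 := mem_closedBall_iff_norm.1 hz
    have hzb : ‖z‖ ≤ c + 2 := by
      have := norm_le_of_mem_closedBall hz
      rwa [norm_smul, hν, mul_one, Real.norm_of_nonneg hc0.le] at this
    have hball : y + s • z ∈ Metric.ball x r := by
      rw [mem_ball_iff_norm] at hy ⊢
      calc ‖y + s • z - x‖ = ‖(y - x) + s • z‖ := by congr 1; abel
        _ ≤ ‖y - x‖ + ‖s • z‖ := norm_add_le _ _
        _ = ‖y - x‖ + s * ‖z‖ := by rw [norm_smul, Real.norm_of_nonneg hs0.le]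
        _ ≤ ‖y - x‖ + r / (2 * (c + 2)) * (c + 2) := by gcongr; exact hs.2
        _ = ‖y - x‖ + r / 2 := by field_simp
        _ < r := by linarith
    rw [hΩr _ hball]
    have e1 : y + s • z = (y + s • (z - c • ν)) + (s * c) • ν := by
      rw [smul_sub, smul_smul]; abel
    have h3 : φ (y + s • z) ≤ φ y + L * (s * 2) := by
      rw [e1, hφν]
      have h4 := hφ.norm_sub_le (y + s • (z - c • ν)) y
      rw [add_sub_cancel_left, norm_smul, Real.norm_of_nonneg hs0.le, Real.norm_eq_abs] at h4
      have h5 := (le_abs_self _).trans h4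
      have h6 : (L : ℝ) * (s * ‖z - c • ν‖) ≤ L * (s * 2) := by gcongr
      linarith
    have h7 : inner ℝ ν y + s * c - s * 2 ≤ inner ℝ ν (y + s • z) := by
      rw [e1, inner_add_right, inner_add_right, inner_smul_right, inner_smul_right,
        real_inner_self_eq_norm_sq, hν]
      have h8 : |inner ℝ ν (z - c • ν)| ≤ 2 := by
        refine (abs_real_inner_le_norm _ _).trans ?_
        rw [hν, one_mul]
        exact hzn
      have h9 : s * (-2) ≤ s * inner ℝ ν (z - c • ν) := by
        gcongr
        exact (abs_le.1 h8).1
      linarith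
    have h10 : s * c = s * (2 * L + 3) := rfl
    nlinarith

/-- By compactness finitely many local cones suffice; the partition of unity is subordinate to their
balls, and `ε₀` is at most each of their heights. -/
theorem exists_inwardCover (hΩo : IsOpen Ω) (hΩb : Bornology.IsBounded Ω)
    (hΩ : HasLipschitzBoundary Ω) :
    ∃ (ι : Type) (_ : Fintype ι), Nonempty (InwardCover Ω ι) := by
  have hc : IsCompact (closure Ω) := hΩb.isCompact_closure
  choose! r s₀ w hr hs₀ hcone using fun x (hx : x ∈ closure Ω) => exists_local_cone hΩo hΩ hx
  obtain ⟨t, ht, htc⟩ := hc.elim_nhds_subcover (fun x => Metric.ball x (r x))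
    fun x hx => Metric.ball_mem_nhds x (hr x hx)
  obtain ⟨ρ, hρ⟩ := SmoothPartitionOfUnity.exists_isSubordinate (ι := t)
    (modelWithCornersSelf ℝ (Eucl d)) isClosed_closure
    (fun x => Metric.ball (x : Eucl d) (r x)) (fun x => Metric.isOpen_ball)
    (htc.trans fun x hx => by simpa using hx)
  have hε : ∃ ε₀ : ℝ, 0 < ε₀ ∧ ∀ x : t, ε₀ ≤ s₀ x := by
    have h1 : ∀ x : t, ∀ᶠ e in 𝓝[>] (0 : ℝ), e ≤ s₀ x := fun x =>
      nhdsWithin_le_nhds (Iic_mem_nhds (hs₀ x (ht x x.2)))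
    obtain ⟨e, he, he0⟩ := ((eventually_all.2 h1).and self_mem_nhdsWithin).exists
    exact ⟨e, he0, he⟩
  obtain ⟨ε₀, hε₀, hεs⟩ := hε
  refine ⟨t, inferInstance, ⟨{
    ψ := fun j => ρ j
    w := fun j => w j
    ε₀ := ε₀
    pos := hε₀
    contDiff := fun j => (ρ j).contMDiff.contDiff
    hasCompactSupport := fun j =>
      (Metric.isBounded_ball.subset (hρ j)).isCompact_closure.of_isClosed_subset
        (isClosed_tsupport _) subset_closure
    nonneg := fun j x => ρ.nonneg j x
    sum_le_one := fun x => by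
      rw [← finsum_eq_sum_of_fintype]
      exact ρ.sum_le_one x
    sum_eq_one := fun x hx => by
      rw [← finsum_eq_sum_of_fintype]
      exact ρ.sum_eq_one hx
    inward := fun j x hx hxj s hs z hz =>
      hcone j (ht j j.2) x hx (hρ j hxj) s ⟨hs.1, hs.2.trans (hεs j)⟩ z hz }⟩⟩

end Cover

end TVFEM

namespace TVFEM

/-! ### Divergence of products, sums and averaged fields. -/

section DivergenceCalculus

variable {d : ℕ} {Ξ : Eucl d → Eucl d} {ψ k : Eucl d → ℝ}

lemma sum_apply_smul_single (v : Eucl d) :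
    ∑ i, v i • EuclideanSpace.single i (1 : ℝ) = v := by
  ext j
  simp [Finset.sum_apply, Pi.single_apply]

lemma norm_le_sum_abs (v : Eucl d) : ‖v‖ ≤ ∑ i, |v i| := by
  conv_lhs => rw [← sum_apply_smul_single v]
  refine (norm_sum_le _ _).trans (Finset.sum_le_sum fun i _ => ?_)
  simp [norm_smul]

lemma norm_le_card {v : Eucl d} {M : ℝ} (hv : ∀ i, |v i| ≤ M) : ‖v‖ ≤ d * M := by
  refine (norm_le_sum_abs v).trans ((Finset.sum_le_sum fun i _ => hv i).trans ?_)
  simp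

lemma divergence_smul (hψ : ContDiff ℝ 1 ψ) (hΞ : ContDiff ℝ 1 Ξ) (x : Eucl d) :
    divergence (fun y => ψ y • Ξ y) x = ψ x * divergence Ξ x + fderiv ℝ ψ x (Ξ x) := by
  have h1 := ((hψ.differentiable one_ne_zero) x).hasFDerivAt
  have h2 := ((hΞ.differentiable one_ne_zero) x).hasFDerivAt
  have h3 : HasFDerivAt (fun y => ψ y • Ξ y) _ x := h1.smul h2
  unfold divergence
  rw [h3.fderiv]
  conv_rhs => rw [← sum_apply_smul_single (Ξ x), map_sum, Finset.mul_sum, ← Finset.sum_add_distrib]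
  refine Finset.sum_congr rfl fun i _ => ?_
  simp [mul_comm]

lemma divergence_sum {ι : Type*} [Fintype ι] {Φ : ι → Eucl d → Eucl d}
    (hΦ : ∀ j, ContDiff ℝ 1 (Φ j)) (x : Eucl d) :
    divergence (fun y => ∑ j, Φ j y) x = ∑ j, divergence (Φ j) x := by
  unfold divergence
  rw [fderiv_fun_sum fun j _ => (hΦ j).differentiable one_ne_zero x, Finset.sum_comm]
  simp

lemma integrable_coavg (hk : Continuous k) (hkc : HasCompactSupport k)
    {F : Type*} [NormedAddCommGroup F] [NormedSpace ℝ F] {Φ : Eucl d → F} (hΦ : Continuous Φ)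
    (t : Eucl d) : Integrable fun u => k u • Φ (t + u) :=
  (by fun_prop : Continuous fun u => k u • Φ (t + u)).integrable_of_hasCompactSupport
    hkc.smul_right

lemma divergence_coavg (hk : Continuous k) (hkc : HasCompactSupport k) (hΞ : ContDiff ℝ 1 Ξ)
    (hΞc : HasCompactSupport Ξ) (t : Eucl d) :
    divergence (coavg k Ξ) t = coavg k (divergence Ξ) t := by
  have hd := hΞ.continuous_fderiv one_ne_zero
  conv_lhs => unfold divergence
  conv_rhs => unfold coavg divergence
  simp only [Finset.smul_sum]
  rw [integral_finsetSum]
  · refine Finset.sum_congr rfl fun i _ => ?_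
    rw [fderiv_coavg hk hΞ hΞc, coavg]
    have h := (EuclideanSpace.proj i : Eucl d →L[ℝ] ℝ).integral_comp_comm
      (integrable_coavg hk hkc
        (by fun_prop : Continuous fun x => fderiv ℝ Ξ x (EuclideanSpace.single i 1)) t)
    simpa using h.symm
  · intro i _
    exact integrable_coavg hk hkc (by fun_prop :
      Continuous fun x => (fderiv ℝ Ξ x (EuclideanSpace.single i (1 : ℝ))) i) t

lemma coavg_apply (hk : Continuous k) (hkc : HasCompactSupport k) (hΞ : Continuous Ξ)
    (t : Eucl d) (i : Fin d) : (coavg k Ξ t) i = coavg k (fun x => Ξ x i) t := by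
  have h := (EuclideanSpace.proj i : Eucl d →L[ℝ] ℝ).integral_comp_comm
      (integrable_coavg hk hkc hΞ t)
  simpa [coavg] using h.symm

lemma exists_norm_fderiv_le {ψ : Eucl d → ℝ} (h1 : ContDiff ℝ ∞ ψ) (h2 : HasCompactSupport ψ) :
    ∃ D : ℝ, 0 ≤ D ∧ ∀ x, ‖fderiv ℝ ψ x‖ ≤ D := by
  obtain ⟨C, hC⟩ := (h1.continuous_fderiv (by simp)).bounded_above_of_compact_support
    (h2.fderiv (𝕜 := ℝ))
  exact ⟨C, (norm_nonneg _).trans (hC 0), hC⟩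

lemma abs_sub_le_of_norm_fderiv_le {ψ : Eucl d → ℝ} {D : ℝ} (h1 : ContDiff ℝ 1 ψ)
    (hD : ∀ x, ‖fderiv ℝ ψ x‖ ≤ D) (x y : Eucl d) : |ψ x - ψ y| ≤ D * ‖x - y‖ :=
  (convex_univ).norm_image_sub_le_of_norm_fderiv_le
    (fun z _ => (h1.differentiable one_ne_zero) z) (fun z _ => hD z) (mem_univ y) (mem_univ x)

end DivergenceCalculus

/-! ### The smoothing of a function of bounded variation: range, `L¹` error, total variation. -/

namespace InwardCover

variable {d : ℕ} {Ω : Set (Eucl d)} {ι : Type} [Fintype ι] (c : InwardCover Ω ι)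
  {q : Eucl d → ℝ} {ε : ℝ}

lemma exists_gradient_bound :
    ∃ D : ℝ, 0 ≤ D ∧ ∀ j x, ‖fderiv ℝ (c.ψ j) x‖ ≤ D := by
  choose D hD0 hD using fun j => exists_norm_fderiv_le (c.contDiff j) (c.hasCompactSupport j)
  exact ⟨∑ j, D j, Finset.sum_nonneg fun j _ => hD0 j, fun j x => (hD j x).trans
    (Finset.single_le_sum (fun j _ => hD0 j) (Finset.mem_univ j))⟩

lemma exists_direction_bound : ∃ W : ℝ, 0 ≤ W ∧ ∀ j, ‖c.w j‖ ≤ W :=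
  ⟨∑ j, ‖c.w j‖, Finset.sum_nonneg fun _ _ => norm_nonneg _, fun j =>
    Finset.single_le_sum (f := fun j => ‖c.w j‖) (fun _ _ => norm_nonneg _) (Finset.mem_univ j)⟩

lemma add_mem {j : ι} {x : Eucl d} (hx : x ∈ closure Ω) (hxj : x ∈ tsupport (c.ψ j))
    (hε : 0 < ε) (hε' : ε ≤ c.ε₀) {z : Eucl d} (hz : z ∈ Metric.closedBall (c.w j) 1) :
    x + ε • z ∈ Ω :=
  c.inward j x hx hxj ε ⟨hε, hε'⟩ z (Metric.closedBall_subset_closedBall (by norm_num) hz)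

/-- Here `-(s • u)` is an inward displacement of size `s * ε`; `s = 0` is separate, as the cone
condition concerns positive steps only. This keeps whole paths of translations inside `Ω`. -/
lemma sub_smul_mem {j : ι} {x : Eucl d} (hx : x ∈ Ω) (hxj : x ∈ tsupport (c.ψ j))
    (hε : 0 < ε) (hε' : ε ≤ c.ε₀) {u : Eucl d} (hu : u ∈ tsupport (kernel (c.w j) ε)) {s : ℝ}
    (hs : s ∈ Icc (0 : ℝ) 1) : x - s • u ∈ Ω := by
  obtain ⟨z, hz, rfl⟩ := exists_of_mem_tsupport_kernel hε hu
  rcases hs.1.eq_or_lt with rfl | hs0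
  · simpa using hx
  · rw [smul_neg, sub_neg_eq_add, smul_smul]
    refine c.add_mem (subset_closure hx) hxj (by positivity) ?_ hz
    exact (mul_le_of_le_one_left hε.le hs.2).trans hε'

lemma abs_integral_avg_sub_mul_le (hΩ : IsOpen Ω) (hq : IntegrableOn q Ω) (hTV : TV Ω q ≠ ⊤)
    (hε : 0 < ε) (hε' : ε ≤ c.ε₀) {j : ι} {θ : Eucl d → ℝ} {M : ℝ} (hM : 0 ≤ M)
    (h1 : ContDiff ℝ 1 θ) (h2 : HasCompactSupport θ) (h3 : tsupport θ ⊆ Ω)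
    (h4 : tsupport θ ⊆ tsupport (c.ψ j)) (h5 : ∀ x, |θ x| ≤ M) :
    |∫ x in Ω, (avg (kernel (c.w j) ε) (Ω.indicator q) x - q x) * θ x| ≤
      ε * (‖c.w j‖ + 1) * M * (TV Ω q).toReal := by
  have e1 : ∫ x in Ω, (avg (kernel (c.w j) ε) (Ω.indicator q) x - q x) * θ x =
      ∫ x, (avg (kernel (c.w j) ε) (Ω.indicator q) x - Ω.indicator q x) * θ x := by
    rw [← integral_indicator hΩ.measurableSet]
    congr 1
    ext x
    by_cases hx : x ∈ Ω
    · simp [hx]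
    · have : θ x = 0 := image_eq_zero_of_notMem_tsupport fun h => hx (h3 h)
      simp [hx, this]
  rw [e1]
  exact TVFEM.abs_integral_avg_sub_mul_le hq hΩ.measurableSet hTV hM contDiff_kernel.continuous
    (hasCompactSupport_kernel hε) (kernel_nonneg hε) (integral_kernel hε)
    (fun u hu => norm_le_of_kernel_ne_zero hε hu) h1 h2 h5
    (fun u hu x hx s hs => c.sub_smul_mem (h3 hx) (h4 hx) hε hε' (subset_tsupport _ hu) hs)

/-- The approximation of `q` by smooth functions: averages of `q` over points moved into `Ω`, glued
together by a partition of unity. -/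
noncomputable def smoothing (q : Eucl d → ℝ) (ε : ℝ) (x : Eucl d) : ℝ :=
  ∑ j, c.ψ j x * avg (kernel (c.w j) ε) (Ω.indicator q) x

lemma locallyIntegrable (hΩ : IsOpen Ω) (hq : IntegrableOn q Ω) :
    LocallyIntegrable (Ω.indicator q) :=
  ((integrable_indicator_iff hΩ.measurableSet).2 hq).locallyIntegrable

lemma contDiff_avg_kernel (hΩ : IsOpen Ω) (hq : IntegrableOn q Ω) (hε : 0 < ε) (w : Eucl d) :
    ContDiff ℝ ∞ (avg (kernel w ε) (Ω.indicator q)) :=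
  contDiff_avg (n := ⊤) (locallyIntegrable hΩ hq) contDiff_kernel (hasCompactSupport_kernel hε)

lemma contDiff_smoothing (hΩ : IsOpen Ω) (hq : IntegrableOn q Ω) (hε : 0 < ε) :
    ContDiff ℝ ∞ (c.smoothing q ε) := by
  unfold smoothing
  exact ContDiff.sum fun j _ => (c.contDiff j).mul (contDiff_avg_kernel hΩ hq hε _)

/-- The weights have total mass one and charge only points of `Ω`, where the bounds hold almost
everywhere; the zero extension of `q` is never seen. -/
lemma avg_mem_Icc (hΩ : IsOpen Ω) (hq : IntegrableOn q Ω) {lo hi : ℝ}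
    (hb : ∀ᵐ x ∂(volume.restrict Ω), lo ≤ q x ∧ q x ≤ hi) (hε : 0 < ε) (hε' : ε ≤ c.ε₀) {j : ι}
    {x : Eucl d} (hx : x ∈ closure Ω) (hxj : x ∈ tsupport (c.ψ j)) :
    avg (kernel (c.w j) ε) (Ω.indicator q) x ∈ Icc lo hi := by
  have hki : Integrable fun t => kernel (c.w j) ε (x - t) := (integrable_kernel hε).comp_sub_left x
  have hk1 : ∫ t, kernel (c.w j) ε (x - t) = 1 := by
    rw [integral_sub_left_eq_self, integral_kernel hε]
  have hint : Integrable fun t => Ω.indicator q t * kernel (c.w j) ε (x - t) := by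
    obtain ⟨C, hC⟩ :=
      (contDiff_kernel (w := c.w j) (ε := ε)).continuous.bounded_above_of_compact_support
      (hasCompactSupport_kernel hε)
    refine ((integrable_indicator_iff hΩ.measurableSet).2 hq).mul_bdd (c := C) ?_
      (Eventually.of_forall fun t => hC (x - t))
    exact (contDiff_kernel.continuous.comp (by fun_prop)).aestronglyMeasurable
  have hb' : ∀ᵐ t, lo * kernel (c.w j) ε (x - t) ≤ Ω.indicator q t * kernel (c.w j) ε (x - t) ∧
      Ω.indicator q t * kernel (c.w j) ε (x - t) ≤ hi * kernel (c.w j) ε (x - t) := by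
    rw [ae_restrict_iff' hΩ.measurableSet] at hb
    filter_upwards [hb] with t ht
    by_cases hk : kernel (c.w j) ε (x - t) = 0
    · simp [hk]
    · obtain ⟨z, hz, hzt⟩ := exists_of_kernel_ne_zero hε hk
      have h1 : t = x + ε • z := by rw [← sub_eq_iff_eq_add', ← neg_sub, hzt, neg_neg]
      have htΩ : t ∈ Ω := h1 ▸ c.add_mem hx hxj hε hε' hz
      have h2 := ht htΩ
      rw [indicator_of_mem htΩ]
      exact ⟨mul_le_mul_of_nonneg_right h2.1 (kernel_nonneg hε _),
        mul_le_mul_of_nonneg_right h2.2 (kernel_nonneg hε _)⟩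
  constructor
  · have := integral_mono_ae (hki.const_mul lo) hint (hb'.mono fun t ht => ht.1)
    rwa [integral_const_mul, hk1, mul_one] at this
  · have := integral_mono_ae hint (hki.const_mul hi) (hb'.mono fun t ht => ht.2)
    rwa [integral_const_mul, hk1, mul_one] at this

lemma smoothing_mem_Icc (hΩ : IsOpen Ω) (hq : IntegrableOn q Ω) {lo hi : ℝ}
    (hb : ∀ᵐ x ∂(volume.restrict Ω), lo ≤ q x ∧ q x ≤ hi) (hε : 0 < ε) (hε' : ε ≤ c.ε₀)
    {x : Eucl d} (hx : x ∈ closure Ω) : c.smoothing q ε x ∈ Icc lo hi := by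
  have h : ∀ j, c.ψ j x * lo ≤ c.ψ j x * avg (kernel (c.w j) ε) (Ω.indicator q) x ∧
      c.ψ j x * avg (kernel (c.w j) ε) (Ω.indicator q) x ≤ c.ψ j x * hi := by
    intro j
    by_cases hj : c.ψ j x = 0
    · simp [hj]
    · have := c.avg_mem_Icc hΩ hq hb hε hε' hx (subset_tsupport _ hj)
      exact ⟨mul_le_mul_of_nonneg_left this.1 (c.nonneg j x),
        mul_le_mul_of_nonneg_left this.2 (c.nonneg j x)⟩
  have h1 := c.sum_eq_one x hx
  constructor
  · have := Finset.sum_le_sum fun j (_ : j ∈ Finset.univ) => (h j).1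
    rwa [← Finset.sum_mul, h1, one_mul] at this
  · have := Finset.sum_le_sum fun j (_ : j ∈ Finset.univ) => (h j).2
    rwa [← Finset.sum_mul, h1, one_mul] at this

lemma integrableOn_of_continuous (hΩb : Bornology.IsBounded Ω) {f : Eucl d → ℝ}
    (hf : Continuous f) : IntegrableOn f Ω :=
  (hf.continuousOn.integrableOn_compact hΩb.isCompact_closure).mono_set subset_closure

/-- On `Ω` the error is `Σ ψ_j (A_j - q)`. Tested with `θ` it becomes a sum of errors of averages
tested with `ψ_j θ`, which is supported where the direction `w_j` points inwards. -/
lemma exists_integral_abs_smoothing_sub_le (hΩ : IsOpen Ω) (hΩb : Bornology.IsBounded Ω)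
    (hq : IntegrableOn q Ω) (hTV : TV Ω q ≠ ⊤) :
    ∃ C : ℝ, 0 ≤ C ∧ ∀ ε : ℝ, 0 < ε → ε ≤ c.ε₀ →
      ∫ x in Ω, |c.smoothing q ε x - q x| ≤ C * ε := by
  refine ⟨∑ j, (‖c.w j‖ + 1) * (TV Ω q).toReal, by positivity, fun ε hε hε' => ?_⟩
  have hsm := integrableOn_of_continuous hΩb (c.contDiff_smoothing hΩ hq hε).continuous
  refine integral_abs_le_of_forall_test hΩ hΩb (hsm.sub hq) fun θ h1 h2 h3 h4 => ?_
  set A := fun j => avg (kernel (c.w j) ε) (Ω.indicator q) with hA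
  have hAc : ∀ j, Continuous (A j) := fun j => (contDiff_avg_kernel hΩ hq hε _).continuous
  have hint : ∀ j, IntegrableOn (fun x => (A j x - q x) * (c.ψ j x * θ x)) Ω := by
    intro j
    obtain ⟨B, hB⟩ := ((c.contDiff j).continuous.mul h1.continuous).bounded_above_of_compact_support
      (h2.mul_left (f := c.ψ j))
    exact ((integrableOn_of_continuous hΩb (hAc j)).sub hq).mul_bdd (c := B)
      ((c.contDiff j).continuous.mul h1.continuous).aestronglyMeasurable
      (Eventually.of_forall hB)
  have e1 : ∫ x in Ω, (c.smoothing q ε x - q x) * θ x =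
      ∑ j, ∫ x in Ω, (A j x - q x) * (c.ψ j x * θ x) := by
    rw [← integral_finsetSum _ fun j _ => hint j]
    refine setIntegral_congr_fun hΩ.measurableSet fun x hx => ?_
    have h5 := c.sum_eq_one x (subset_closure hx)
    have h6 : q x = ∑ j, c.ψ j x * q x := by rw [← Finset.sum_mul, h5, one_mul]
    simp only [smoothing]
    conv_lhs => rw [h6, ← Finset.sum_sub_distrib, Finset.sum_mul]
    refine Finset.sum_congr rfl fun j _ => ?_
    ring
  rw [show (∫ x in Ω, (fun x => c.smoothing q ε x - q x) x * θ x) =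
    ∫ x in Ω, (c.smoothing q ε x - q x) * θ x from rfl, e1, Finset.sum_mul]
  refine Finset.sum_le_sum fun j _ => ?_
  have hψ1 : ∀ x, c.ψ j x ≤ 1 := fun x =>
    (Finset.single_le_sum (f := fun j => c.ψ j x) (fun j _ => c.nonneg j x)
      (Finset.mem_univ j)).trans (c.sum_le_one x)
  have key := c.abs_integral_avg_sub_mul_le (j := j) (θ := fun x => c.ψ j x * θ x) (M := 1)
    hΩ hq hTV hε hε' zero_le_one
    (((c.contDiff j).of_le (by simp)).mul h1) (h2.mul_left (f := c.ψ j))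
    ((closure_mono (Function.support_mul_subset_right _ _)).trans h3)
    (closure_mono (Function.support_mul_subset_left _ _)) (fun x => by
      rw [abs_mul, abs_of_nonneg (c.nonneg j x)]
      exact mul_le_one₀ (hψ1 x) (abs_nonneg _) (h4 x))
  refine (le_abs_self _).trans (key.trans (le_of_eq ?_))
  ring

/-- Allows `q` to be subtracted from each average wherever a derivative falls on the partition of
unity. -/
lemma sum_fderiv_eq_zero (hΩ : IsOpen Ω) {x : Eucl d} (hx : x ∈ Ω) (v : Eucl d) :
    ∑ j, fderiv ℝ (c.ψ j) x v = 0 := by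
  have h1 : (fun y => ∑ j, c.ψ j y) =ᶠ[𝓝 x] fun _ => 1 := by
    filter_upwards [hΩ.mem_nhds hx] with y hy
    exact c.sum_eq_one y (subset_closure hy)
  have h2 := h1.fderiv_eq (𝕜 := ℝ)
  rw [fderiv_fun_sum fun j _ => ((c.contDiff j).differentiable (by simp)) x] at h2
  have h3 := congrArg (fun L => L v) h2
  simpa using h3

/-- The values of `ψ_j` that are averaged lie within `ε * (W + 1)` of `t`, and `D` bounds the slope.
Summed over `j`, this keeps the averaged test field below `1 + O(ε)`. -/
lemma coavg_le (hε : 0 < ε) {j : ι} {D W : ℝ} (hD : ∀ j x, ‖fderiv ℝ (c.ψ j) x‖ ≤ D)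
    (hD0 : 0 ≤ D) (hW : ∀ j, ‖c.w j‖ ≤ W) (t : Eucl d) :
    coavg (kernel (c.w j) ε) (c.ψ j) t ≤ c.ψ j t + D * (ε * (W + 1)) := by
  have h1 : ∫ u, kernel (c.w j) ε u * (c.ψ j t + D * (ε * (W + 1))) =
      c.ψ j t + D * (ε * (W + 1)) := by
    rw [integral_mul_const, integral_kernel hε, one_mul]
  rw [← h1, coavg]
  refine integral_mono (integrable_coavg contDiff_kernel.continuous (hasCompactSupport_kernel hε)
    (c.contDiff j).continuous t) ((integrable_kernel hε).mul_const _) fun u => ?_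
  rw [smul_eq_mul]
  by_cases hu : kernel (c.w j) ε u = 0
  · simp [hu]
  refine mul_le_mul_of_nonneg_left ?_ (kernel_nonneg hε u)
  have h2 := abs_sub_le_of_norm_fderiv_le ((c.contDiff j).of_le (by simp)) (hD j) (t + u) t
  rw [add_sub_cancel_left] at h2
  have h3 : ‖u‖ ≤ ε * (W + 1) := (norm_le_of_kernel_ne_zero hε hu).trans (by
    gcongr
    exact hW j)
  have h4 := mul_le_mul_of_nonneg_left h3 hD0
  linarith [le_abs_self (c.ψ j (t + u) - c.ψ j t)]

set_option maxHeartbeats 400000 in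
/-- The smoothed functions have almost the same total variation. -/
lemma exists_TV_smoothing_le (hΩ : IsOpen Ω) (hΩb : Bornology.IsBounded Ω)
    (hq : IntegrableOn q Ω) (hTV : TV Ω q ≠ ⊤) :
    ∃ C : ℝ, 0 ≤ C ∧ ∀ ε : ℝ, 0 < ε → ε ≤ c.ε₀ →
      TV Ω (c.smoothing q ε) ≤ ENNReal.ofReal ((1 + C * ε) * (TV Ω q).toReal) := by
  obtain ⟨D, hD0, hD⟩ := c.exists_gradient_bound
  obtain ⟨W, hW0, hW⟩ := c.exists_direction_bound
  set N : ℝ := (Fintype.card ι : ℝ) with hN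
  refine ⟨N * (D * (W + 1)) + N * ((W + 1) * (d * D)), by positivity, fun ε hε hε' =>
    TV_le_ofReal fun Ξ hΞ => ?_⟩
  set k := fun j => kernel (c.w j) ε with hk
  have hkc : ∀ j, Continuous (k j) := fun j => contDiff_kernel.continuous
  have hkcs : ∀ j, HasCompactSupport (k j) := fun j => hasCompactSupport_kernel hε
  set f := Ω.indicator q with hf
  have hfi : Integrable f := (integrable_indicator_iff hΩ.measurableSet).2 hq
  set A := fun j => avg (k j) f with hA
  have hAc : ∀ j, Continuous (A j) := fun j => (contDiff_avg_kernel hΩ hq hε _).continuous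
  set Φ : ι → Eucl d → Eucl d := fun j x => c.ψ j x • Ξ x with hΦ
  have hΦ1 : ∀ j, ContDiff ℝ 1 (Φ j) := fun j => ((c.contDiff j).of_le (by simp)).smul hΞ.contDiff
  have hΦc : ∀ j, HasCompactSupport (Φ j) := fun j =>
    HasCompactSupport.smul_left (f := c.ψ j) hΞ.hasCompactSupport
  have hΦΩ : ∀ j, tsupport (Φ j) ⊆ Ω := fun j =>
    (tsupport_smul_subset_right _ _).trans hΞ.tsupport_subset
  have hΦψ : ∀ j, tsupport (Φ j) ⊆ tsupport (c.ψ j) := fun j => tsupport_smul_subset_left _ _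
  set η : ι → Eucl d → ℝ := fun j x => fderiv ℝ (c.ψ j) x (Ξ x) with hη
  have hη1 : ∀ j, ContDiff ℝ 1 (η j) := fun j =>
    ((c.contDiff j).fderiv_right (m := 1) (WithTop.coe_le_coe.2 le_top)).clm_apply hΞ.contDiff
  have hηΞ : ∀ j, tsupport (η j) ⊆ tsupport Ξ := fun j => closure_mono fun x hx => by
    contrapose! hx
    simp only [Function.mem_support, not_not] at hx ⊢
    simp [hη, hx]
  have hηc : ∀ j, HasCompactSupport (η j) := fun j =>
    hΞ.hasCompactSupport.of_isClosed_subset (isClosed_tsupport _) (hηΞ j)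
  have hηψ : ∀ j, tsupport (η j) ⊆ tsupport (c.ψ j) := fun j => by
    refine (closure_mono fun x hx => ?_).trans (tsupport_fderiv_subset ℝ (f := c.ψ j))
    contrapose! hx
    simp only [Function.mem_support, not_not] at hx ⊢
    simp [hη, hx]
  have hηb : ∀ j x, |η j x| ≤ d * D := fun j x => by
    rw [← Real.norm_eq_abs]
    refine ((fderiv ℝ (c.ψ j) x).le_opNorm _).trans ?_
    have h1 : ‖Ξ x‖ ≤ d * 1 := norm_le_card (hΞ.bound x)
    rw [mul_one] at h1
    rw [mul_comm]
    exact mul_le_mul h1 (hD j x) (norm_nonneg _) (by positivity)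
  have hdc : ∀ j, Continuous (divergence (Φ j)) := fun j => continuous_divergence (hΦ1 j)
  have hdcs : ∀ j, HasCompactSupport (divergence (Φ j)) := fun j =>
    hasCompactSupport_divergence (hΦc j)
  have hi1 : ∀ j, IntegrableOn (fun x => A j x * divergence (Φ j) x) Ω := fun j =>
    integrableOn_of_continuous hΩb ((hAc j).mul (hdc j))
  have hi2 : ∀ j, IntegrableOn (fun x => (A j x - q x) * η j x) Ω := fun j => by
    obtain ⟨B, hB⟩ := (hη1 j).continuous.bounded_above_of_compact_support (hηc j)
    exact ((integrableOn_of_continuous hΩb (hAc j)).sub hq).mul_bdd (c := B)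
      (hη1 j).continuous.aestronglyMeasurable (Eventually.of_forall hB)
  -- Product rule `ψ_j div Ξ = div (ψ_j Ξ) - ∇ψ_j · Ξ`. Since `Σ ∇ψ_j = 0` on `Ω`, subtracting `q`
  -- in the second sum changes nothing and makes that sum of order `ε`.
  have hsplit : ∫ x in Ω, c.smoothing q ε x * divergence Ξ x =
      (∑ j, ∫ x in Ω, A j x * divergence (Φ j) x) - ∑ j, ∫ x in Ω, (A j x - q x) * η j x := by
    rw [← integral_finsetSum _ fun j _ => hi1 j, ← integral_finsetSum _ fun j _ => hi2 j,
      ← integral_sub (integrable_finsetSum _ fun j _ => hi1 j)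
        (integrable_finsetSum _ fun j _ => hi2 j)]
    refine setIntegral_congr_fun hΩ.measurableSet fun x hx => ?_
    have h1 : ∑ j, q x * η j x = 0 := by
      rw [← Finset.mul_sum, c.sum_fderiv_eq_zero hΩ hx, mul_zero]
    simp only [sub_mul]
    rw [Finset.sum_sub_distrib, h1, sub_zero, ← Finset.sum_sub_distrib]
    simp only [smoothing]
    rw [Finset.sum_mul]
    refine Finset.sum_congr rfl fun j _ => ?_
    rw [divergence_smul ((c.contDiff j).of_le (by simp)) hΞ.contDiff]
    ring
  -- Moving the averages onto the fields turns the first sum into the pairing of `q` with the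
  -- divergence of `Ψ`.
  set Ψ : Eucl d → Eucl d := fun t => ∑ j, coavg (k j) (Φ j) t with hΨ
  have hΨj : ∀ j, ContDiff ℝ 1 (coavg (k j) (Φ j)) := fun j =>
    contDiff_coavg (n := 1) (hkc j) (hΦ1 j) (hΦc j)
  have hts : ∀ j, tsupport (coavg (k j) (Φ j)) ⊆ Ω := fun j t ht => by
    obtain ⟨u, hu, htu⟩ := (tsupport_coavg_subset (hkcs j) (hΦc j)).2 ht
    have := c.sub_smul_mem (hΦΩ j htu) (hΦψ j htu) hε hε' hu (s := 1) (by simp)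
    simpa using this
  have hΨsupp : Function.support Ψ ⊆ ⋃ j, tsupport (coavg (k j) (Φ j)) := fun t ht => by
    by_contra hcon
    simp only [mem_iUnion, not_exists] at hcon
    exact ht (Finset.sum_eq_zero fun j _ => image_eq_zero_of_notMem_tsupport (hcon j))
  have hcomp : IsCompact (⋃ j, tsupport (coavg (k j) (Φ j))) :=
    isCompact_iUnion fun j => hasCompactSupport_coavg (hkcs j) (hΦc j)
  -- The components of `Ξ` are at most 1, so those of `Ψ` are at most the sum over `j` of the
  -- averaged `ψ_j`, that is `Σ ψ_j ≤ 1` up to `O(ε)`.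
  have hbound : ∀ t i, |Ψ t i| ≤ 1 + N * (D * (W + 1)) * ε := by
    intro t i
    have h1 : ∀ j, |(coavg (k j) (Φ j) t) i| ≤ c.ψ j t + D * (ε * (W + 1)) := by
      intro j
      rw [coavg_apply (hkc j) (hkcs j) (hΦ1 j).continuous, ← Real.norm_eq_abs]
      refine le_trans ?_ (c.coavg_le hε hD hD0 hW t)
      refine norm_integral_le_of_norm_le (integrable_coavg (hkc j) (hkcs j)
        (c.contDiff j).continuous t) (Eventually.of_forall fun u => ?_)
      rw [norm_smul, Real.norm_of_nonneg (kernel_nonneg hε u), smul_eq_mul]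
      refine mul_le_mul_of_nonneg_left ?_ (kernel_nonneg hε u)
      simp only [hΦ, PiLp.smul_apply, smul_eq_mul, norm_mul,
        Real.norm_of_nonneg (c.nonneg j (t + u))]
      exact mul_le_of_le_one_right (c.nonneg j _) (hΞ.bound _ i)
    have h2 : Ψ t i = ∑ j, (coavg (k j) (Φ j) t) i := by
      simp [hΨ]
    rw [h2]
    refine (Finset.abs_sum_le_sum_abs _ _).trans ((Finset.sum_le_sum fun j _ => h1 j).trans ?_)
    rw [Finset.sum_add_distrib]
    simp only [Finset.sum_const, nsmul_eq_mul, Finset.card_univ]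
    have := c.sum_le_one t
    have e : N * (D * (ε * (W + 1))) = N * (D * (W + 1)) * ε := by ring
    linarith
  have hmain : ∑ j, ∫ x in Ω, A j x * divergence (Φ j) x ≤
      (1 + N * (D * (W + 1)) * ε) * (TV Ω q).toReal := by
    have e1 : ∀ j, ∫ x in Ω, A j x * divergence (Φ j) x =
        ∫ t in Ω, q t * divergence (coavg (k j) (Φ j)) t := by
      intro j
      have h1 : ∫ x in Ω, A j x * divergence (Φ j) x = ∫ x, A j x * divergence (Φ j) x := by
        refine setIntegral_eq_integral_of_forall_compl_eq_zero fun x hx => ?_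
        have h2 : x ∉ tsupport (Φ j) := fun h => hx (hΦΩ j h)
        have h3 : fderiv ℝ (Φ j) x = 0 := by
          by_contra hne
          exact h2 (support_fderiv_subset ℝ hne)
        simp [divergence, h3]
      rw [h1, integral_avg_mul hfi (hkc j) (hkcs j) (hdc j) (hdcs j),
        ← integral_indicator hΩ.measurableSet]
      congr 1
      ext t
      simp only [divergence_coavg (hkc j) (hkcs j) (hΦ1 j) (hΦc j)]
      by_cases ht : t ∈ Ω <;> simp [hf, ht]
    simp only [e1]
    rw [← integral_finsetSum _ fun j _ => integrableOn_mul_divergence hq (hΨj j)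
      (hasCompactSupport_coavg (hkcs j) (hΦc j))]
    simp only [← Finset.mul_sum, ← divergence_sum hΨj]
    exact integral_mul_divergence_le_mul (Ξ := Ψ) hTV (by positivity)
      (ContDiff.sum fun j _ => hΨj j)
      (HasCompactSupport.of_support_subset_isCompact hcomp hΨsupp)
      ((closure_minimal hΨsupp hcomp.isClosed).trans (iUnion_subset hts)) hbound
  have hrest : -∑ j, ∫ x in Ω, (A j x - q x) * η j x ≤
      N * ((W + 1) * (d * D)) * ε * (TV Ω q).toReal := by
    rw [← Finset.sum_neg_distrib]
    have h1 : ∀ j ∈ Finset.univ, -∫ x in Ω, (A j x - q x) * η j x ≤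
        ε * (W + 1) * (d * D) * (TV Ω q).toReal := fun j _ => by
      refine (neg_le_abs _).trans ((c.abs_integral_avg_sub_mul_le hΩ hq hTV hε hε' (by positivity)
        (hη1 j) (hηc j) ((hηΞ j).trans hΞ.tsupport_subset) (hηψ j) (hηb j)).trans ?_)
      gcongr
      exact hW j
    refine (Finset.sum_le_sum h1).trans (le_of_eq ?_)
    simp only [Finset.sum_const, nsmul_eq_mul, Finset.card_univ]
    ring
  rw [hsplit]
  linarith

end InwardCover

end TVFEM

namespace TVFEM

/-! ### Affine functions on simplices. -/

section Simplices

variable {d : ℕ} {Ω : Set (Eucl d)} {K : Geometry.SimplicialComplex ℝ (Eucl d)}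
  {s t : Finset (Eucl d)}

/-- The closed simplex with vertex set `s`. -/
abbrev simplex (s : Finset (Eucl d)) : Set (Eucl d) := convexHull ℝ (s : Set (Eucl d))

lemma isCompact_simplex (s : Finset (Eucl d)) : IsCompact (simplex s) :=
  s.finite_toSet.isCompact_convexHull ℝ

lemma vertex_mem_simplex {x : Eucl d} (hx : x ∈ s) : x ∈ simplex s :=
  subset_convexHull ℝ _ hx

lemma measure_simplex_ne_top (s : Finset (Eucl d)) : volume (simplex s) ≠ ⊤ :=
  (isCompact_simplex s).measure_lt_top.ne

lemma norm_sub_le_diam {x y : Eucl d} (hx : x ∈ simplex s) (hy : y ∈ simplex s) :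
    ‖x - y‖ ≤ Metric.diam (simplex s) := by
  rw [← dist_eq_norm]
  exact Metric.dist_le_diam_of_mem (isCompact_simplex s).isBounded hx hy

/-- The `d + 1` vertices form an affine basis; combine its barycentric coordinates with the
prescribed values. -/
lemma exists_affine_of_cell (hs : s ∈ cells K) (w : Eucl d → ℝ) :
    ∃ a : Eucl d →ᵃ[ℝ] ℝ, ∀ x ∈ s, a x = w x := by
  have hind := K.indep hs.1
  have htop : affineSpan ℝ (range ((↑) : s → Eucl d)) = ⊤ := by
    rw [hind.affineSpan_eq_top_iff_card_eq_finrank_add_one]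
    simp [hs.2]
  classical
  set b : AffineBasis s ℝ (Eucl d) := ⟨_, hind, htop⟩ with hb
  have hbx : ∀ i : s, b i = (i : Eucl d) := fun i => rfl
  refine ⟨∑ i : s, w i • b.coord i, fun x hx => ?_⟩
  have h1 : ∀ i : s, b.coord i x = if i = ⟨x, hx⟩ then 1 else 0 := fun i => by
    rw [← b.coord_apply i ⟨x, hx⟩, hbx]
  have h2 : (∑ i : s, w i • b.coord i) x = ∑ i : s, w i • b.coord i x := by
    induction (Finset.univ : Finset s) using Finset.induction_on with
    | empty => simp
    | insert i u hi ih => rw [Finset.sum_insert hi, Finset.sum_insert hi, ← ih]; rfl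
  rw [h2]
  simp [h1]

lemma affine_eqOn_convexHull {A : Set (Eucl d)} {a b : Eucl d →ᵃ[ℝ] ℝ} (h : EqOn a b A) :
    EqOn a b (convexHull ℝ A) := by
  have hconv : Convex ℝ {x | a x = b x} := by
    intro x hx y hy α β _ _ hαβ
    simp only [mem_ofPred_eq] at hx hy ⊢
    rw [Convex.combo_affine_apply hαβ, Convex.combo_affine_apply hαβ, hx, hy]
  exact convexHull_min h hconv

lemma affine_mem_Icc {a : Eucl d →ᵃ[ℝ] ℝ} {lo hi : ℝ} (h : ∀ x ∈ s, a x ∈ Icc lo hi)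
    {x : Eucl d} (hx : x ∈ simplex s) : a x ∈ Icc lo hi := by
  have hconv : Convex ℝ (a ⁻¹' Icc lo hi) := (convex_Icc lo hi).affine_preimage a
  exact convexHull_min (fun y hy => h y hy) hconv hx

/-- A linear form whose oscillation on a simplex containing a ball of radius `r` is small is
small. -/
lemma norm_le_of_osc_le {L : Eucl d →L[ℝ] ℝ} {δ r : ℝ} {c : Eucl d} (hr : 0 < r)
    (hball : Metric.closedBall c r ⊆ simplex s) (hδ : 0 ≤ δ)
    (h : ∀ x ∈ s, ∀ y ∈ s, L (x - y) ≤ δ) : ‖L‖ ≤ δ / r := by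
  -- By convexity in each variable the bound passes from pairs of vertices to pairs of points. Every
  -- vector of norm `r` is such a difference, `(c + v) - c`.
  have h1 : ∀ x ∈ simplex s, ∀ y ∈ s, L (x - y) ≤ δ := by
    intro x hx y hy
    have hconv : Convex ℝ {x | L x ≤ δ + L y} := convex_halfSpace_le L.toLinearMap.isLinear _
    have := convexHull_min (fun x hx => by
      have := h x hx y hy
      rw [map_sub] at this
      show L x ≤ δ + L y
      linarith) hconv hx
    rw [map_sub]
    linarith [this.out]
  have h2 : ∀ x ∈ simplex s, ∀ y ∈ simplex s, L (x - y) ≤ δ := by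
    intro x hx y hy
    have hconv : Convex ℝ {y | L x - δ ≤ L y} := convex_halfSpace_ge L.toLinearMap.isLinear _
    have := convexHull_min (fun y hy => by
      have := h1 x hx y hy
      rw [map_sub] at this
      show L x - δ ≤ L y
      linarith) hconv hy
    rw [map_sub]
    linarith [this.out]
  have h3 : ∀ v : Eucl d, ‖v‖ = r → L v ≤ δ := by
    intro v hv
    have := h2 (c + v) (hball (by simp [hv])) c (hball (by simp [hr.le]))
    simpa using this
  refine ContinuousLinearMap.opNorm_le_bound' _ (by positivity) fun v hv => ?_
  have hv0 : 0 < ‖v‖ := lt_of_le_of_ne (norm_nonneg _) (Ne.symm hv)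
  have h4 := h3 ((r / ‖v‖) • v) (by rw [norm_smul, norm_div, norm_norm,
    Real.norm_of_nonneg hr.le, div_mul_cancel₀ _ hv0.ne'])
  have h5 := h3 ((-(r / ‖v‖)) • v) (by rw [norm_smul, norm_neg, norm_div, norm_norm,
    Real.norm_of_nonneg hr.le, div_mul_cancel₀ _ hv0.ne'])
  rw [map_smul, smul_eq_mul] at h4 h5
  rw [Real.norm_eq_abs, abs_le']
  constructor
  · calc L v = (‖v‖ / r) * (r / ‖v‖ * L v) := by field_simp
      _ ≤ (‖v‖ / r) * δ := by gcongr
      _ = δ / r * ‖v‖ := by ring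
  · calc -L v = (‖v‖ / r) * (-(r / ‖v‖) * L v) := by field_simp
      _ ≤ (‖v‖ / r) * δ := by gcongr
      _ = δ / r * ‖v‖ := by ring

/-- The linear part of an affine function, as a continuous linear form. -/
noncomputable def gradForm (a : Eucl d →ᵃ[ℝ] ℝ) : Eucl d →L[ℝ] ℝ :=
  LinearMap.toContinuousLinearMap a.linear

lemma gradForm_sub (a : Eucl d →ᵃ[ℝ] ℝ) (x y : Eucl d) : gradForm a (x - y) = a x - a y := by
  have := a.linearMap_vsub x y
  simpa [gradForm] using this

lemma hasFDerivAt_affine (a : Eucl d →ᵃ[ℝ] ℝ) (x : Eucl d) :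
    HasFDerivAt a (gradForm a) x := by
  have h : (a : Eucl d → ℝ) = fun y => gradForm a y + a 0 := by
    ext y
    have := gradForm_sub a y 0
    rw [sub_zero] at this
    linarith
  rw [h]
  exact (gradForm a).hasFDerivAt.add_const _

/-- The gradient of the nodal interpolant of a smooth function on a cell. -/
lemma norm_gradForm_sub_fderiv_le {a : Eucl d →ᵃ[ℝ] ℝ} {f : Eucl d → ℝ} {r τ : ℝ} {c : Eucl d}
    (hr : 0 < r) (hball : Metric.closedBall c r ⊆ simplex s) (hf : ContDiff ℝ 1 f)
    (haf : ∀ x ∈ s, a x = f x) (hτ0 : 0 ≤ τ)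
    (hτ : ∀ x ∈ simplex s, ∀ y ∈ simplex s, ‖fderiv ℝ f x - fderiv ℝ f y‖ ≤ τ) {x : Eucl d}
    (hx : x ∈ simplex s) :
    ‖gradForm a - fderiv ℝ f x‖ ≤ τ * Metric.diam (simplex s) / r := by
  refine norm_le_of_osc_le hr hball (mul_nonneg hτ0 Metric.diam_nonneg) fun y hy z hz => ?_
  -- Mean value inequality for `f` minus its linearization at `x`; between vertices the increments
  -- of `a` and `f` coincide.
  have h1 := (convex_convexHull ℝ (s : Set (Eucl d))).norm_image_sub_le_of_norm_fderiv_le'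
    (𝕜 := ℝ) (f := f) (φ := fderiv ℝ f x) (C := τ)
    (fun u _ => hf.differentiable one_ne_zero u) (fun u hu => hτ u hu x hx)
    (vertex_mem_simplex hz) (vertex_mem_simplex hy)
  rw [sub_apply, gradForm_sub, haf y hy, haf z hz]
  refine (le_abs_self _).trans (h1.trans ?_)
  gcongr
  exact norm_sub_le_diam (vertex_mem_simplex hy) (vertex_mem_simplex hz)

lemma abs_sub_le_on_simplex {a : Eucl d →ᵃ[ℝ] ℝ} {f : Eucl d → ℝ} {B : ℝ}
    (hf : ContDiff ℝ 1 f) (hB : ∀ x ∈ simplex s, ‖gradForm a - fderiv ℝ f x‖ ≤ B) {x y : Eucl d}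
    (hx : x ∈ simplex s) (hy : y ∈ simplex s) :
    |(a x - f x) - (a y - f y)| ≤ B * ‖x - y‖ := by
  have hd : ∀ u, HasFDerivAt (fun u => a u - f u) (gradForm a - fderiv ℝ f u) u := fun u =>
    (hasFDerivAt_affine a u).sub (hf.differentiable one_ne_zero u).hasFDerivAt
  refine (convex_convexHull ℝ (s : Set (Eucl d))).norm_image_sub_le_of_norm_fderiv_le (𝕜 := ℝ)
    (f := fun u => a u - f u) (fun u _ => (hd u).differentiableAt) (fun u hu => ?_) hy hx
  rw [(hd u).fderiv]
  exact hB u hu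

end Simplices

/-! ### Cells of a triangulation: gluing, null overlaps, additivity of integrals. -/

namespace IsTriangulation

variable {d : ℕ} {Ω : Set (Eucl d)} {K : Geometry.SimplicialComplex ℝ (Eucl d)}
  {s t : Finset (Eucl d)}

/-- The finite set of cells of a triangulation. -/
noncomputable def cellFinset (hT : IsTriangulation Ω K) : Finset (Finset (Eucl d)) :=
  (hT.finite.subset (fun _ hs => hs.1 : cells K ⊆ K.faces)).toFinset

lemma mem_cellFinset (hT : IsTriangulation Ω K) : s ∈ hT.cellFinset ↔ s ∈ cells K := by
  simp [cellFinset]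

lemma closure_eq (hT : IsTriangulation Ω K) : closure Ω = ⋃ s ∈ hT.cellFinset, simplex s := by
  rw [← hT.space_eq]
  refine Subset.antisymm (fun x hx => ?_) (iUnion₂_subset fun s hs =>
    K.convexHull_subset_space (hT.mem_cellFinset.1 hs).1)
  obtain ⟨s, hs, hxs⟩ := K.mem_space_iff.1 hx
  obtain ⟨t, ht, hst⟩ := hT.pure s hs
  exact mem_biUnion (hT.mem_cellFinset.2 ht) (convexHull_mono (by exact_mod_cast hst) hxs)

lemma exists_cell (hT : IsTriangulation Ω K) {x : Eucl d} (hx : x ∈ closure Ω) :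
    ∃ s ∈ cells K, x ∈ simplex s := by
  rw [hT.closure_eq] at hx
  obtain ⟨s, hs, hxs⟩ := mem_iUnion₂.1 hx
  exact ⟨s, hT.mem_cellFinset.1 hs, hxs⟩

lemma simplex_subset (hT : IsTriangulation Ω K) (hs : s ∈ cells K) : simplex s ⊆ closure Ω := by
  rw [hT.closure_eq]
  exact subset_biUnion_of_mem (hT.mem_cellFinset.2 hs)

lemma continuousOn_of_cells (hT : IsTriangulation Ω K) {v : Eucl d → ℝ}
    (h : ∀ s ∈ cells K, ContinuousOn v (simplex s)) :
    ContinuousOn v (closure Ω) := by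
  have h1 : closure Ω = ⋃ i : hT.cellFinset, simplex (i : Finset (Eucl d)) := by
    rw [hT.closure_eq, iUnion_subtype]
  rw [h1]
  refine LocallyFinite.continuousOn_iUnion (locallyFinite_of_finite _)
    (fun i => (isCompact_simplex _).isClosed) fun i => h _ (hT.mem_cellFinset.1 i.2)

/-- Existence of nodal interpolants. -/
lemma exists_interpolant (hT : IsTriangulation Ω K) (w : Eucl d → ℝ) :
    ∃ v : Eucl d → ℝ, ∀ s ∈ cells K, ∃ a : Eucl d →ᵃ[ℝ] ℝ,
      EqOn v a (simplex s) ∧ ∀ x ∈ s, a x = w x := by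
  classical
  choose! a ha using fun s (hs : s ∈ cells K) => exists_affine_of_cell hs w
  choose! σ hσ hxσ using fun x (hx : x ∈ closure Ω) => hT.exists_cell hx
  refine ⟨fun x => a (σ x) x, fun s hs => ⟨a s, fun x hx => ?_, ha s hs⟩⟩
  have hxc := hT.simplex_subset hs hx
  -- Two cells meet in the hull of their common vertices, where both affine functions agree, so the
  -- choice of the cell `σ x` is immaterial.
  have h1 := K.inter_subset_convexHull (hσ x hxc).1 hs.1 ⟨hxσ x hxc, hx⟩
  exact affine_eqOn_convexHull (fun y hy => by
    rw [ha _ (hσ x hxc) y hy.1, ha s hs y hy.2]) h1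

/-- Having equally many vertices, `s` has a vertex `x` outside `t`. The affine function equal to 1
at `x` and 0 at the other vertices of `s` vanishes on the span of the common vertices. That span is
therefore proper, hence null, and contains the overlap. -/
lemma aedisjoint_of_cells (hs : s ∈ cells K) (ht : t ∈ cells K) (hst : s ≠ t) :
    AEDisjoint volume (simplex s) (simplex t) := by
  have h1 : ∃ x ∈ s, x ∉ t := by
    by_contra! hcon
    exact hst (Finset.eq_of_subset_of_card_le hcon (by rw [hs.2, ht.2]))
  obtain ⟨x, hxs, hxt⟩ := h1
  classical
  obtain ⟨a, ha⟩ := exists_affine_of_cell hs (fun y => if y = x then 1 else 0)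
  have hsub : simplex s ∩ simplex t ⊆ affineSpan ℝ ((s : Set (Eucl d)) ∩ t) :=
    (K.inter_subset_convexHull hs.1 ht.1).trans (convexHull_subset_affineSpan _)
  refine measure_mono_null hsub (Measure.addHaar_affineSubspace _ _ fun htop => ?_)
  have h2 : affineSpan ℝ ((s : Set (Eucl d)) ∩ t) ≤
      (AffineSubspace.mk' (0 : ℝ) ⊥).comap a := by
    rw [affineSpan_le]
    intro y hy
    have hne : y ≠ x := fun h => hxt (h ▸ hy.2)
    simp [ha y hy.1, hne, AffineSubspace.mem_mk']
  rw [htop] at h2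
  have h3 : x ∈ (AffineSubspace.mk' (0 : ℝ) ⊥).comap a := h2 (AffineSubspace.mem_top ℝ _ x)
  simp [ha x hxs, AffineSubspace.mem_mk'] at h3

lemma sum_measure_le_of_cells (A : Finset (Finset (Eucl d))) (hA : ∀ s ∈ A, s ∈ cells K)
    {B : Set (Eucl d)} (hB : ∀ s ∈ A, simplex s ⊆ B) :
    ∑ s ∈ A, volume (simplex s) ≤ volume B := by
  rw [← measure_biUnion_finset₀ (fun s hs t ht hst => aedisjoint_of_cells (hA s hs) (hA t ht) hst)
    fun s _ => (isCompact_simplex s).measurableSet.nullMeasurableSet]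
  exact measure_mono (iUnion₂_subset hB)

lemma sum_measureReal_le_of_cells (A : Finset (Finset (Eucl d))) (hA : ∀ s ∈ A, s ∈ cells K)
    {B : Set (Eucl d)} (hBt : volume B ≠ ⊤) (hB : ∀ s ∈ A, simplex s ⊆ B) :
    ∑ s ∈ A, volume.real (simplex s) ≤ volume.real B := by
  have h := ENNReal.toReal_mono hBt (sum_measure_le_of_cells A hA hB)
  rwa [ENNReal.toReal_sum fun s _ => measure_simplex_ne_top s] at h

lemma sum_setLIntegral_eq (hT : IsTriangulation Ω K) (f : Eucl d → ℝ≥0∞) :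
    ∑ s ∈ hT.cellFinset, ∫⁻ x in simplex s, f x = ∫⁻ x in closure Ω, f x := by
  rw [hT.closure_eq, lintegral_biUnion_finset₀]
  · exact fun s hs t ht hst =>
      aedisjoint_of_cells (hT.mem_cellFinset.1 hs) (hT.mem_cellFinset.1 ht) hst
  · exact fun s _ => (isCompact_simplex s).measurableSet.nullMeasurableSet

end IsTriangulation

/-- A set whose boundary is a finite union of convex hulls of finite sets has a boundary of measure
zero. -/
lemma IsPolygonalDomain.measure_frontier {d : ℕ} {Ω : Set (Eucl d)} (hΩ : IsPolygonalDomain Ω) :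
    volume (frontier Ω) = 0 := by
  obtain ⟨F, hF, hFΩ⟩ := hΩ.polygonal
  rw [hFΩ, measure_biUnion_null_iff hF.countable]
  intro s hs
  -- The frontier of an open set has empty interior, so each hull coincides with its own frontier,
  -- which is null by convexity.
  have h1 : interior (simplex s) = ∅ := by
    have h2 : simplex s ⊆ frontier Ω := by
      rw [hFΩ]
      exact subset_biUnion_of_mem (u := fun s : Finset (Eucl d) => simplex s) hs
    have h3 : interior (frontier Ω) = ∅ := by
      rw [← frontier_compl]
      exact interior_frontier hΩ.isOpen.isClosed_compl
    exact subset_empty_iff.1 (h3 ▸ interior_mono h2)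
  have h4 := (convex_convexHull ℝ (s : Set (Eucl d))).addHaar_frontier volume
  rwa [(isCompact_simplex s).isClosed.frontier_eq, h1, sdiff_empty] at h4

lemma IsPolygonalDomain.setLIntegral_closure {d : ℕ} {Ω : Set (Eucl d)}
    (hΩ : IsPolygonalDomain Ω) (f : Eucl d → ℝ≥0∞) :
    ∫⁻ x in closure Ω, f x = ∫⁻ x in Ω, f x := by
  refine setLIntegral_congr ?_
  refine (Filter.EventuallyLE.antisymm (subset_closure (s := Ω)).eventuallyLE ?_).symm
  rw [ae_le_set, ← hΩ.isOpen.frontier_eq]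
  exact hΩ.measure_frontier

end TVFEM

namespace TVFEM

/-! ### Total variation of piecewise Lipschitz functions. -/

section PiecewiseLipschitz

variable {d : ℕ} {Ω : Set (Eucl d)} {K : Geometry.SimplicialComplex ℝ (Eucl d)}
  {f θ : Eucl d → ℝ}

lemma hasDerivAt_integral_translate (hf : Integrable f) (h1 : ContDiff ℝ 1 θ)
    (h2 : HasCompactSupport θ) (v : Eucl d) :
    HasDerivAt (fun s : ℝ => ∫ t, f t * θ (t + s • v)) (∫ t, f t * fderiv ℝ θ t v) 0 := by
  set θ' : Eucl d → ℝ := fun y => θ (-y) with hθ'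
  have h1' : ContDiff ℝ 1 θ' := h1.comp contDiff_neg
  have h2' : HasCompactSupport θ' := h2.comp_homeomorph (Homeomorph.neg (Eucl d))
  have hGd : ContDiff ℝ 1 (avg θ' f) := contDiff_avg hf.locallyIntegrable h1' h2'
  have e1 : (fun s : ℝ => ∫ t, f t * θ (t + s • v)) = fun s => avg θ' f (s • (-v)) := by
    ext s
    rw [avg_add_eq, smul_neg]
  have ha : HasDerivAt (fun s : ℝ => s • (-v)) (-v) 0 := by
    simpa using (hasDerivAt_id (0 : ℝ)).smul_const (-v)
  have hG := (hGd.differentiable one_ne_zero ((0 : ℝ) • (-v))).hasFDerivAt.comp_hasDerivAt 0 ha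
  rw [e1]
  suffices hval : ∫ t, f t * fderiv ℝ θ t v = fderiv ℝ (avg θ' f) ((0 : ℝ) • (-v)) (-v) by
    rw [hval]
    exact hG
  rw [zero_smul, fderiv_avg hf.locallyIntegrable h1' h2', avg]
  congr 1
  ext t
  have hθd : HasFDerivAt θ' ((fderiv ℝ θ t).comp (-ContinuousLinearMap.id ℝ (Eucl d)))
      (0 - t) := by
    refine HasFDerivAt.comp _ ?_ (hasFDerivAt_id _).fun_neg
    rw [zero_sub, neg_neg]
    exact (h1.differentiable one_ne_zero t).hasFDerivAt
  rw [hθd.fderiv]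
  simp

lemma divergence_eq_sum_partial {Ξ : Eucl d → Eucl d} (hΞ : ContDiff ℝ 1 Ξ) (x : Eucl d) :
    divergence Ξ x = ∑ i, fderiv ℝ (fun y => Ξ y i) x (EuclideanSpace.single i 1) := by
  unfold divergence
  refine Finset.sum_congr rfl fun i _ => ?_
  have h := (EuclideanSpace.proj i : Eucl d →L[ℝ] ℝ).hasFDerivAt.comp x
    ((hΞ.differentiable one_ne_zero) x).hasFDerivAt
  have h' : HasFDerivAt (fun y => Ξ y i) _ x := h
  rw [h'.fderiv]
  simp

/-- Test fields are bounded in the `ℓ^∞` norm, so each component is by itself an admissible scalar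
test; the `d` contributions add up. -/
lemma TV_le_of_partials {C : ℝ} (hf : IntegrableOn f Ω)
    (h : ∀ (i : Fin d) (φ : Eucl d → ℝ), ContDiff ℝ 1 φ → HasCompactSupport φ →
      tsupport φ ⊆ Ω → (∀ x, |φ x| ≤ 1) →
      ∫ x in Ω, f x * fderiv ℝ φ x (EuclideanSpace.single i 1) ≤ C) :
    TV Ω f ≤ ENNReal.ofReal (d * C) := by
  refine TV_le_ofReal fun Ξ hΞ => ?_
  have h1 : ∀ i, ContDiff ℝ 1 fun y => Ξ y i := fun i =>
    (EuclideanSpace.proj i : Eucl d →L[ℝ] ℝ).contDiff.comp hΞ.contDiff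
  have hsub : ∀ i, tsupport (fun y => Ξ y i) ⊆ tsupport Ξ := fun i => closure_mono fun x hx => by
    contrapose! hx
    simp only [Function.mem_support, not_not] at hx ⊢
    simp [hx]
  have h2 : ∀ i, HasCompactSupport fun y => Ξ y i := fun i =>
    hΞ.hasCompactSupport.of_isClosed_subset (isClosed_tsupport _) (hsub i)
  have h3 : ∀ i, IntegrableOn
      (fun x => f x * fderiv ℝ (fun y => Ξ y i) x (EuclideanSpace.single i 1)) Ω := fun i => by
    have hc : Continuous fun x => fderiv ℝ (fun y => Ξ y i) x (EuclideanSpace.single i 1) :=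
      ((h1 i).continuous_fderiv one_ne_zero).clm_apply continuous_const
    obtain ⟨B, hB⟩ := hc.bounded_above_of_compact_support ((h2 i).fderiv_apply (𝕜 := ℝ) _)
    exact hf.mul_bdd (c := B) hc.aestronglyMeasurable (Eventually.of_forall hB)
  simp only [divergence_eq_sum_partial hΞ.contDiff, Finset.mul_sum]
  rw [integral_finsetSum _ fun i _ => h3 i]
  refine (Finset.sum_le_sum fun i _ => h i _ (h1 i) (h2 i) ((hsub i).trans hΞ.tsupport_subset)
    fun x => hΞ.bound x i).trans ?_
  simp

lemma IsTriangulation.continuousOn_of_lipschitz (hT : IsTriangulation Ω K) {w : Eucl d → ℝ}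
    {B : Finset (Eucl d) → ℝ}
    (hw : ∀ s ∈ cells K, ∀ x ∈ simplex s, ∀ y ∈ simplex s, |w x - w y| ≤ B s * ‖x - y‖) :
    ContinuousOn w (closure Ω) := by
  refine hT.continuousOn_of_cells fun s hs => ?_
  refine LipschitzOnWith.continuousOn (K := (B s).toNNReal) ?_
  refine LipschitzOnWith.of_dist_le_mul fun x hx y hy => ?_
  rw [Real.dist_eq, dist_eq_norm]
  refine (hw s hs x hx y hy).trans ?_
  gcongr
  exact Real.le_coe_toNNReal _

/-- A function that is Lipschitz on all cells is Lipschitz along segments. -/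
lemma IsTriangulation.abs_sub_le_of_segment (hT : IsTriangulation Ω K) {w : Eucl d → ℝ} {L : ℝ}
    (hw : ∀ s ∈ cells K, ∀ x ∈ simplex s, ∀ y ∈ simplex s, |w x - w y| ≤ L * ‖x - y‖)
    {x v : Eucl d} {t : ℝ} (ht : 0 ≤ t) (hseg : ∀ τ ∈ Icc 0 t, x + τ • v ∈ closure Ω) :
    |w (x + t • v) - w x| ≤ L * ‖v‖ * t := by
  have hwc := hT.continuousOn_of_lipschitz (B := fun _ => L) hw
  have hc : ContinuousOn (fun τ : ℝ => |w (x + τ • v) - w x|) (Icc 0 t) := by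
    have h1 : ContinuousOn (fun τ : ℝ => w (x + τ • v)) (Icc 0 t) :=
      hwc.comp (by fun_prop) hseg
    exact (h1.sub continuousOn_const).abs
  refine image_le_of_liminf_slope_right_le_deriv_boundary hc (B := fun τ => L * ‖v‖ * τ)
    (B' := fun _ => L * ‖v‖) (by simp) (by fun_prop) (fun τ _ => ?_) (fun τ hτ r hr => ?_)
    (right_mem_Icc.2 ht)
  · simpa using ((hasDerivAt_id τ).const_mul (L * ‖v‖)).hasDerivWithinAt
  have h1 : ∀ᶠ z in 𝓝[>] τ, z ∈ Ioc τ t := Ioc_mem_nhdsGT hτ.2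
  -- There are finitely many closed cells, so one of them contains points of the segment for
  -- parameters arbitrarily close to `τ` from the right, and hence the point at `τ`. Its Lipschitz
  -- bound controls the right lower slope there.
  have h2 : ∃ s ∈ hT.cellFinset, ∃ᶠ z in 𝓝[>] τ, x + z • v ∈ simplex s := by
    by_contra! hcon
    have h3 : ∀ᶠ z in 𝓝[>] τ, ∀ s ∈ hT.cellFinset, x + z • v ∉ simplex s :=
      (Finset.eventually_all hT.cellFinset).2 fun s hs => hcon s hs
    obtain ⟨z, hz, hz'⟩ := (h1.and h3).exists
    obtain ⟨s, hs, hzs⟩ := hT.exists_cell (hseg z ⟨hτ.1.trans hz.1.le, hz.2⟩)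
    exact hz' s (hT.mem_cellFinset.2 hs) hzs
  obtain ⟨s, hs, hfreq⟩ := h2
  have hτs : x + τ • v ∈ simplex s := by
    refine (isCompact_simplex s).isClosed.mem_of_frequently_of_tendsto hfreq ?_
    have : Continuous fun z : ℝ => x + z • v := by fun_prop
    exact (this.tendsto τ).mono_left nhdsWithin_le_nhds
  refine (hfreq.and_eventually h1).mono fun z hz => ?_
  have hz0 : 0 < z - τ := sub_pos.2 hz.2.1
  have h4 := hw s (hT.mem_cellFinset.1 hs) _ hz.1 _ hτs
  rw [add_sub_add_left_eq_sub, ← sub_smul, norm_smul, Real.norm_of_nonneg hz0.le] at h4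
  rw [slope_def_field, div_lt_iff₀ hz0]
  have h5 : |w (x + z • v) - w x| ≤ |w (x + z • v) - w (x + τ • v)| + |w (x + τ • v) - w x| :=
    abs_sub_le _ _ _
  have h6 : L * ‖v‖ * (z - τ) < r * (z - τ) := mul_lt_mul_of_pos_right hr hz0
  nlinarith

/-- The total variation of a function that is Lipschitz on each cell of a triangulation. -/
lemma IsTriangulation.TV_le_of_lipschitz (hΩ : IsOpen Ω) (hΩb : Bornology.IsBounded Ω)
    (hT : IsTriangulation Ω K) {w : Eucl d → ℝ} {B : Finset (Eucl d) → ℝ} (hB : ∀ s, 0 ≤ B s)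
    (hw : ∀ s ∈ cells K, ∀ x ∈ simplex s, ∀ y ∈ simplex s, |w x - w y| ≤ B s * ‖x - y‖) :
    TV Ω w ≤ ENNReal.ofReal (d * ∑ s ∈ hT.cellFinset, volume.real (simplex s) * B s) := by
  have hwc := hT.continuousOn_of_lipschitz hw
  have hwi : IntegrableOn w Ω :=
    (hwc.integrableOn_compact hΩb.isCompact_closure).mono_set subset_closure
  refine TV_le_of_partials hwi fun i φ h1 h2 h3 h4 => ?_
  set v : Eucl d := EuclideanSpace.single i 1 with hv
  have hv1 : ‖v‖ = 1 := by simp [hv]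
  -- A crude Lipschitz constant for all cells at once; it serves only for dominated convergence,
  -- while the final bound comes from `b`.
  set L : ℝ := ∑ s ∈ hT.cellFinset, B s with hL
  have hwL : ∀ s ∈ cells K, ∀ x ∈ simplex s, ∀ y ∈ simplex s, |w x - w y| ≤ L * ‖x - y‖ := by
    intro s hs x hx y hy
    refine (hw s hs x hx y hy).trans ?_
    gcongr
    exact Finset.single_le_sum (fun s _ => hB s) (hT.mem_cellFinset.2 hs)
  set f := Ω.indicator w with hf
  have hfi : Integrable f := (integrable_indicator_iff hΩ.measurableSet).2 hwi
  have hder := hasDerivAt_integral_translate hfi h1 h2 v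
  obtain ⟨δ, hδ, hδΩ⟩ := IsCompact.exists_cthickening_subset_open h2 hΩ h3
  have hmem : ∀ x ∈ tsupport φ, ∀ τ ∈ Icc (0 : ℝ) δ, x + τ • (-v) ∈ Ω := by
    intro x hx τ hτ
    refine hδΩ (Metric.mem_cthickening_of_dist_le _ x δ _ hx ?_)
    rw [dist_eq_norm, add_sub_cancel_left, norm_smul, norm_neg, hv1, mul_one,
      Real.norm_of_nonneg hτ.1]
    exact hτ.2
  set b : Eucl d → ℝ := fun x => ∑ s ∈ hT.cellFinset, (simplex s).indicator (fun _ => B s) x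
    with hb
  have hbi : Integrable b := by
    refine integrable_finsetSum _ fun s _ => ?_
    rw [integrable_indicator_iff (isCompact_simplex s).measurableSet]
    exact integrableOn_const (measure_simplex_ne_top s)
  have hb0 : ∀ x, 0 ≤ b x := fun x => Finset.sum_nonneg fun s _ =>
    indicator_nonneg (fun _ _ => hB s) x
  have hbint : ∫ x, b x = ∑ s ∈ hT.cellFinset, volume.real (simplex s) * B s := by
    rw [integral_finsetSum]
    · refine Finset.sum_congr rfl fun s _ => ?_
      rw [integral_indicator (isCompact_simplex s).measurableSet, setIntegral_const, smul_eq_mul]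
    · intro s _
      rw [integrable_indicator_iff (isCompact_simplex s).measurableSet]
      exact integrableOn_const (measure_simplex_ne_top s)
  have hble : ∀ s ∈ cells K, ∀ x ∈ simplex s, B s ≤ b x := by
    intro s hs x hx
    have := Finset.single_le_sum (f := fun s => (simplex s).indicator (fun _ => B s) x)
      (fun s _ => indicator_nonneg (fun _ _ => hB s) x) (hT.mem_cellFinset.2 hs)
    simpa [hx] using this
  set Q : ℝ → Eucl d → ℝ := fun t x => t⁻¹ * (f (x + t • (-v)) - f x) with hQ
  have hQL : ∀ t ∈ Ioc (0 : ℝ) δ, ∀ x ∈ tsupport φ, |Q t x| ≤ L := by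
    intro t ht x hx
    have hseg := hT.abs_sub_le_of_segment hwL ht.1.le
      (fun τ hτ => subset_closure (hmem x hx τ ⟨hτ.1, hτ.2.trans ht.2⟩))
    have hx0 : x ∈ Ω := h3 hx
    have hxt := hmem x hx t ⟨ht.1.le, ht.2⟩
    simp only [hQ, hf, indicator_of_mem hx0, indicator_of_mem hxt]
    rw [abs_mul, abs_inv, abs_of_pos ht.1, inv_mul_le_iff₀ ht.1]
    rw [norm_neg, hv1, mul_one] at hseg
    linarith
  -- The excess of the difference quotient over `b`. It is at most `L`, and at interior points of
  -- cells, hence almost everywhere, it vanishes for small `t`; its integral therefore tends to 0.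
  set E : ℝ → Eucl d → ℝ := fun t => (tsupport φ).indicator fun x => max (|Q t x| - b x) 0 with hE
  have hQm : ∀ t, AEStronglyMeasurable (Q t) volume := fun t =>
    ((hfi.comp_add_right (t • (-v))).aestronglyMeasurable.sub hfi.aestronglyMeasurable).const_mul _
  have hEm : ∀ t, AEStronglyMeasurable (E t) volume := fun t =>
    ((((hQm t).norm).sub hbi.aestronglyMeasurable).sup aestronglyMeasurable_const).indicator
      h2.isCompact.measurableSet
  have hφL : Integrable ((tsupport φ).indicator fun _ => L) := by
    rw [integrable_indicator_iff h2.isCompact.measurableSet]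
    exact integrableOn_const h2.isCompact.measure_lt_top.ne
  have hL0 : 0 ≤ L := Finset.sum_nonneg fun s _ => hB s
  have hEb : ∀ t ∈ Ioc (0 : ℝ) δ, ∀ x, ‖E t x‖ ≤ (tsupport φ).indicator (fun _ => L) x := by
    intro t ht x
    by_cases hx : x ∈ tsupport φ
    · simp only [hE, indicator_of_mem hx]
      rw [Real.norm_of_nonneg (le_max_right _ _)]
      exact max_le (by linarith [hQL t ht x hx, hb0 x]) hL0
    · simp [hE, hx]
  have hsmall : ∀ᶠ t in 𝓝[>] (0 : ℝ), t ∈ Ioc (0 : ℝ) δ := Ioc_mem_nhdsGT hδ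
  have hElim : ∀ᵐ x, Tendsto (fun t => E t x) (𝓝[>] 0) (𝓝 0) := by
    have hfr : ∀ᵐ x, ∀ s ∈ hT.cellFinset, x ∉ frontier (simplex s) := by
      rw [Finset.eventually_all]
      intro s _
      exact measure_eq_zero_iff_ae_notMem.1
        ((convex_convexHull ℝ (s : Set (Eucl d))).addHaar_frontier volume)
    filter_upwards [hfr] with x hx
    by_cases hxφ : x ∈ tsupport φ
    · obtain ⟨s, hs, hxs⟩ := hT.exists_cell (subset_closure (h3 hxφ))
      have hxi : x ∈ interior (simplex s) := by
        by_contra hcon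
        exact hx s (hT.mem_cellFinset.2 hs) ⟨subset_closure hxs, hcon⟩
      have hcont : Tendsto (fun t : ℝ => x + t • (-v)) (𝓝[>] 0) (𝓝 x) := by
        have : Continuous fun t : ℝ => x + t • (-v) := by fun_prop
        have h5 := (this.tendsto 0).mono_left (nhdsWithin_le_nhds (s := Ioi 0))
        simpa using h5
      have hev := hcont.eventually (isOpen_interior.mem_nhds hxi)
      refine tendsto_const_nhds.congr' ?_
      filter_upwards [hev, hsmall] with t ht1 ht2
      have hx0 : x ∈ Ω := h3 hxφ
      have hxt := hmem x hxφ t ⟨ht2.1.le, ht2.2⟩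
      have h6 := hw s hs _ (interior_subset ht1) x hxs
      rw [add_sub_cancel_left, norm_smul, norm_neg, hv1, mul_one,
        Real.norm_of_nonneg ht2.1.le] at h6
      have h7 : |Q t x| ≤ b x := by
        refine le_trans ?_ (hble s hs x hxs)
        simp only [hQ, hf, indicator_of_mem hx0, indicator_of_mem hxt]
        rw [abs_mul, abs_inv, abs_of_pos ht2.1, inv_mul_le_iff₀ ht2.1]
        linarith
      simp only [hE, indicator_of_mem hxφ]
      rw [max_eq_right (by linarith)]
    · simp [hE, hxφ]
  have hDCT : Tendsto (fun t => ∫ x, E t x) (𝓝[>] 0) (𝓝 0) := by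
    have := tendsto_integral_filter_of_dominated_convergence (F := E) (f := fun _ => (0 : ℝ))
      (μ := volume) (l := 𝓝[>] (0 : ℝ)) ((tsupport φ).indicator fun _ => L)
      (Eventually.of_forall hEm)
      (hsmall.mono fun t ht => Eventually.of_forall (hEb t ht)) hφL hElim
    simpa using this
  have hslope : Tendsto (fun t : ℝ => t⁻¹ * ((∫ x, f x * φ (x + t • v)) - ∫ x, f x * φ x))
      (𝓝[>] 0) (𝓝 (∫ x, f x * fderiv ℝ φ x v)) := by
    have := hder.tendsto_slope.mono_left (nhdsWithin_mono 0 fun t (ht : 0 < t) => ht.ne')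
    refine this.congr fun t => ?_
    simp [slope, vsub_eq_sub]
  have hfinal : ∫ x, f x * fderiv ℝ φ x v ≤ (∫ x, b x) + 0 := by
    refine le_of_tendsto_of_tendsto hslope (hDCT.const_add _) ?_
    filter_upwards [hsmall] with t ht
    obtain ⟨C, hC⟩ := h1.continuous.bounded_above_of_compact_support h2
    have e1 : ∫ x, f x * φ (x + t • v) = ∫ x, f (x + t • (-v)) * φ x := by
      rw [← integral_add_right_eq_self (fun x => f x * φ (x + t • v)) (t • (-v))]
      simp
    have i1 : Integrable fun x => f (x + t • (-v)) * φ x :=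
      (hfi.comp_add_right _).mul_bdd (c := C) h1.continuous.aestronglyMeasurable
        (Eventually.of_forall hC)
    have i2 : Integrable fun x => f x * φ x :=
      hfi.mul_bdd (c := C) h1.continuous.aestronglyMeasurable (Eventually.of_forall hC)
    have hEi : Integrable (E t) := hφL.mono' (hEm t) (Eventually.of_forall (hEb t ht))
    rw [e1, ← integral_sub i1 i2, ← integral_const_mul, ← integral_add hbi hEi]
    refine integral_mono ((i1.sub i2).const_mul _) (hbi.add hEi) fun x => ?_
    have e2 : t⁻¹ * (f (x + t • (-v)) * φ x - f x * φ x) = Q t x * φ x := by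
      simp only [hQ]; ring
    show t⁻¹ * (f (x + t • (-v)) * φ x - f x * φ x) ≤ b x + E t x
    rw [e2]
    by_cases hx : x ∈ tsupport φ
    · simp only [hE, indicator_of_mem hx]
      have h8 : Q t x * φ x ≤ |Q t x| := by
        refine (le_abs_self _).trans ?_
        rw [abs_mul]
        exact mul_le_of_le_one_right (abs_nonneg _) (h4 x)
      linarith [le_max_left (|Q t x| - b x) 0]
    · simp [hE, hx, image_eq_zero_of_notMem_tsupport hx, hb0 x]
  rw [add_zero, hbint] at hfinal
  refine le_trans (le_of_eq ?_) hfinal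
  rw [← integral_indicator hΩ.measurableSet]
  congr 1
  ext x
  by_cases hx : x ∈ Ω <;> simp [hf, hx]

end PiecewiseLipschitz

end TVFEM

namespace TVFEM

lemma abs_avg_le_of_ae {d : ℕ} {k f : Eucl d → ℝ} {B : ℝ} (hf : ∀ᵐ t, |f t| ≤ B)
    (hk : Integrable k) (x : Eucl d) : |avg k f x| ≤ B * ∫ u, |k u| := by
  have h1 : ∫ u, |k u| = ∫ t, |k (x - t)| :=
    (integral_sub_left_eq_self (fun u => |k u|) volume x).symm
  rw [h1, avg, ← integral_const_mul, ← Real.norm_eq_abs]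
  refine norm_integral_le_of_norm_le ((hk.comp_sub_left x).abs.const_mul _) ?_
  filter_upwards [hf] with t ht
  rw [norm_mul]
  exact mul_le_mul_of_nonneg_right ht (abs_nonneg _)

/-! ### Oscillation over the cells of the gradient of the averages. -/

namespace InwardCover

variable {d : ℕ} {Ω : Set (Eucl d)} {ι : Type} [Fintype ι] (c : InwardCover Ω ι)
  {q : Eucl d → ℝ} {ε h : ℝ} {K : Geometry.SimplicialComplex ℝ (Eucl d)}

/-- The point set where a difference of two translated kernels lives. -/
lemma kernel_pair_support {w x y : Eucl d} (hε : 0 < ε) :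
    IsCompact ({t | x - t ∈ tsupport (kernel w ε)} ∪ {t | y - t ∈ tsupport (kernel w ε)}) := by
  have h1 : ∀ x : Eucl d, IsCompact {t | x - t ∈ tsupport (kernel w ε)} := fun x =>
    (Homeomorph.subLeft x).isCompact_preimage.2 (hasCompactSupport_kernel hε).isCompact
  exact (h1 x).union (h1 y)

/-- The second base point `y` need not lie in the support of `ψ_j`: `y + ε z = x + ε z'` with `‖z' -
z‖ ≤ 1`, which is where radius 2 in the cone condition is used. -/
lemma kernel_pair_subset {j : ι} {x y : Eucl d} (hε : 0 < ε) (hε' : ε ≤ c.ε₀)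
    (hx : x ∈ closure Ω) (hxj : x ∈ tsupport (c.ψ j)) (hxy : ‖x - y‖ ≤ ε) :
    {t | x - t ∈ tsupport (kernel (c.w j) ε)} ∪ {t | y - t ∈ tsupport (kernel (c.w j) ε)} ⊆ Ω := by
  rintro t (ht | ht)
  · obtain ⟨z, hz, hzt⟩ := exists_of_mem_tsupport_kernel hε ht
    have h1 : t = x + ε • z := by rw [← sub_eq_iff_eq_add', ← neg_sub, hzt, neg_neg]
    exact h1 ▸ c.add_mem hx hxj hε hε' hz
  · obtain ⟨z, hz, hzt⟩ := exists_of_mem_tsupport_kernel hε ht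
    have h1 : t = y + ε • z := by rw [← sub_eq_iff_eq_add', ← neg_sub, hzt, neg_neg]
    have h2 : t = x + ε • (z - ε⁻¹ • (x - y)) := by
      rw [h1, smul_sub, smul_smul, mul_inv_cancel₀ hε.ne', one_smul]
      abel
    rw [h2]
    refine c.inward j x hx hxj ε ⟨hε, hε'⟩ _ ?_
    rw [mem_closedBall_iff_norm] at hz ⊢
    have h3 : ‖ε⁻¹ • (x - y)‖ ≤ 1 := by
      rw [norm_smul, norm_inv, Real.norm_of_nonneg hε.le, inv_mul_le_iff₀ hε, mul_one]
      exact hxy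
    calc ‖z - ε⁻¹ • (x - y) - c.w j‖ = ‖(z - c.w j) - ε⁻¹ • (x - y)‖ := by congr 1; abel
      _ ≤ ‖z - c.w j‖ + ‖ε⁻¹ • (x - y)‖ := norm_sub_le _ _
      _ ≤ 2 := by linarith

/-- The kernel is Lipschitz with constant of order `ε^{-(d+1)}`, and the two points are at most `h`
apart. Cells with a nonzero term lie in the ball of radius `ε (W + 2)` around `t`: reach `W + 1` of
the kernel, plus a diameter `h ≤ ε`. Their total volume is of order `ε^d`. -/
lemma sum_kernel_pair_le {L W : ℝ} (hL0 : 0 ≤ L) (hW0 : 0 ≤ W)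
    (hL : ∀ x y, |mollifier d x - mollifier d y| ≤ L * ‖x - y‖) {w : Eucl d} (hw : ‖w‖ ≤ W)
    (hε : 0 < ε) (hh : 0 < h) (hhε : h ≤ ε) {A : Finset (Finset (Eucl d))}
    (hA : ∀ s ∈ A, s ∈ cells K) (hdiam : ∀ s ∈ cells K, Metric.diam (simplex s) ≤ h)
    {x y : Finset (Eucl d) → Eucl d} (hx : ∀ s ∈ A, x s ∈ simplex s)
    (hy : ∀ s ∈ A, y s ∈ simplex s) (t : Eucl d) :
    ∑ s ∈ A, volume.real (simplex s) * |kernel w ε (x s - t) - kernel w ε (y s - t)| ≤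
      L * (W + 2) ^ d * volume.real (Metric.ball (0 : Eucl d) 1) * (h / ε) := by
  classical
  set R : ℝ := ε * (W + 2) with hR
  have hR0 : 0 ≤ R := by positivity
  set A' := A.filter fun s => simplex s ⊆ Metric.closedBall t R with hA'
  have h1 : ∀ s ∈ A, s ∉ A' →
      volume.real (simplex s) * |kernel w ε (x s - t) - kernel w ε (y s - t)| = 0 := by
    intro s hs hs'
    have h2 : ∀ z ∈ simplex s, kernel w ε (z - t) = 0 := by
      intro z hz
      by_contra hne
      refine hs' (Finset.mem_filter.2 ⟨hs, fun u hu => ?_⟩)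
      rw [mem_closedBall_iff_norm]
      have h3 := norm_le_of_kernel_ne_zero hε hne
      have h4 := (norm_sub_le_diam hu hz).trans (hdiam s (hA s hs))
      have h5 : ε * (‖w‖ + 1) ≤ ε * (W + 1) := by gcongr
      calc ‖u - t‖ = ‖(u - z) + (z - t)‖ := by congr 1; abel
        _ ≤ ‖u - z‖ + ‖z - t‖ := norm_add_le _ _
        _ ≤ R := by rw [hR]; linarith
    rw [h2 _ (hx s hs), h2 _ (hy s hs)]
    simp
  rw [← Finset.sum_subset (Finset.filter_subset _ A) h1]
  have h6 : ∀ s ∈ A', volume.real (simplex s) *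
      |kernel w ε (x s - t) - kernel w ε (y s - t)| ≤
      volume.real (simplex s) * (L * (ε ^ (d + 1))⁻¹ * h) := by
    intro s hs
    have hsA := (Finset.mem_filter.1 hs).1
    refine mul_le_mul_of_nonneg_left ?_ measureReal_nonneg
    refine (abs_kernel_sub_le hL hε _ _).trans ?_
    rw [sub_sub_sub_cancel_right]
    gcongr
    exact (norm_sub_le_diam (hx s hsA) (hy s hsA)).trans (hdiam s (hA s hsA))
  refine (Finset.sum_le_sum h6).trans ?_
  rw [← Finset.sum_mul]
  have h7 : ∑ s ∈ A', volume.real (simplex s) ≤ volume.real (Metric.closedBall t R) :=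
    IsTriangulation.sum_measureReal_le_of_cells (K := K) A'
      (fun s hs => hA s (Finset.mem_filter.1 hs).1)
      (measure_closedBall_lt_top).ne fun s hs => (Finset.mem_filter.1 hs).2
  have h8 : volume.real (Metric.closedBall t R) =
      R ^ d * volume.real (Metric.ball (0 : Eucl d) 1) := by
    have := Measure.addHaar_real_closedBall (volume : Measure (Eucl d)) t hR0
    rwa [finrank_euclideanSpace, Fintype.card_fin] at this
  calc (∑ s ∈ A', volume.real (simplex s)) * (L * (ε ^ (d + 1))⁻¹ * h)
      ≤ (R ^ d * volume.real (Metric.ball (0 : Eucl d) 1)) * (L * (ε ^ (d + 1))⁻¹ * h) := by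
        rw [← h8]
        gcongr
    _ = L * (W + 2) ^ d * volume.real (Metric.ball (0 : Eucl d) 1) * (h / ε) := by
        rw [hR, mul_pow, pow_succ]
        field_simp

/-- Duality estimate for the oscillation of the first derivatives of the averages, summed over the
cells of a triangulation. -/
lemma exists_sum_osc_partial_le (hΩ : IsOpen Ω) (hq : IntegrableOn q Ω) (hTV : TV Ω q ≠ ⊤) :
    ∃ C : ℝ, 0 ≤ C ∧ ∀ ε h : ℝ, 0 < ε → ε ≤ c.ε₀ → 0 < h → h ≤ ε →
      ∀ (K : Geometry.SimplicialComplex ℝ (Eucl d)) (hT : IsTriangulation Ω K),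
      (∀ s ∈ cells K, Metric.diam (simplex s) ≤ h) → ∀ (j : ι) (v : Eucl d), ‖v‖ ≤ 1 →
      ∀ x y : Finset (Eucl d) → Eucl d, (∀ s ∈ cells K, x s ∈ simplex s) →
      (∀ s ∈ cells K, y s ∈ simplex s) →
      ∑ s ∈ hT.cellFinset, volume.real (simplex s) * (c.ψ j (x s) *
        |fderiv ℝ (avg (kernel (c.w j) ε) (Ω.indicator q)) (x s) v -
          fderiv ℝ (avg (kernel (c.w j) ε) (Ω.indicator q)) (y s) v|) ≤ C * (h / ε) := by
  obtain ⟨W, hW0, hW⟩ := c.exists_direction_bound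
  obtain ⟨L, hL0, hL⟩ := exists_mollifier_lipschitz d
  refine ⟨L * (W + 2) ^ d * volume.real (Metric.ball (0 : Eucl d) 1) * (TV Ω q).toReal,
    by positivity, fun ε h hε hε' hh hhε K hT hdiam j v hv x y hx hy => ?_⟩
  set k := kernel (c.w j) ε with hk
  set f := Ω.indicator q with hf
  have hfi : Integrable f := (integrable_indicator_iff hΩ.measurableSet).2 hq
  have hkd : ContDiff ℝ 1 k := contDiff_kernel.of_le (by simp)
  have hkc : HasCompactSupport k := hasCompactSupport_kernel hε
  set g := fun z => fderiv ℝ (avg k f) z v with hg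
  -- With these signs the sum equals `-∫ q ∂_v φ` for the combination `φ` of kernel differences
  -- below, so it is at most `sup |φ|` times the variation. The factor `ψ_j` discards the cells
  -- where `w_j` need not point inwards, which keeps the support of `φ` in `Ω`.
  set σ : Finset (Eucl d) → ℝ := fun s => c.ψ j (x s) * SignType.sign (g (x s) - g (y s)) with hσ
  set φ : Eucl d → ℝ := fun t => ∑ s ∈ hT.cellFinset,
    volume.real (simplex s) * σ s * (k (x s - t) - k (y s - t)) with hφ
  have hσ1 : ∀ s, |σ s| ≤ 1 := by
    intro s
    have h1 : c.ψ j (x s) ≤ 1 :=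
      (Finset.single_le_sum (f := fun j => c.ψ j (x s)) (fun j _ => c.nonneg j _)
        (Finset.mem_univ j)).trans (c.sum_le_one _)
    rw [hσ, abs_mul, abs_of_nonneg (c.nonneg j _)]
    refine mul_le_one₀ h1 (abs_nonneg _) ?_
    rcases lt_trichotomy (g (x s) - g (y s)) 0 with h | h | h <;> simp [h]
  have hkx : ∀ z : Eucl d, ContDiff ℝ 1 fun t => k (z - t) := fun z =>
    hkd.comp (contDiff_const.sub contDiff_id)
  have hφ1 : ContDiff ℝ 1 φ :=
    ContDiff.sum fun s _ => contDiff_const.mul ((hkx _).sub (hkx _))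
  set S : Set (Eucl d) := ⋃ s ∈ {s | s ∈ hT.cellFinset ∧ σ s ≠ 0},
    ({t | x s - t ∈ tsupport k} ∪ {t | y s - t ∈ tsupport k}) with hS
  have hfin : {s | s ∈ hT.cellFinset ∧ σ s ≠ 0}.Finite :=
    hT.cellFinset.finite_toSet.subset fun s hs => hs.1
  have hSc : IsCompact S := hfin.isCompact_biUnion fun s _ => kernel_pair_support hε
  have hSΩ : S ⊆ Ω := by
    refine iUnion₂_subset fun s hs => ?_
    have hsc := hT.mem_cellFinset.1 hs.1
    refine c.kernel_pair_subset hε hε' (hT.simplex_subset hsc (hx s hsc))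
      (subset_tsupport _ (left_ne_zero_of_mul hs.2)) ?_
    exact ((norm_sub_le_diam (hx s hsc) (hy s hsc)).trans (hdiam s hsc)).trans hhε
  have hsupp : Function.support φ ⊆ S := by
    intro t ht
    obtain ⟨s, hs, hne⟩ := Finset.exists_ne_zero_of_sum_ne_zero ht
    have hσs : σ s ≠ 0 := right_ne_zero_of_mul (left_ne_zero_of_mul hne)
    refine mem_biUnion (show s ∈ {s | s ∈ hT.cellFinset ∧ σ s ≠ 0} from ⟨hs, hσs⟩) ?_
    by_contra hcon
    simp only [mem_union, not_or] at hcon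
    refine right_ne_zero_of_mul hne ?_
    rw [image_eq_zero_of_notMem_tsupport (f := k) hcon.1,
      image_eq_zero_of_notMem_tsupport (f := k) hcon.2, sub_zero]
  have hφb : ∀ t, |φ t| ≤ L * (W + 2) ^ d * volume.real (Metric.ball (0 : Eucl d) 1) * (h / ε) := by
    intro t
    refine (Finset.abs_sum_le_sum_abs _ _).trans (le_trans (Finset.sum_le_sum fun s _ => ?_)
      (sum_kernel_pair_le hL0.le hW0 hL (hW j) hε hh hhε (fun s hs => hT.mem_cellFinset.1 hs) hdiam
        (fun s hs => hx s (hT.mem_cellFinset.1 hs)) (fun s hs => hy s (hT.mem_cellFinset.1 hs)) t))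
    rw [abs_mul, abs_mul, abs_of_nonneg measureReal_nonneg]
    refine mul_le_mul_of_nonneg_right ?_ (abs_nonneg _)
    exact mul_le_of_le_one_right measureReal_nonneg (hσ1 s)
  have key := abs_integral_mul_fderiv_le (q := q) (φ := φ) hTV (by positivity) hφ1
    (HasCompactSupport.of_support_subset_isCompact hSc hsupp)
    ((closure_minimal hsupp hSc.isClosed).trans hSΩ) hφb v
  have hgz : ∀ z, g z = ∫ t, f t * fderiv ℝ k (z - t) v := fun z =>
    fderiv_avg hfi.locallyIntegrable hkd hkc z v
  have hki : ∀ z : Eucl d, Integrable fun t => f t * fderiv ℝ k (z - t) v := by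
    intro z
    have hc : Continuous fun u => fderiv ℝ k u v :=
      (hkd.continuous_fderiv one_ne_zero).clm_apply continuous_const
    obtain ⟨B, hB⟩ := hc.bounded_above_of_compact_support (hkc.fderiv_apply (𝕜 := ℝ) v)
    exact hfi.mul_bdd (c := B) (hc.comp (by fun_prop)).aestronglyMeasurable
      (Eventually.of_forall fun t => hB _)
  have hkd' : ∀ z t, HasFDerivAt (fun t => k (z - t))
      ((fderiv ℝ k (z - t)).comp (-ContinuousLinearMap.id ℝ (Eucl d))) t := by
    intro z t
    refine HasFDerivAt.comp t (hkd.differentiable one_ne_zero _).hasFDerivAt ?_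
    simpa using (hasFDerivAt_id t).const_sub z
  have hφ' : ∀ t, fderiv ℝ φ t v = ∑ s ∈ hT.cellFinset, volume.real (simplex s) * σ s *
      (fderiv ℝ k (y s - t) v - fderiv ℝ k (x s - t) v) := by
    intro t
    have h1 : HasFDerivAt φ _ t := HasFDerivAt.fun_sum fun s (_ : s ∈ hT.cellFinset) =>
      ((hkd' (x s) t).sub (hkd' (y s) t)).const_mul (volume.real (simplex s) * σ s)
    rw [h1.fderiv, sum_apply]
    refine Finset.sum_congr rfl fun s _ => ?_
    simp
    ring
  have hint : ∫ t in Ω, q t * fderiv ℝ φ t v =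
      -∑ s ∈ hT.cellFinset, volume.real (simplex s) * (c.ψ j (x s) * |g (x s) - g (y s)|) := by
    have h2 : ∫ t in Ω, q t * fderiv ℝ φ t v = ∫ t, f t * fderiv ℝ φ t v := by
      rw [← integral_indicator hΩ.measurableSet]
      congr 1
      ext t
      by_cases ht : t ∈ Ω <;> simp [hf, ht]
    have h3 : ∀ t, f t * fderiv ℝ φ t v = ∑ s ∈ hT.cellFinset, volume.real (simplex s) * σ s *
        (f t * fderiv ℝ k (y s - t) v - f t * fderiv ℝ k (x s - t) v) := by
      intro t
      rw [hφ', Finset.mul_sum]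
      refine Finset.sum_congr rfl fun s _ => ?_
      ring
    rw [h2]
    simp only [h3]
    have h5 : ∀ s ∈ hT.cellFinset, Integrable fun t => volume.real (simplex s) * σ s *
        (f t * fderiv ℝ k (y s - t) v - f t * fderiv ℝ k (x s - t) v) := fun s _ =>
      ((hki (y s)).sub (hki (x s))).const_mul _
    rw [integral_finsetSum _ h5,
      ← Finset.sum_neg_distrib]
    refine Finset.sum_congr rfl fun s _ => ?_
    rw [integral_const_mul, integral_sub (hki (y s)) (hki (x s)), ← hgz, ← hgz]
    have h4 : |g (x s) - g (y s)| = SignType.sign (g (x s) - g (y s)) * (g (x s) - g (y s)) :=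
      (sign_mul_self _).symm
    rw [h4]
    simp only [hσ]
    ring
  rw [hint, abs_neg] at key
  refine (le_abs_self _).trans (key.trans ?_)
  calc ‖v‖ * (L * (W + 2) ^ d * volume.real (Metric.ball (0 : Eucl d) 1) * (h / ε)) *
        (TV Ω q).toReal
      ≤ 1 * (L * (W + 2) ^ d * volume.real (Metric.ball (0 : Eucl d) 1) * (h / ε)) *
        (TV Ω q).toReal := by gcongr
    _ = _ := by ring

end InwardCover

end TVFEM

namespace TVFEM

lemma exists_lipschitz_of_contDiff {d : ℕ} {F : Type*} [NormedAddCommGroup F] [NormedSpace ℝ F]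
    {g : Eucl d → F} (h1 : ContDiff ℝ 1 g) (h2 : HasCompactSupport g) :
    ∃ D : ℝ, 0 ≤ D ∧ ∀ x y, ‖g x - g y‖ ≤ D * ‖x - y‖ := by
  obtain ⟨C, hC⟩ := h1.lipschitzWith_of_hasCompactSupport h2 one_ne_zero
  exact ⟨C, C.2, fun x y => hC.norm_sub_le x y⟩

lemma opNorm_le_sum_single {d : ℕ} (L : Eucl d →L[ℝ] ℝ) :
    ‖L‖ ≤ ∑ i, |L (EuclideanSpace.single i 1)| := by
  refine L.opNorm_le_bound (by positivity) fun v => ?_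
  conv_lhs => rw [← sum_apply_smul_single v, map_sum]
  refine (norm_sum_le _ _).trans ?_
  rw [Finset.sum_mul]
  refine Finset.sum_le_sum fun i _ => ?_
  rw [map_smul, smul_eq_mul, norm_mul, mul_comm]
  refine mul_le_mul_of_nonneg_left ?_ (abs_nonneg _)
  simpa using PiLp.norm_apply_le v i

namespace InwardCover

variable {d : ℕ} {Ω : Set (Eucl d)} {ι : Type} [Fintype ι] (c : InwardCover Ω ι)
  {q : Eucl d → ℝ} {ε : ℝ}

lemma hasFDerivAt_smoothing (hΩ : IsOpen Ω) (hq : IntegrableOn q Ω) (hε : 0 < ε) (x : Eucl d) :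
    HasFDerivAt (c.smoothing q ε)
      (∑ j, (c.ψ j x • fderiv ℝ (avg (kernel (c.w j) ε) (Ω.indicator q)) x +
        avg (kernel (c.w j) ε) (Ω.indicator q) x • fderiv ℝ (c.ψ j) x)) x := by
  unfold smoothing
  exact HasFDerivAt.fun_sum fun j _ =>
    ((c.contDiff j).differentiable (by simp) x).hasFDerivAt.mul
      ((contDiff_avg_kernel hΩ hq hε _).differentiable (by simp) x).hasFDerivAt

/-- The oscillation of the gradient of the smoothed functions over the cells of a fine
triangulation. -/
lemma exists_sum_osc_fderiv_le (hΩ : IsOpen Ω) (hΩb : Bornology.IsBounded Ω)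
    (hq : IntegrableOn q Ω) (hTV : TV Ω q ≠ ⊤) {B : ℝ}
    (hB : ∀ᵐ x ∂(volume.restrict Ω), |q x| ≤ B) :
    ∃ C : ℝ, 0 ≤ C ∧ ∀ ε h : ℝ, 0 < ε → ε ≤ c.ε₀ → 0 < h → h ≤ ε →
      ∀ (K : Geometry.SimplicialComplex ℝ (Eucl d)) (hT : IsTriangulation Ω K),
      (∀ s ∈ cells K, Metric.diam (simplex s) ≤ h) → ∃ τ : Finset (Eucl d) → ℝ, (∀ s, 0 ≤ τ s) ∧
      (∀ s ∈ cells K, ∀ x ∈ simplex s, ∀ y ∈ simplex s,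
        ‖fderiv ℝ (c.smoothing q ε) x - fderiv ℝ (c.smoothing q ε) y‖ ≤ τ s) ∧
      ∑ s ∈ hT.cellFinset, volume.real (simplex s) * τ s ≤ C * (h / ε) := by
  obtain ⟨C₁, hC₁0, hC₁⟩ := c.exists_sum_osc_partial_le hΩ hq hTV
  obtain ⟨D, hD0, hD⟩ := c.exists_gradient_bound
  choose D₂' hD₂'0 hD₂' using fun j => exists_lipschitz_of_contDiff
    ((c.contDiff j).fderiv_right (m := 1) (WithTop.coe_le_coe.2 le_top))
    ((c.hasCompactSupport j).fderiv (𝕜 := ℝ))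
  set D₂ := ∑ j, D₂' j with hD₂
  have hD₂0 : 0 ≤ D₂ := Finset.sum_nonneg fun j _ => hD₂'0 j
  have hD₂j : ∀ j, D₂' j ≤ D₂ := fun j =>
    Finset.single_le_sum (fun j _ => hD₂'0 j) (Finset.mem_univ j)
  obtain ⟨C₂, hC₂0, hC₂⟩ := exists_integral_abs_fderiv_kernel_le d
  set B' := max B 0 with hB'
  have hB'0 : 0 ≤ B' := le_max_right _ _
  set N : ℝ := (Fintype.card ι : ℝ) with hN
  -- Collects the terms of the product rule with a derivative on `ψ_j`. Two are of order `h / ε`;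
  -- the third is of order `h`, which is at most `ε₀ (h / ε)`.
  set E : ℝ := 2 * D * (B' * C₂) + B' * D₂ * c.ε₀ with hE
  have hε₀ := c.pos
  have hE0 : 0 ≤ E := by positivity
  refine ⟨N * (d * C₁) + N * E * volume.real (closure Ω), by positivity,
    fun ε h hε hε' hh hhε K hT hdiam => ?_⟩
  set f := Ω.indicator q with hf
  set A := fun j => avg (kernel (c.w j) ε) f with hA
  have hfi : Integrable f := (integrable_indicator_iff hΩ.measurableSet).2 hq
  have hfB : ∀ᵐ t, |f t| ≤ B' := by
    rw [ae_restrict_iff' hΩ.measurableSet] at hB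
    filter_upwards [hB] with t ht
    by_cases htΩ : t ∈ Ω
    · rw [hf, indicator_of_mem htΩ]
      exact (ht htΩ).trans (le_max_left B 0)
    · simp [hf, htΩ, hB'0]
  have hAd : ∀ j, ContDiff ℝ ∞ (A j) := fun j => contDiff_avg_kernel hΩ hq hε _
  have hAb : ∀ j x, |A j x| ≤ B' := fun j x => by
    have := abs_avg_le_of_ae hfB (integrable_kernel (w := c.w j) hε) x
    simpa only [abs_of_nonneg (kernel_nonneg hε _), integral_kernel hε, mul_one] using this
  have hAg : ∀ j x, ‖fderiv ℝ (A j) x‖ ≤ B' * C₂ * ε⁻¹ := fun j x => by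
    refine ContinuousLinearMap.opNorm_le_bound _ (by positivity) fun v => ?_
    rw [hA, fderiv_avg hfi.locallyIntegrable (contDiff_kernel.of_le (by simp))
      (hasCompactSupport_kernel hε), Real.norm_eq_abs]
    have hki : Integrable fun u => fderiv ℝ (kernel (c.w j) ε) u v :=
      (((contDiff_kernel (w := c.w j) (ε := ε)).continuous_fderiv (by simp)).clm_apply
        continuous_const).integrable_of_hasCompactSupport
        ((hasCompactSupport_kernel hε).fderiv_apply (𝕜 := ℝ) v)
    refine (abs_avg_le_of_ae hfB hki x).trans ?_
    calc B' * ∫ u, |fderiv ℝ (kernel (c.w j) ε) u v| ≤ B' * (C₂ * ε⁻¹ * ‖v‖) := by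
          gcongr
          exact hC₂ _ _ hε v
      _ = B' * C₂ * ε⁻¹ * ‖v‖ := by ring
  have hAl : ∀ j x y, |A j x - A j y| ≤ B' * C₂ * ε⁻¹ * ‖x - y‖ := fun j x y =>
    abs_sub_le_of_norm_fderiv_le ((hAd j).of_le (by simp)) (hAg j) x y
  have hAgc : ∀ j, Continuous (fderiv ℝ (A j)) := fun j => (hAd j).continuous_fderiv (by simp)
  -- the maximal oscillation of the partial derivatives on each cell
  set G : ι → Fin d → Eucl d × Eucl d → ℝ := fun j i p => c.ψ j p.1 *
    |fderiv ℝ (A j) p.1 (EuclideanSpace.single i 1) -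
      fderiv ℝ (A j) p.2 (EuclideanSpace.single i 1)| with hG
  have hGc : ∀ j i, Continuous (G j i) := fun j i => by
    have h1 := hAgc j
    have h2 := (c.contDiff j).continuous
    have h3 : Continuous fun p : Eucl d × Eucl d => fderiv ℝ (A j) p.1
      (EuclideanSpace.single i 1) := by fun_prop
    have h4 : Continuous fun p : Eucl d × Eucl d => fderiv ℝ (A j) p.2
      (EuclideanSpace.single i 1) := by fun_prop
    exact (h2.comp continuous_fst).mul (h3.sub h4).abs
  -- The maximum is attained on each cell, so the duality estimate applies to the maximizing pairs.
  have hmax : ∀ (j : ι) (i : Fin d) (s : Finset (Eucl d)), s ∈ cells K →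
      ∃ p ∈ simplex s ×ˢ simplex s, IsMaxOn (G j i) (simplex s ×ˢ simplex s) p := by
    intro j i s hs
    have hne : (simplex s).Nonempty := by
      rw [convexHull_nonempty_iff]
      exact_mod_cast K.nonempty_of_mem_faces hs.1
    exact ((isCompact_simplex s).prod (isCompact_simplex s)).exists_isMaxOn (hne.prod hne)
      (hGc j i).continuousOn
  choose! P hPmem hPmax using hmax
  have hG0 : ∀ j i p, 0 ≤ G j i p := fun j i p => mul_nonneg (c.nonneg j _) (abs_nonneg _)
  refine ⟨fun s => ∑ j, ((∑ i, G j i (P j i s)) + E * (h / ε)), fun s => ?_,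
    fun s hs x hx y hy => ?_, ?_⟩
  · exact Finset.sum_nonneg fun j _ => add_nonneg (Finset.sum_nonneg fun i _ => hG0 j i _)
      (by positivity)
  · have hxy : ‖x - y‖ ≤ h := (norm_sub_le_diam hx hy).trans (hdiam s hs)
    rw [(c.hasFDerivAt_smoothing hΩ hq hε x).fderiv, (c.hasFDerivAt_smoothing hΩ hq hε y).fderiv,
      ← Finset.sum_sub_distrib]
    refine (norm_sum_le _ _).trans (Finset.sum_le_sum fun j _ => ?_)
    -- The splitting puts `ψ_j` at the first point in front of the difference of gradients, as in
    -- the duality estimate.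
    have e1 : (c.ψ j x • fderiv ℝ (A j) x + A j x • fderiv ℝ (c.ψ j) x) -
        (c.ψ j y • fderiv ℝ (A j) y + A j y • fderiv ℝ (c.ψ j) y) =
        c.ψ j x • (fderiv ℝ (A j) x - fderiv ℝ (A j) y) +
        ((c.ψ j x - c.ψ j y) • fderiv ℝ (A j) y + (A j x • (fderiv ℝ (c.ψ j) x - fderiv ℝ (c.ψ j) y)
          + (A j x - A j y) • fderiv ℝ (c.ψ j) y)) := by
      module
    show ‖(c.ψ j x • fderiv ℝ (A j) x + A j x • fderiv ℝ (c.ψ j) x) -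
        (c.ψ j y • fderiv ℝ (A j) y + A j y • fderiv ℝ (c.ψ j) y)‖ ≤ _
    rw [e1]
    refine (norm_add_le _ _).trans (add_le_add ?_ ?_)
    · rw [norm_smul, Real.norm_of_nonneg (c.nonneg j x)]
      refine (mul_le_mul_of_nonneg_left (opNorm_le_sum_single _) (c.nonneg j x)).trans ?_
      rw [Finset.mul_sum]
      refine Finset.sum_le_sum fun i _ => ?_
      exact hPmax j i s hs (show (x, y) ∈ simplex s ×ˢ simplex s from ⟨hx, hy⟩)
    · have t1 : ‖(c.ψ j x - c.ψ j y) • fderiv ℝ (A j) y‖ ≤ (D * h) * (B' * C₂ * ε⁻¹) := by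
        rw [norm_smul]
        refine mul_le_mul ?_ (hAg j y) (norm_nonneg _) (by positivity)
        refine (abs_sub_le_of_norm_fderiv_le ((c.contDiff j).of_le (by simp)) (hD j) x y).trans ?_
        gcongr
      have t2 : ‖A j x • (fderiv ℝ (c.ψ j) x - fderiv ℝ (c.ψ j) y)‖ ≤ B' * (D₂ * h) := by
        rw [norm_smul]
        refine mul_le_mul (hAb j x) ?_ (norm_nonneg _) hB'0
        refine (hD₂' j x y).trans ?_
        gcongr
        exact hD₂j j
      have t3 : ‖(A j x - A j y) • fderiv ℝ (c.ψ j) y‖ ≤ (B' * C₂ * ε⁻¹ * h) * D := by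
        rw [norm_smul]
        refine mul_le_mul ?_ (hD j y) (norm_nonneg _) (by positivity)
        refine (hAl j x y).trans ?_
        gcongr
      have t4 : B' * (D₂ * h) ≤ B' * D₂ * c.ε₀ * (h / ε) := by
        have h5 : h ≤ c.ε₀ * (h / ε) := by
          rw [mul_div_assoc', le_div_iff₀ hε, mul_comm]
          gcongr
        calc B' * (D₂ * h) ≤ B' * (D₂ * (c.ε₀ * (h / ε))) := by gcongr
          _ = _ := by ring
      have e2 : E * (h / ε) = (D * h) * (B' * C₂ * ε⁻¹) + (B' * D₂ * c.ε₀ * (h / ε) +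
          (B' * C₂ * ε⁻¹ * h) * D) := by
        rw [hE, div_eq_mul_inv]
        ring
      rw [e2]
      exact (norm_add_le _ _).trans (add_le_add t1 ((norm_add_le _ _).trans
        (add_le_add (t2.trans t4) t3)))
  · have e3 : ∑ s ∈ hT.cellFinset, volume.real (simplex s) *
        ∑ j, ((∑ i, G j i (P j i s)) + E * (h / ε)) =
        (∑ j, ∑ i, ∑ s ∈ hT.cellFinset, volume.real (simplex s) * G j i (P j i s)) +
        N * (E * (h / ε)) * ∑ s ∈ hT.cellFinset, volume.real (simplex s) := by
      simp only [Finset.sum_add_distrib, mul_add, Finset.mul_sum, Finset.sum_const, nsmul_eq_mul,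
        Finset.card_univ]
      congr 1
      · rw [Finset.sum_comm]
        refine Finset.sum_congr rfl fun j _ => ?_
        rw [Finset.sum_comm]
      · refine Finset.sum_congr rfl fun s _ => ?_
        ring
    rw [e3]
    have h6 : ∀ j i, ∑ s ∈ hT.cellFinset, volume.real (simplex s) * G j i (P j i s) ≤
        C₁ * (h / ε) := fun j i =>
      hC₁ ε h hε hε' hh hhε K hT hdiam j (EuclideanSpace.single i 1) (by simp)
        (fun s => (P j i s).1) (fun s => (P j i s).2) (fun s hs => (hPmem j i s hs).1)
        (fun s hs => (hPmem j i s hs).2)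
    have h7 : ∑ s ∈ hT.cellFinset, volume.real (simplex s) ≤ volume.real (closure Ω) :=
      IsTriangulation.sum_measureReal_le_of_cells (K := K) _ (fun s hs => hT.mem_cellFinset.1 hs)
        hΩb.isCompact_closure.measure_lt_top.ne
        fun s hs => hT.simplex_subset (hT.mem_cellFinset.1 hs)
    have h8 : ∑ j : ι, ∑ i : Fin d, ∑ s ∈ hT.cellFinset,
        volume.real (simplex s) * G j i (P j i s) ≤ N * (d * (C₁ * (h / ε))) := by
      refine (Finset.sum_le_sum fun j _ => Finset.sum_le_sum fun i _ => h6 j i).trans ?_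
      simp [hN]
    have h9 : N * (E * (h / ε)) * ∑ s ∈ hT.cellFinset, volume.real (simplex s) ≤
        N * (E * (h / ε)) * volume.real (closure Ω) := by gcongr
    calc _ ≤ N * (d * (C₁ * (h / ε))) + N * (E * (h / ε)) * volume.real (closure Ω) :=
          add_le_add h8 h9
      _ = _ := by ring

end InwardCover

/-! ### Admissibility and errors of nodal interpolants. -/

namespace IsTriangulation

variable {d : ℕ} {Ω : Set (Eucl d)} {K : Geometry.SimplicialComplex ℝ (Eucl d)}

lemma eLpNorm_le_of_cells (hT : IsTriangulation Ω K) {g : Eucl d → ℝ}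
    {b : Finset (Eucl d) → ℝ} (hb : ∀ s, 0 ≤ b s)
    (hg : ∀ s ∈ cells K, ∀ x ∈ simplex s, |g x| ≤ b s) :
    eLpNorm g 1 (volume.restrict Ω) ≤
      ENNReal.ofReal (∑ s ∈ hT.cellFinset, volume.real (simplex s) * b s) := by
  rw [eLpNorm_one_eq_lintegral_enorm]
  refine (lintegral_mono_set subset_closure).trans ?_
  rw [← hT.sum_setLIntegral_eq, ENNReal.ofReal_sum_of_nonneg fun s _ =>
    mul_nonneg measureReal_nonneg (hb s)]
  refine Finset.sum_le_sum fun s hs => ?_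
  have h1 : ∫⁻ x in simplex s, ‖g x‖ₑ ≤ ∫⁻ _ in simplex s, ENNReal.ofReal (b s) := by
    refine setLIntegral_mono' (isCompact_simplex s).measurableSet fun x hx => ?_
    rw [← ofReal_norm]
    exact ENNReal.ofReal_le_ofReal (hg s (hT.mem_cellFinset.1 hs) x hx)
  refine h1.trans (le_of_eq ?_)
  rw [setLIntegral_const, ENNReal.ofReal_mul measureReal_nonneg, mul_comm,
    ofReal_measureReal (measure_simplex_ne_top s)]

/-- Finite element functions with values in `[lo, hi]` at the nodes are admissible. -/
lemma memQadh_of_nodes (hΩ : IsOpen Ω) (hT : IsTriangulation Ω K)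
    {v w : Eucl d → ℝ} {lo hi : ℝ}
    (hv : ∀ s ∈ cells K, ∃ a : Eucl d →ᵃ[ℝ] ℝ, EqOn v a (simplex s) ∧ ∀ x ∈ s, a x = w x)
    (hw : ∀ x ∈ closure Ω, w x ∈ Icc lo hi) : MemQadh Ω lo hi K v := by
  have hvc : ContinuousOn v (closure Ω) := hT.continuousOn_of_cells fun s hs => by
    obtain ⟨a, ha, -⟩ := hv s hs
    exact (a.continuous_of_finiteDimensional.continuousOn).congr ha
  have hvb : ∀ x ∈ closure Ω, v x ∈ Icc lo hi := fun x hx => by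
    obtain ⟨s, hs, hxs⟩ := hT.exists_cell hx
    obtain ⟨a, ha, haw⟩ := hv s hs
    rw [ha hxs]
    refine affine_mem_Icc (fun y hy => ?_) hxs
    rw [haw y hy]
    exact hw y (hT.simplex_subset hs (vertex_mem_simplex hy))
  have hae : ∀ᵐ x ∂(volume.restrict Ω), lo ≤ v x ∧ v x ≤ hi := by
    rw [ae_restrict_iff' hΩ.measurableSet]
    exact Eventually.of_forall fun x hx => hvb x (subset_closure hx)
  refine ⟨⟨?_, hae⟩, hvc, fun s hs => ?_⟩
  · refine memLp_top_of_bound ((hvc.mono subset_closure).aestronglyMeasurable hΩ.measurableSet)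
      (max |lo| |hi|) (hae.mono fun x hx => ?_)
    exact abs_le_max_abs_abs hx.1 hx.2
  · obtain ⟨a, ha, -⟩ := hv s hs
    exact ⟨a, ha⟩

/-- Error estimates for the nodal interpolant of a smooth function in terms of the oscillation of
its gradient over the cells. -/
lemma interpolation_error (hΩ : IsOpen Ω) (hΩb : Bornology.IsBounded Ω) (hT : IsTriangulation Ω K)
    {κ h : ℝ} (hκ : 0 < κ) (hdiam : ∀ s ∈ cells K, Metric.diam (simplex s) ≤ h)
    (hreg : ∀ s ∈ cells K, ∃ (c : Eucl d) (r : ℝ), 0 < r ∧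
      Metric.closedBall c r ⊆ simplex s ∧ Metric.diam (simplex s) ≤ κ * r)
    {f v : Eucl d → ℝ} (hf : ContDiff ℝ 1 f) {τ : Finset (Eucl d) → ℝ} (hτ0 : ∀ s, 0 ≤ τ s)
    (hτ : ∀ s ∈ cells K, ∀ x ∈ simplex s, ∀ y ∈ simplex s, ‖fderiv ℝ f x - fderiv ℝ f y‖ ≤ τ s)
    (hv : ∀ s ∈ cells K, ∃ a : Eucl d →ᵃ[ℝ] ℝ, EqOn v a (simplex s) ∧ ∀ x ∈ s, a x = f x) :
    TV Ω (fun x => v x - f x) ≤ ENNReal.ofReal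
      (d * κ * ∑ s ∈ hT.cellFinset, volume.real (simplex s) * τ s) ∧
    eLpNorm (fun x => v x - f x) 1 (volume.restrict Ω) ≤ ENNReal.ofReal
      (κ * h * ∑ s ∈ hT.cellFinset, volume.real (simplex s) * τ s) := by
  have hlip : ∀ s ∈ cells K, ∀ x ∈ simplex s, ∀ y ∈ simplex s,
      |(v x - f x) - (v y - f y)| ≤ (κ * τ s) * ‖x - y‖ := by
    intro s hs x hx y hy
    obtain ⟨a, ha, haf⟩ := hv s hs
    obtain ⟨c, r, hr, hball, hdr⟩ := hreg s hs
    rw [ha hx, ha hy]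
    refine abs_sub_le_on_simplex hf (fun z hz => ?_) hx hy
    refine (norm_gradForm_sub_fderiv_le hr hball hf haf (hτ0 s) (hτ s hs) hz).trans ?_
    rw [div_le_iff₀ hr]
    calc τ s * Metric.diam (simplex s) ≤ τ s * (κ * r) := by gcongr; exact hτ0 s
      _ = κ * τ s * r := by ring
  have hκτ : ∀ s, 0 ≤ κ * τ s := fun s => mul_nonneg hκ.le (hτ0 s)
  constructor
  · refine (hT.TV_le_of_lipschitz hΩ hΩb hκτ hlip).trans (le_of_eq ?_)
    congr 1
    rw [Finset.mul_sum, Finset.mul_sum]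
    refine Finset.sum_congr rfl fun s _ => ?_
    ring
  -- The sign of `h` comes from the diameter of some cell; without cells both sides vanish.
  · rcases hT.cellFinset.eq_empty_or_nonempty with h0 | ⟨s₀, hs₀⟩
    · refine (hT.eLpNorm_le_of_cells (b := fun _ => 0) (fun _ => le_rfl) fun s hs => ?_).trans ?_
      · have := hT.mem_cellFinset.2 hs
        simp [h0] at this
      · simp [h0]
    have hh : 0 ≤ h := Metric.diam_nonneg.trans (hdiam s₀ (hT.mem_cellFinset.1 hs₀))
    refine (hT.eLpNorm_le_of_cells (b := fun s => κ * τ s * h)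
      (fun s => mul_nonneg (hκτ s) hh) fun s hs x hx => ?_).trans (le_of_eq ?_)
    -- The error vanishes at a vertex, so its Lipschitz constant times the diameter bounds it on the
    -- cell.
    · obtain ⟨y, hy⟩ := K.nonempty_of_mem_faces hs.1
      obtain ⟨a, ha, haf⟩ := hv s hs
      have h1 := hlip s hs x hx y (vertex_mem_simplex hy)
      rw [ha (vertex_mem_simplex hy), haf y hy, sub_self, sub_zero] at h1
      refine h1.trans ?_
      gcongr
      · exact hκτ s
      · exact (norm_sub_le_diam hx (vertex_mem_simplex hy)).trans (hdiam s hs)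
    · congr 1
      rw [Finset.mul_sum]
      refine Finset.sum_congr rfl fun s _ => ?_
      ring

end IsTriangulation

end TVFEM

namespace TVFEM

/-! ### Approximation of functions of bounded variation. -/

section Families

variable {d : ℕ} {Ω : Set (Eucl d)} {q : Eucl d → ℝ} {qlo qhi : ℝ}
  {K : ℝ → Geometry.SimplicialComplex ℝ (Eucl d)}

/-- Regularity and quasi-uniformity together make the inradius comparable to `h`; this also forces
`r > 0`. -/
lemma IsRegularQuasiUniformFamily.exists_ball (hK : IsRegularQuasiUniformFamily Ω K) :
    ∃ κ : ℝ, 0 < κ ∧ ∀ h ∈ Ioo (0 : ℝ) 1, ∀ s ∈ cells (K h), ∃ (c : Eucl d) (r : ℝ), 0 < r ∧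
      Metric.closedBall c r ⊆ simplex s ∧ h ≤ κ * r := by
  obtain ⟨κ, hκ, h1⟩ := hK.regular
  obtain ⟨τ, hτ, h2⟩ := hK.quasiUniform
  refine ⟨κ / τ, by positivity, fun h hh s hs => ?_⟩
  obtain ⟨c, r, hc, hr⟩ := h1 h hh s hs
  have h3 := (h2 h hh s hs).trans hr
  have h4 : 0 < κ * r := (mul_pos hτ hh.1).trans_le h3
  refine ⟨c, r, pos_of_mul_pos_right h4 hκ.le, hc, ?_⟩
  rw [div_mul_eq_mul_div, le_div_iff₀ hτ]
  linarith

/-- Lower semicontinuity supplies the lower bound, so an upper bound converging to the variation of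
`q` is enough. -/
lemma tendsto_TV_of_le {l : Filter ℝ} [l.NeBot] {F : ℝ → Eucl d → ℝ} {U : ℝ → ℝ≥0∞}
    (hF : ∀ᶠ h in l, IntegrableOn (F h) Ω) (hq : IntegrableOn q Ω)
    (hlim : Tendsto (fun h => eLpNorm (fun x => F h x - q x) 1 (volume.restrict Ω)) l (𝓝 0))
    (hle : ∀ᶠ h in l, TV Ω (F h) ≤ U h) (hU : Tendsto U l (𝓝 (TV Ω q))) :
    Tendsto (fun h => TV Ω (F h)) l (𝓝 (TV Ω q)) := by
  refine tendsto_of_le_liminf_of_limsup_le (TV_le_liminf hF hq hlim) ?_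
  rw [← hU.limsup_eq]
  exact limsup_le_limsup hle

lemma MemQ.integrableOn (hΩb : Bornology.IsBounded Ω) {v : Eucl d → ℝ} (hv : MemQ Ω qlo qhi v) :
    IntegrableOn v Ω := by
  have : IsFiniteMeasure (volume.restrict Ω) :=
    isFiniteMeasure_restrict.2 hΩb.measure_lt_top.ne
  exact hv.1.integrable le_top

lemma eLpNorm_eq_ofReal_integral {g : Eucl d → ℝ} (hg : IntegrableOn g Ω) :
    eLpNorm g 1 (volume.restrict Ω) = ENNReal.ofReal (∫ x in Ω, |g x|) := by
  rw [eLpNorm_one_eq_lintegral_enorm, ← ofReal_integral_norm_eq_lintegral_enorm hg]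
  rfl

lemma tendsto_mul_abs_log : Tendsto (fun h : ℝ => h * |Real.log h|) (𝓝[>] 0) (𝓝 0) := by
  have h1 := (Real.continuous_mul_log.tendsto 0).mono_left (nhdsWithin_le_nhds (s := Ioi 0))
  have h2 := h1.abs
  simp only [zero_mul, abs_zero] at h2
  refine h2.congr' ?_
  filter_upwards [self_mem_nhdsWithin] with h (hh : 0 < h)
  rw [abs_mul, abs_of_pos hh]

lemma tendsto_abs_log : Tendsto (fun h : ℝ => |Real.log h|) (𝓝[>] 0) atTop :=
  tendsto_abs_atBot_atTop.comp Real.tendsto_log_nhdsGT_zero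

lemma tendsto_eLpNorm_of_rate {F : ℝ → Eucl d → ℝ}
    (hrate : ∃ C h₁ : ℝ, 0 < h₁ ∧ ∀ h ∈ Ioc (0 : ℝ) h₁,
      eLpNorm (fun x => F h x - q x) 1 (volume.restrict Ω) ≤
        ENNReal.ofReal (C * h * |Real.log h|)) :
    Tendsto (fun h => eLpNorm (fun x => F h x - q x) 1 (volume.restrict Ω)) (𝓝[>] 0) (𝓝 0) := by
  obtain ⟨C, h₁, h₁0, hC⟩ := hrate
  have h2 : Tendsto (fun h : ℝ => ENNReal.ofReal (C * h * |Real.log h|)) (𝓝[>] 0) (𝓝 0) := by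
    have h3 := ENNReal.tendsto_ofReal (tendsto_mul_abs_log.const_mul C)
    simpa [mul_assoc] using h3
  refine tendsto_of_tendsto_of_tendsto_of_le_of_le' tendsto_const_nhds h2
    (Eventually.of_forall fun _ => zero_le) ?_
  filter_upwards [Ioc_mem_nhdsGT h₁0] with h hh using hC h hh

/-- Approximation of functions of bounded variation by finite element functions. -/
theorem exists_isApproximatingFamily (hΩ : IsPolygonalDomain Ω)
    (hK : IsRegularQuasiUniformFamily Ω K) (hq : MemQad Ω qlo qhi q) :
    ∃ qh : ℝ → Eucl d → ℝ, IsApproximatingFamily Ω qlo qhi K q qh := by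
  have hΩo := hΩ.isOpen
  have hΩb := hΩ.isBounded
  have hqi : IntegrableOn q Ω := hq.2.1
  have hTV : TV Ω q ≠ ⊤ := hq.2.2.ne
  have hfm : IsFiniteMeasure (volume.restrict Ω) :=
    isFiniteMeasure_restrict.2 hΩb.measure_lt_top.ne
  obtain ⟨ι, _, ⟨c⟩⟩ := exists_inwardCover hΩo hΩb hΩ.lipschitz
  -- `Ω` has positive measure, so some value of `q` lies between the bounds. Needed for the constant
  -- `qlo` to be admissible.
  have hlohi : qlo ≤ qhi := by
    have h1 : (volume.restrict Ω) ≠ 0 := by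
      rw [Ne, Measure.restrict_eq_zero]
      exact (hΩo.measure_pos volume hΩ.isConnected.nonempty).ne'
    have : (ae (volume.restrict Ω)).NeBot := ae_neBot.2 h1
    obtain ⟨x, hx⟩ := hq.1.2.exists
    exact hx.1.trans hx.2
  set B := max |qlo| |qhi| with hB
  have hqB : ∀ᵐ x ∂(volume.restrict Ω), |q x| ≤ B :=
    hq.1.2.mono fun x hx => abs_le_max_abs_abs hx.1 hx.2
  obtain ⟨C₁, hC₁0, hC₁⟩ := c.exists_integral_abs_smoothing_sub_le hΩo hΩb hqi hTV
  obtain ⟨C₂, hC₂0, hC₂⟩ := c.exists_TV_smoothing_le hΩo hΩb hqi hTV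
  obtain ⟨C₃, hC₃0, hC₃⟩ := c.exists_sum_osc_fderiv_le hΩo hΩb hqi hTV hqB
  obtain ⟨κ, hκ, hball⟩ := hK.exists_ball
  -- Below `h₁` the scale `ε = h |log h|` satisfies `h ≤ ε ≤ ε₀`, as the estimates require.
  obtain ⟨h₁, ⟨h₁1, hgood⟩, h₁0⟩ : ∃ h₁ : ℝ, (h₁ < 1 ∧ ∀ h ∈ Ioc (0 : ℝ) h₁,
      1 ≤ |Real.log h| ∧ h * |Real.log h| ≤ c.ε₀) ∧ 0 < h₁ := by
    have e1 : ∀ᶠ h in 𝓝[>] (0 : ℝ), 1 ≤ |Real.log h| ∧ h * |Real.log h| ≤ c.ε₀ :=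
      (tendsto_abs_log.eventually_ge_atTop 1).and
        (tendsto_mul_abs_log.eventually (Iic_mem_nhds c.pos))
    obtain ⟨u, hu0, hu⟩ := mem_nhdsGT_iff_exists_Ioc_subset.1 e1
    have hu0' : (0 : ℝ) < u := hu0
    exact ⟨min u (1 / 2), ⟨(min_le_right _ _).trans_lt (by norm_num), fun h hh =>
      hu ⟨hh.1, hh.2.trans (min_le_left _ _)⟩⟩, by positivity⟩
  set e : ℝ → ℝ := fun h => h * |Real.log h| with he
  have he0 : ∀ h ∈ Ioc (0 : ℝ) h₁, 0 < e h := fun h hh =>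
    mul_pos hh.1 (zero_lt_one.trans_le (hgood h hh).1)
  have hhe : ∀ h ∈ Ioc (0 : ℝ) h₁, h ≤ e h := fun h hh =>
    le_mul_of_one_le_right hh.1.le (hgood h hh).1
  have hIoo : ∀ h ∈ Ioc (0 : ℝ) h₁, h ∈ Ioo (0 : ℝ) 1 := fun h hh => ⟨hh.1, hh.2.trans_lt h₁1⟩
  choose! v hv using fun h (hh : h ∈ Ioo (0 : ℝ) 1) =>
    (hK.isTriangulation h hh).exists_interpolant (c.smoothing q (e h))
  -- Above `h₁` any admissible function will do: the rate is there a matter of the constant.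
  set qh : ℝ → Eucl d → ℝ := fun h => if h ≤ h₁ then v h else fun _ => qlo with hqh
  have hqh1 : ∀ h ∈ Ioc (0 : ℝ) h₁, qh h = v h := fun h hh => by simp [hqh, hh.2]
  have hqh2 : ∀ h, h₁ < h → qh h = fun _ => qlo := fun h hh => by simp [hqh, hh.not_ge]
  have hmem : ∀ h ∈ Ioo (0 : ℝ) 1, MemQadh Ω qlo qhi (K h) (qh h) := by
    intro h hh
    rcases le_or_gt h h₁ with hle | hlt
    · have hh1 : h ∈ Ioc (0 : ℝ) h₁ := ⟨hh.1, hle⟩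
      rw [hqh1 h hh1]
      exact (hK.isTriangulation h hh).memQadh_of_nodes hΩo (hv h hh) fun x hx =>
        c.smoothing_mem_Icc hΩo hqi hq.1.2 (he0 h hh1) (hgood h hh1).2 hx
    · rw [hqh2 h hlt]
      refine (hK.isTriangulation h hh).memQadh_of_nodes (w := fun _ => qlo) hΩo (fun s hs =>
        ⟨AffineMap.const ℝ _ qlo, fun x _ => rfl, fun x _ => rfl⟩) fun x _ => ⟨le_rfl, hlohi⟩
  have herr : ∀ h ∈ Ioc (0 : ℝ) h₁,
      TV Ω (fun x => v h x - c.smoothing q (e h) x) ≤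
        ENNReal.ofReal (d * κ * C₃ * |Real.log h|⁻¹) ∧
      eLpNorm (fun x => v h x - c.smoothing q (e h) x) 1 (volume.restrict Ω) ≤
        ENNReal.ofReal (κ * C₃ * e h) := by
    intro h hh
    have hhI := hIoo h hh
    have hT := hK.isTriangulation h hhI
    obtain ⟨τ, hτ0, hτ, hτsum⟩ := hC₃ (e h) h (he0 h hh) (hgood h hh).2 hh.1 (hhe h hh) (K h) hT
      (hK.meshSize h hhI)
    have key := hT.interpolation_error hΩo hΩb hκ (hK.meshSize h hhI) (fun s hs => by
      obtain ⟨x, r, hr, hb, hle⟩ := hball h hhI s hs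
      exact ⟨x, r, hr, hb, (hK.meshSize h hhI s hs).trans hle⟩)
      ((c.contDiff_smoothing hΩo hqi (he0 h hh)).of_le (by simp)) hτ0 hτ (hv h hhI)
    have hlog : 0 < |Real.log h| := zero_lt_one.trans_le (hgood h hh).1
    have hdiv : h / e h = |Real.log h|⁻¹ := by
      have := hh.1.ne'
      rw [he]
      field_simp
    have hdiv1 : h / e h ≤ 1 := div_le_one_of_le₀ (hhe h hh) (he0 h hh).le
    have hh0 := hh.1.le
    refine ⟨key.1.trans (ENNReal.ofReal_le_ofReal ?_), key.2.trans (ENNReal.ofReal_le_ofReal ?_)⟩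
    · rw [mul_assoc (d * κ), ← hdiv]
      gcongr
    · calc κ * h * ∑ s ∈ hT.cellFinset, volume.real (simplex s) * τ s
          ≤ κ * h * (C₃ * (h / e h)) := by gcongr
        _ ≤ κ * e h * (C₃ * 1) := by
          gcongr
          exact hhe h hh
        _ = κ * C₃ * e h := by ring
  have hsmi : ∀ h ∈ Ioc (0 : ℝ) h₁, IntegrableOn (c.smoothing q (e h)) Ω := fun h hh =>
    InwardCover.integrableOn_of_continuous hΩb
      (c.contDiff_smoothing hΩo hqi (he0 h hh)).continuous
  have hvi : ∀ h ∈ Ioc (0 : ℝ) h₁, IntegrableOn (v h) Ω := fun h hh => by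
    have := (hmem h (hIoo h hh)).1.integrableOn hΩb
    rwa [hqh1 h hh] at this
  have hrate1 : ∀ h ∈ Ioc (0 : ℝ) h₁,
      eLpNorm (fun x => qh h x - q x) 1 (volume.restrict Ω) ≤
        ENNReal.ofReal ((κ * C₃ + C₁) * h * |Real.log h|) := by
    intro h hh
    rw [hqh1 h hh]
    have e1 : (fun x => v h x - q x) = (fun x => v h x - c.smoothing q (e h) x) +
        fun x => c.smoothing q (e h) x - q x := by
      ext x
      simp
    have e2 : eLpNorm (fun x => c.smoothing q (e h) x - q x) 1 (volume.restrict Ω) ≤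
        ENNReal.ofReal (C₁ * e h) := by
      rw [eLpNorm_eq_ofReal_integral (g := fun x => c.smoothing q (e h) x - q x)
        ((hsmi h hh).sub hqi)]
      exact ENNReal.ofReal_le_ofReal (hC₁ _ (he0 h hh) (hgood h hh).2)
    rw [e1]
    refine (eLpNorm_add_le ((hvi h hh).sub (hsmi h hh)).aestronglyMeasurable
      ((hsmi h hh).sub hqi).aestronglyMeasurable le_rfl).trans
      ((add_le_add (herr h hh).2 e2).trans (le_of_eq ?_))
    have h0 := he0 h hh
    rw [← ENNReal.ofReal_add (by positivity) (by positivity)]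
    congr 1
    simp only [he]
    ring
  refine ⟨qh, hmem, fun h₀ hh₀ => ?_, ?_⟩
  · set M := ∫ x in Ω, |qlo - q x| with hM
    have hM0 : 0 ≤ M := integral_nonneg fun x => abs_nonneg _
    have hlog0 : 0 < |Real.log h₀| := abs_pos.2 (Real.log_neg hh₀.1 hh₀.2).ne
    -- For `h₁ < h ≤ h₀` one has `h |log h| ≥ h₁ |log h₀|`, so the third term absorbs the fixed
    -- error `M`; the summand 1 ensures positivity.
    refine ⟨κ * C₃ + C₁ + M / (h₁ * |Real.log h₀|) + 1, by positivity, fun h hh => ?_⟩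
    have hlog : |Real.log h₀| ≤ |Real.log h| := by
      rw [abs_of_neg (Real.log_neg hh₀.1 hh₀.2),
        abs_of_neg (Real.log_neg hh.1 (hh.2.trans_lt hh₀.2))]
      exact neg_le_neg (Real.log_le_log hh.1 hh.2)
    have hh0 := hh.1.le
    rcases le_or_gt h h₁ with hle | hlt
    · refine (hrate1 h ⟨hh.1, hle⟩).trans (ENNReal.ofReal_le_ofReal ?_)
      have : 0 ≤ M / (h₁ * |Real.log h₀|) := by positivity
      exact mul_le_mul_of_nonneg_right (mul_le_mul_of_nonneg_right (by linarith) hh0)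
        (abs_nonneg _)
    · have hci : IntegrableOn (fun _ : Eucl d => qlo) Ω :=
        integrableOn_const hΩb.measure_lt_top.ne
      rw [hqh2 h hlt]
      rw [eLpNorm_eq_ofReal_integral (g := fun x => qlo - q x) (hci.sub hqi)]
      refine ENNReal.ofReal_le_ofReal ?_
      calc M = M / (h₁ * |Real.log h₀|) * h₁ * |Real.log h₀| := by field_simp
        _ ≤ M / (h₁ * |Real.log h₀|) * h * |Real.log h| := by gcongr
        _ ≤ (κ * C₃ + C₁ + M / (h₁ * |Real.log h₀|) + 1) * h * |Real.log h| := by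
          have : 0 ≤ κ * C₃ := by positivity
          exact mul_le_mul_of_nonneg_right (mul_le_mul_of_nonneg_right (by linarith) hh0)
            (abs_nonneg _)
  · refine tendsto_TV_of_le (U := fun h => ENNReal.ofReal ((1 + C₂ * e h) * (TV Ω q).toReal) +
      ENNReal.ofReal (d * κ * C₃ * |Real.log h|⁻¹)) ?_ hqi
      (tendsto_eLpNorm_of_rate ⟨_, h₁, h₁0, hrate1⟩) ?_ ?_
    · filter_upwards [Ioo_mem_nhdsGT (zero_lt_one' ℝ)] with h hh
      exact (hmem h hh).1.integrableOn hΩb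
    · filter_upwards [Ioc_mem_nhdsGT h₁0] with h hh
      rw [hqh1 h hh]
      have e1 : v h = fun x => c.smoothing q (e h) x + (v h x - c.smoothing q (e h) x) := by
        ext x
        ring
      conv_lhs => rw [e1]
      exact (TV_add_le (hsmi h hh) ((hvi h hh).sub (hsmi h hh))).trans
        (add_le_add (hC₂ _ (he0 h hh) (hgood h hh).2) (herr h hh).1)
    · have t1 : Tendsto (fun h => (1 + C₂ * e h) * (TV Ω q).toReal) (𝓝[>] 0)
          (𝓝 ((1 + C₂ * 0) * (TV Ω q).toReal)) :=
        ((tendsto_mul_abs_log.const_mul C₂).const_add 1).mul_const _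
      have t2 : Tendsto (fun h : ℝ => d * κ * C₃ * |Real.log h|⁻¹) (𝓝[>] 0)
          (𝓝 (d * κ * C₃ * 0)) :=
        (tendsto_inv_atTop_zero.comp tendsto_abs_log).const_mul _
      have t3 := (ENNReal.tendsto_ofReal t1).add (ENNReal.tendsto_ofReal t2)
      simpa [ENNReal.ofReal_toReal hTV] using t3

end Families

end TVFEM

namespace TVFEM

/-! ### Convergence of averages in `L^p`. -/

section LpConvergence

variable {d : ℕ} {p : ℝ≥0∞} {g k : Eucl d → ℝ}

lemma tendsto_eLpNorm_translate_sub (hp : 1 ≤ p) (hp' : p ≠ ⊤) (hg : MemLp g p) :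
    Tendsto (fun u => eLpNorm (fun x => g (x - u) - g x) p volume) (𝓝 0) (𝓝 0) := by
  have : Fact (1 ≤ p) := ⟨hp⟩
  have : Fact (p ≠ ⊤) := ⟨hp'⟩
  have hc : Continuous fun u : Eucl d => DomAddAct.mk (-u) +ᵥ hg.toLp g :=
    (DomAddAct.continuous_mk.comp continuous_neg).vadd continuous_const
  have ht := (tendsto_iff_edist_tendsto_0.1 (hc.tendsto 0))
  refine ht.congr fun u => ?_
  rw [neg_zero, DomAddAct.mk_zero, zero_vadd, DomAddAct.mk_vadd_toLp, Lp.edist_toLp_toLp]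
  congr 1
  ext x
  simp [sub_eq_neg_add]

/-- Jensen and Tonelli: the error at `x` is the mean of `g (x - u) - g x` under the probability
measure with density `k`. Jensen enters as monotonicity of `L^p` norms in the exponent; strong
measurability serves the exchange of integrals. -/
lemma eLpNorm_avg_sub_le_of_stronglyMeasurable (hp : 1 ≤ p) (hp' : p ≠ ⊤) (hg : MemLp g p)
    (hgm : StronglyMeasurable g) (hk : Continuous k)
    (hkc : HasCompactSupport k) (hk0 : ∀ u, 0 ≤ k u) (hk1 : ∫ u, k u = 1) {δ : ℝ≥0∞}
    (hδ : ∀ u, k u ≠ 0 → eLpNorm (fun x => g (x - u) - g x) p volume ≤ δ) :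
    eLpNorm (fun x => avg k g x - g x) p volume ≤ δ := by
  have hp0 : p ≠ 0 := (zero_lt_one.trans_le hp).ne'
  have hpr : 0 < p.toReal := ENNReal.toReal_pos hp0 hp'
  set ν : Measure (Eucl d) := volume.withDensity fun u => ENNReal.ofReal (k u) with hν
  have hki : Integrable k := hk.integrable_of_hasCompactSupport hkc
  have hmk : Measurable fun u => ENNReal.ofReal (k u) := by fun_prop
  have : IsProbabilityMeasure ν := by
    constructor
    rw [hν, withDensity_apply _ MeasurableSet.univ, Measure.restrict_univ,
      ← ofReal_integral_eq_lintegral_ofReal hki (ae_of_all _ hk0), hk1, ENNReal.ofReal_one]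
  have hm : StronglyMeasurable fun z : Eucl d × Eucl d => g (z.1 - z.2) - g z.1 :=
    (hgm.comp_measurable (by fun_prop)).sub (hgm.comp_measurable (by fun_prop))
  have hpt : ∀ x, ‖avg k g x - g x‖ₑ ^ p.toReal ≤
      ∫⁻ u, ‖g (x - u) - g x‖ₑ ^ p.toReal ∂ν := by
    intro x
    have hmx : AEStronglyMeasurable (fun u => g (x - u) - g x) ν :=
      ((hgm.comp_measurable (by fun_prop)).sub stronglyMeasurable_const).aestronglyMeasurable
    have hi : Integrable fun u => g (x - u) * k u := by
      have h := (hkc.convolutionExists_right (ContinuousLinearMap.mul ℝ ℝ)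
        (hg.locallyIntegrable hp) hk x)
      have h2 := h.integrable_swap
      simpa using h2
    have e : avg k g x - g x = ∫ u, (g (x - u) - g x) * k u := by
      simp only [sub_mul]
      rw [integral_sub hi (hki.const_mul _), integral_const_mul, hk1, mul_one, avg_eq_swap]
    have h1 : ‖avg k g x - g x‖ₑ ≤ eLpNorm (fun u => g (x - u) - g x) 1 ν := by
      rw [e, eLpNorm_one_eq_lintegral_enorm, hν, lintegral_withDensity_eq_lintegral_mul _ hmk]
      · refine (enorm_integral_le_lintegral_enorm _).trans (le_of_eq ?_)
        refine lintegral_congr fun u => ?_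
        rw [enorm_mul, mul_comm, Real.enorm_of_nonneg (hk0 u)]
        rfl
      · exact ((hgm.comp_measurable (by fun_prop)).sub stronglyMeasurable_const).enorm
    have h2 := h1.trans (eLpNorm_le_eLpNorm_of_exponent_le hp hmx)
    rw [eLpNorm_eq_lintegral_rpow_enorm_toReal hp0 hp'] at h2
    have h3 := ENNReal.rpow_le_rpow h2 hpr.le
    rwa [← ENNReal.rpow_mul, one_div, inv_mul_cancel₀ hpr.ne', ENNReal.rpow_one] at h3
  rw [eLpNorm_eq_lintegral_rpow_enorm_toReal hp0 hp', one_div, ENNReal.rpow_inv_le_iff hpr]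
  calc ∫⁻ x, ‖avg k g x - g x‖ₑ ^ p.toReal
      ≤ ∫⁻ x, ∫⁻ u, ‖g (x - u) - g x‖ₑ ^ p.toReal ∂ν := lintegral_mono hpt
    _ = ∫⁻ u, ∫⁻ x, ‖g (x - u) - g x‖ₑ ^ p.toReal ∂volume ∂ν :=
        lintegral_lintegral_swap (hm.enorm.pow_const _).aemeasurable
    _ ≤ ∫⁻ _, δ ^ p.toReal ∂ν := by
        refine lintegral_mono_ae ?_
        rw [hν, ae_withDensity_iff hmk]
        refine ae_of_all _ fun u hu => ?_
        have h1 := hδ u fun h => hu (by simp [h])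
        rwa [eLpNorm_eq_lintegral_rpow_enorm_toReal hp0 hp', one_div,
          ENNReal.rpow_inv_le_iff hpr] at h1
    _ = δ ^ p.toReal := by simp

lemma avg_congr_ae {f : Eucl d → ℝ} (h : f =ᵐ[volume] g) : avg k f = avg k g := by
  ext x
  exact integral_congr_ae (h.mono fun t ht => by simp only [ht])

lemma eLpNorm_avg_sub_le (hp : 1 ≤ p) (hp' : p ≠ ⊤) (hg : MemLp g p) (hk : Continuous k)
    (hkc : HasCompactSupport k) (hk0 : ∀ u, 0 ≤ k u) (hk1 : ∫ u, k u = 1) {δ : ℝ≥0∞}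
    (hδ : ∀ u, k u ≠ 0 → eLpNorm (fun x => g (x - u) - g x) p volume ≤ δ) :
    eLpNorm (fun x => avg k g x - g x) p volume ≤ δ := by
  have hae := hg.1.ae_eq_mk
  have h1 := eLpNorm_avg_sub_le_of_stronglyMeasurable hp hp' ((memLp_congr_ae hae).1 hg)
    hg.1.stronglyMeasurable_mk hk hkc hk0 hk1 (δ := δ) fun u hu => by
      refine (eLpNorm_congr_ae ?_).trans_le (hδ u hu)
      have h2 := (measurePreserving_sub_right (volume : Measure (Eucl d))
        u).quasiMeasurePreserving.ae_eq_comp hae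
      filter_upwards [hae, h2] with x h3 h4
      simp only [Function.comp_apply] at h4
      rw [h3, h4]
  refine (eLpNorm_congr_ae ?_).trans_le h1
  filter_upwards [hae] with x hx
  rw [avg_congr_ae hae, hx]

lemma tendsto_eLpNorm_avg_kernel_sub (hp : 1 ≤ p) (hp' : p ≠ ⊤) (hg : MemLp g p) (w : Eucl d) :
    Tendsto (fun ε => eLpNorm (fun x => avg (kernel w ε) g x - g x) p volume) (𝓝[>] 0) (𝓝 0) := by
  rw [ENNReal.tendsto_nhds_zero]
  intro δ hδ
  have h1 := ENNReal.tendsto_nhds_zero.1 (tendsto_eLpNorm_translate_sub hp hp' hg) δ hδ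
  obtain ⟨r, hr, hball⟩ := Metric.eventually_nhds_iff.1 h1
  have hw : 0 < ‖w‖ + 1 := by positivity
  filter_upwards [Ioo_mem_nhdsGT (div_pos hr hw)] with ε hε
  refine eLpNorm_avg_sub_le hp hp' hg contDiff_kernel.continuous (hasCompactSupport_kernel hε.1)
    (kernel_nonneg hε.1) (integral_kernel hε.1) fun u hu => hball ?_
  rw [dist_zero_right]
  exact (norm_le_of_kernel_ne_zero hε.1 hu).trans_lt ((lt_div_iff₀ hw).1 hε.2)

end LpConvergence

end TVFEM

namespace TVFEM

/-! ### Convergence of the gradients of the smoothings for Sobolev functions. -/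

namespace InwardCover

variable {d : ℕ} {Ω : Set (Eucl d)} {ι : Type} [Fintype ι] (c : InwardCover Ω ι)
  {q g : Eucl d → ℝ} {ε : ℝ} {p : ℝ≥0∞} {i : Fin d}

/-- The function `y ↦ k (x - y)` is an admissible test function for the weak derivative, because the
inward shift places its support in `Ω`. -/
lemma fderiv_avg_kernel_of_weak (hΩ : IsOpen Ω) (hq : IntegrableOn q Ω)
    (hg : IsWeakPartialDeriv Ω i q g) (hε : 0 < ε) (hε' : ε ≤ c.ε₀) {j : ι} {x : Eucl d}
    (hx : x ∈ closure Ω) (hxj : x ∈ tsupport (c.ψ j)) :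
    fderiv ℝ (avg (kernel (c.w j) ε) (Ω.indicator q)) x (EuclideanSpace.single i 1) =
      avg (kernel (c.w j) ε) (Ω.indicator g) x := by
  set k := kernel (c.w j) ε with hk
  have hks : ContDiff ℝ ∞ k := contDiff_kernel
  have hφs : ContDiff ℝ ∞ fun y => k (x - y) := hks.comp (contDiff_const.sub contDiff_id)
  have hφc : HasCompactSupport fun y => k (x - y) :=
    (hasCompactSupport_kernel hε).comp_homeomorph (Homeomorph.subLeft x)
  have hφt : tsupport (fun y => k (x - y)) ⊆ Ω := by
    intro y hy
    have h1 : tsupport (fun y => k (x - y)) ⊆ (fun y => x - y) ⁻¹' tsupport k :=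
      tsupport_comp_subset_preimage k (f := fun y => x - y) (by fun_prop)
    obtain ⟨z, hz, hzy⟩ := exists_of_mem_tsupport_kernel hε (h1 hy)
    have hzy : x - y = -(ε • z) := hzy
    have : y = x + ε • z := by
      have h2 : y = x - (x - y) := by abel
      rw [h2, hzy, sub_neg_eq_add]
    rw [this]
    exact c.add_mem hx hxj hε hε' hz
  have hd : ∀ y v, fderiv ℝ (fun y => k (x - y)) y v = - fderiv ℝ k (x - y) v := by
    intro y v
    have h1 : HasFDerivAt (fun y => k (x - y))
        ((fderiv ℝ k (x - y)).comp (-ContinuousLinearMap.id ℝ (Eucl d))) y :=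
      (hks.differentiable (by simp) (x - y)).hasFDerivAt.comp y
        ((hasFDerivAt_id y).const_sub x)
    rw [h1.fderiv]
    simp
  have h := hg _ hφs hφc hφt
  simp only [hd, mul_neg, integral_neg, neg_inj] at h
  rw [fderiv_avg (locallyIntegrable hΩ hq) (hks.of_le (by simp)) (hasCompactSupport_kernel hε)]
  simp only [avg]
  rw [← integral_indicator hΩ.measurableSet, ← integral_indicator hΩ.measurableSet] at h
  simpa only [indicator_mul_left] using h

/-- Product rule, with `Σ ψ_j = 1` and `Σ ∇ψ_j = 0` used to subtract `g` and `q`: only errors of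
averages remain. -/
lemma fderiv_smoothing_sub (hΩ : IsOpen Ω) (hq : IntegrableOn q Ω)
    (hg : IsWeakPartialDeriv Ω i q g) (hε : 0 < ε) (hε' : ε ≤ c.ε₀) {x : Eucl d} (hx : x ∈ Ω) :
    fderiv ℝ (c.smoothing q ε) x (EuclideanSpace.single i 1) - g x =
      ∑ j, (c.ψ j x * (avg (kernel (c.w j) ε) (Ω.indicator g) x - Ω.indicator g x) +
        fderiv ℝ (c.ψ j) x (EuclideanSpace.single i 1) *
          (avg (kernel (c.w j) ε) (Ω.indicator q) x - Ω.indicator q x)) := by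
  have h1 := c.sum_eq_one x (subset_closure hx)
  have h2 := c.sum_fderiv_eq_zero hΩ hx (EuclideanSpace.single i (1 : ℝ))
  have e : ∑ j, (c.ψ j x * (avg (kernel (c.w j) ε) (Ω.indicator g) x - Ω.indicator g x) +
        fderiv ℝ (c.ψ j) x (EuclideanSpace.single i 1) *
          (avg (kernel (c.w j) ε) (Ω.indicator q) x - Ω.indicator q x)) =
      ∑ j, (c.ψ j x * avg (kernel (c.w j) ε) (Ω.indicator g) x +
        fderiv ℝ (c.ψ j) x (EuclideanSpace.single i 1) *
          avg (kernel (c.w j) ε) (Ω.indicator q) x) -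
      ((∑ j, c.ψ j x) * Ω.indicator g x +
        (∑ j, fderiv ℝ (c.ψ j) x (EuclideanSpace.single i 1)) * Ω.indicator q x) := by
    rw [Finset.sum_mul, Finset.sum_mul, ← Finset.sum_add_distrib, ← Finset.sum_sub_distrib]
    exact Finset.sum_congr rfl fun j _ => by ring
  rw [e, h1, h2, indicator_of_mem hx, one_mul, zero_mul, add_zero,
    (c.hasFDerivAt_smoothing hΩ hq hε x).fderiv, sum_apply]
  congr 1
  refine Finset.sum_congr rfl fun j _ => ?_
  simp only [add_apply, smul_apply, smul_eq_mul]
  rw [mul_comm (fderiv ℝ (c.ψ j) x _)]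
  congr 1
  by_cases hj : x ∈ tsupport (c.ψ j)
  · rw [c.fderiv_avg_kernel_of_weak hΩ hq hg hε hε' (subset_closure hx) hj]
  · rw [image_eq_zero_of_notMem_tsupport hj, zero_mul, zero_mul]

lemma tendsto_eLpNorm_fderiv_smoothing_sub (hΩ : IsOpen Ω) (hΩb : Bornology.IsBounded Ω)
    (hp : 1 ≤ p) (hp' : p ≠ ⊤) (hq : MemLp q p (volume.restrict Ω))
    (hgp : MemLp g p (volume.restrict Ω)) (hg : IsWeakPartialDeriv Ω i q g) :
    Tendsto (fun ε => eLpNorm (fun x =>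
      fderiv ℝ (c.smoothing q ε) x (EuclideanSpace.single i 1) - g x) p (volume.restrict Ω))
      (𝓝[>] 0) (𝓝 0) := by
  have : IsFiniteMeasure (volume.restrict Ω) := isFiniteMeasure_restrict.2 hΩb.measure_lt_top.ne
  have hqi : IntegrableOn q Ω := hq.integrable hp
  have hgi : IntegrableOn g Ω := hgp.integrable hp
  have hq' : MemLp (Ω.indicator q) p := (memLp_indicator_iff_restrict hΩ.measurableSet).2 hq
  have hg' : MemLp (Ω.indicator g) p := (memLp_indicator_iff_restrict hΩ.measurableSet).2 hgp
  obtain ⟨D, hD0, hD⟩ := c.exists_gradient_bound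
  set A : (Eucl d → ℝ) → ι → ℝ → Eucl d → ℝ := fun f j ε x =>
    avg (kernel (c.w j) ε) (Ω.indicator f) x - Ω.indicator f x with hA
  have hlim : Tendsto (fun ε => ∑ j, (eLpNorm (A g j ε) p volume +
      ENNReal.ofReal D * eLpNorm (A q j ε) p volume)) (𝓝[>] 0) (𝓝 0) := by
    have h := tendsto_finsetSum (Finset.univ : Finset ι) fun j _ =>
      (tendsto_eLpNorm_avg_kernel_sub hp hp' hg' (c.w j)).add
        (ENNReal.Tendsto.const_mul (tendsto_eLpNorm_avg_kernel_sub hp hp' hq' (c.w j))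
          (Or.inr (ENNReal.ofReal_ne_top (r := D))))
    simpa using h
  refine tendsto_of_tendsto_of_tendsto_of_le_of_le' tendsto_const_nhds hlim
    (Eventually.of_forall fun _ => zero_le) ?_
  filter_upwards [Ioc_mem_nhdsGT c.pos] with ε hε
  have hmA : ∀ f : Eucl d → ℝ, IntegrableOn f Ω → MemLp (Ω.indicator f) p → ∀ j,
      AEStronglyMeasurable (A f j ε) (volume : Measure (Eucl d)) := fun f hf hf' j =>
    (contDiff_avg_kernel hΩ hf hε.1 _).continuous.aestronglyMeasurable.sub hf'.1
  calc eLpNorm (fun x => fderiv ℝ (c.smoothing q ε) x (EuclideanSpace.single i 1) - g x) p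
        (volume.restrict Ω)
      ≤ eLpNorm (∑ j, ((fun x => ‖A g j ε x‖) + D • fun x => ‖A q j ε x‖)) p
        (volume.restrict Ω) := by
        refine eLpNorm_mono_ae_real ?_
        filter_upwards [ae_restrict_mem hΩ.measurableSet] with x hx
        rw [c.fderiv_smoothing_sub hΩ hqi hg hε.1 hε.2 hx, Finset.sum_apply]
        refine (norm_sum_le _ _).trans (Finset.sum_le_sum fun j _ => ?_)
        refine (norm_add_le _ _).trans ?_
        rw [norm_mul, norm_mul]
        refine add_le_add (mul_le_of_le_one_left (norm_nonneg _) ?_)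
          (mul_le_mul_of_nonneg_right ?_ (norm_nonneg _))
        · rw [Real.norm_of_nonneg (c.nonneg j x)]
          exact (Finset.single_le_sum (fun j _ => c.nonneg j x) (Finset.mem_univ j)).trans
            (c.sum_le_one x)
        · refine ((fderiv ℝ (c.ψ j) x).le_opNorm _).trans ?_
          simpa using hD j x
    _ ≤ eLpNorm (∑ j, ((fun x => ‖A g j ε x‖) + D • fun x => ‖A q j ε x‖)) p volume :=
        eLpNorm_restrict_le _ _ _ _
    _ ≤ ∑ j, eLpNorm ((fun x => ‖A g j ε x‖) + D • fun x => ‖A q j ε x‖) p volume :=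
        eLpNorm_sum_le (fun j _ => (hmA g hgi hg' j).norm.add
          ((hmA q hqi hq' j).norm.const_smul D)) hp
    _ ≤ ∑ j, (eLpNorm (A g j ε) p volume + ENNReal.ofReal D * eLpNorm (A q j ε) p volume) := by
        refine Finset.sum_le_sum fun j _ => ?_
        refine (eLpNorm_add_le (hmA g hgi hg' j).norm
          ((hmA q hqi hq' j).norm.const_smul D) hp).trans ?_
        rw [eLpNorm_const_smul, eLpNorm_norm, eLpNorm_norm, Real.enorm_of_nonneg hD0]

/-- Both gradients are `L^p` close to the same weak gradient. The Cauchy form involves only smooth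
functions, to which Morrey's inequality applies. -/
lemma exists_eLpNorm_fderiv_smoothing_sub_le (hΩ : IsOpen Ω) (hΩb : Bornology.IsBounded Ω)
    (hp : 1 ≤ p) (hp' : p ≠ ⊤) (hq : MemW1p Ω p q) {η : ℝ≥0∞} (hη : 0 < η) :
    ∃ ε₁ ∈ Ioc 0 c.ε₀, ∀ ε ∈ Ioc 0 ε₁, ∀ ε' ∈ Ioc 0 ε₁,
      eLpNorm (fun x => ‖fderiv ℝ (fun y => c.smoothing q ε y - c.smoothing q ε' y) x‖) p
        (volume.restrict Ω) ≤ η := by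
  have : IsFiniteMeasure (volume.restrict Ω) := isFiniteMeasure_restrict.2 hΩb.measure_lt_top.ne
  have hqi : IntegrableOn q Ω := hq.1.integrable hp
  choose g hgp hg using hq.2
  have hlim : Tendsto (fun ε => ∑ i, eLpNorm (fun x =>
      fderiv ℝ (c.smoothing q ε) x (EuclideanSpace.single i 1) - g i x) p (volume.restrict Ω))
      (𝓝[>] 0) (𝓝 0) := by
    have h := tendsto_finsetSum (Finset.univ : Finset (Fin d)) fun i _ =>
      c.tendsto_eLpNorm_fderiv_smoothing_sub hΩ hΩb hp hp' hq.1 (hgp i) (hg i)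
    simpa using h
  have hη2 : 0 < η / 2 := ENNReal.half_pos hη.ne'
  have hev := (ENNReal.tendsto_nhds_zero.1 hlim (η / 2) hη2).and (Ioc_mem_nhdsGT c.pos)
  obtain ⟨ε₁, hε₁, hsub⟩ := (mem_nhdsGT_iff_exists_Ioc_subset (a := (0 : ℝ))).1 hev
  refine ⟨ε₁, ⟨hε₁, (hsub ⟨hε₁, le_rfl⟩).2.2⟩, fun ε hε ε' hε' => ?_⟩
  have hcd : ∀ ε : ℝ, 0 < ε → ContDiff ℝ ∞ (c.smoothing q ε) := fun ε hε =>
    c.contDiff_smoothing hΩ hqi hε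
  set P : ℝ → Fin d → Eucl d → ℝ := fun ε i x =>
    fderiv ℝ (c.smoothing q ε) x (EuclideanSpace.single i 1) - g i x with hP
  have hmP : ∀ ε : ℝ, 0 < ε → ∀ i, AEStronglyMeasurable (P ε i) (volume.restrict Ω) :=
    fun ε hε i => (((hcd ε hε).continuous_fderiv (by simp)).clm_apply
      continuous_const).aestronglyMeasurable.sub (hgp i).1
  calc eLpNorm (fun x => ‖fderiv ℝ (fun y => c.smoothing q ε y - c.smoothing q ε' y) x‖) p
        (volume.restrict Ω)
      ≤ eLpNorm (∑ i, ((fun x => ‖P ε i x‖) + fun x => ‖P ε' i x‖)) p (volume.restrict Ω) := by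
        refine eLpNorm_mono_real fun x => ?_
        rw [norm_norm, Finset.sum_apply]
        refine (opNorm_le_sum_single _).trans (Finset.sum_le_sum fun i _ => ?_)
        rw [fderiv_fun_sub ((hcd ε hε.1).differentiable (by simp) x)
          ((hcd ε' hε'.1).differentiable (by simp) x)]
        refine le_trans (le_of_eq ?_) (norm_sub_le (P ε i x) (P ε' i x))
        simp [hP, Real.norm_eq_abs]
    _ ≤ ∑ i, eLpNorm ((fun x => ‖P ε i x‖) + fun x => ‖P ε' i x‖) p (volume.restrict Ω) :=
        eLpNorm_sum_le (fun i _ => (hmP ε hε.1 i).norm.add (hmP ε' hε'.1 i).norm) hp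
    _ ≤ ∑ i, (eLpNorm (P ε i) p (volume.restrict Ω) + eLpNorm (P ε' i) p (volume.restrict Ω)) := by
        refine Finset.sum_le_sum fun i _ => ?_
        refine (eLpNorm_add_le (hmP ε hε.1 i).norm (hmP ε' hε'.1 i).norm hp).trans ?_
        rw [eLpNorm_norm, eLpNorm_norm]
    _ ≤ η := by
        rw [Finset.sum_add_distrib]
        exact (add_le_add (hsub hε).1 (hsub hε').1).trans_eq (ENNReal.add_halves η)

end InwardCover

end TVFEM

namespace TVFEM

/-! ### Morrey's inequality on cells, summed over a triangulation. -/

section Morrey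

variable {d : ℕ}

lemma lintegral_comp_homothety (H : Eucl d → ℝ≥0∞) (x : Eucl d) {t : ℝ}
    (ht : 0 < t) : ∫⁻ y, H (x + t • (y - x)) = ENNReal.ofReal (t ^ d)⁻¹ * ∫⁻ y, H y := by
  have h1 : ∫⁻ y, H (x + t • (y - x)) = ∫⁻ u, H (x + t • u) :=
    lintegral_sub_right_eq_self (fun u => H (x + t • u)) x
  have h2 : ∫⁻ u, H (x + t • u) = ∫⁻ v, H (x + v) ∂(Measure.map (t • ·) volume) :=
    (lintegral_map_equiv (fun v => H (x + v))
      (Homeomorph.smulOfNeZero t ht.ne').toMeasurableEquiv).symm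
  rw [h1, h2, Measure.map_addHaar_smul _ ht.ne', lintegral_smul_measure,
    lintegral_add_left_eq_self]
  simp [abs_of_pos (pow_pos ht d)]

/-- The homothety about `x` maps the convex set into itself and has Jacobian `t^d`. -/
lemma setLIntegral_comp_homothety_le (G : Eucl d → ℝ≥0∞) {T : Set (Eucl d)}
    (hT : Convex ℝ T) (hTm : MeasurableSet T) {x : Eucl d} (hx : x ∈ T) {t : ℝ}
    (ht : t ∈ Ioc (0 : ℝ) 1) :
    ∫⁻ y in T, G (x + t • (y - x)) ≤ ENNReal.ofReal (t ^ d)⁻¹ * ∫⁻ y in T, G y := by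
  rw [← lintegral_indicator hTm, ← lintegral_indicator hTm,
    ← lintegral_comp_homothety (T.indicator G) x ht.1]
  refine lintegral_mono fun y => ?_
  by_cases hy : y ∈ T
  · have : x + t • (y - x) ∈ T := hT.add_smul_sub_mem hx hy ⟨ht.1.le, ht.2⟩
    rw [indicator_of_mem hy, indicator_of_mem this]
  · simp [hy]

/-- Takes the place of Hölder's inequality: the right-hand side is linear in `a ^ p`, so the
estimate can be summed over cells. -/
lemma le_add_rpow_mul {a l p : ℝ} (ha : 0 ≤ a) (hl : 0 < l) (hp : 1 ≤ p) :
    a ≤ l + l ^ (1 - p) * a ^ p := by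
  rcases le_or_gt a l with h | h
  · have : 0 ≤ l ^ (1 - p) * a ^ p := by positivity
    linarith
  · have ha' : 0 < a := hl.trans h
    have h1 : a ^ (1 - p) ≤ l ^ (1 - p) := Real.rpow_le_rpow_of_nonpos hl h.le (by linarith)
    calc a = a ^ (1 - p) * a ^ p := by
          rw [← Real.rpow_add ha', sub_add_cancel, Real.rpow_one]
      _ ≤ l ^ (1 - p) * a ^ p := by gcongr
      _ ≤ _ := by linarith

lemma lintegral_rpow_neg_ne_top {α : ℝ} (hα : α < 1) :
    ∫⁻ t in Ioc (0 : ℝ) 1, ENNReal.ofReal (t ^ (-α)) ≠ ⊤ := by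
  have h := (intervalIntegral.intervalIntegrable_rpow' (a := 0) (b := 1)
    (r := -α) (by linarith)).1
  exact h.lintegral_lt_top.ne

lemma enorm_sub_le_lintegral_fderiv {w : Eucl d → ℝ} (hw : ContDiff ℝ 1 w) {h : ℝ}
    {x y : Eucl d} (hxy : ‖y - x‖ ≤ h) :
    ‖w y - w x‖ₑ ≤ ∫⁻ t in Ioc (0 : ℝ) 1,
      ENNReal.ofReal h * ENNReal.ofReal ‖fderiv ℝ w (x + t • (y - x))‖ := by
  have hd : ∀ t : ℝ, HasDerivAt (fun t : ℝ => w (x + t • (y - x)))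
      (fderiv ℝ w (x + t • (y - x)) (y - x)) t := by
    intro t
    have h1 : HasDerivAt (fun t : ℝ => x + t • (y - x)) (y - x) t := by
      simpa using ((hasDerivAt_id t).smul_const (y - x)).const_add x
    exact (hw.differentiable one_ne_zero _).hasFDerivAt.comp_hasDerivAt t h1
  have hc : Continuous fun t : ℝ => fderiv ℝ w (x + t • (y - x)) (y - x) :=
    ((hw.continuous_fderiv one_ne_zero).comp (by fun_prop)).clm_apply continuous_const
  have h2 := intervalIntegral.integral_eq_sub_of_hasDerivAt (fun t _ => hd t)
    (hc.intervalIntegrable 0 1)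
  simp only [one_smul, zero_smul, add_zero, add_sub_cancel] at h2
  rw [← h2, intervalIntegral.integral_of_le zero_le_one]
  refine (enorm_integral_le_lintegral_enorm _).trans (lintegral_mono fun t => ?_)
  have h0 : 0 ≤ h := (norm_nonneg _).trans hxy
  rw [← ofReal_norm, ← ENNReal.ofReal_mul h0, mul_comm h]
  refine ENNReal.ofReal_le_ofReal ((ContinuousLinearMap.le_opNorm _ _).trans ?_)
  gcongr

/-- Morrey's inequality on a convex set. -/
lemma lintegral_enorm_sub_le {w : Eucl d → ℝ} (hw : ContDiff ℝ 1 w) {T : Set (Eucl d)}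
    (hT : Convex ℝ T) (hTm : MeasurableSet T) {h p η : ℝ}
    (hdiam : ∀ x ∈ T, ∀ y ∈ T, ‖y - x‖ ≤ h) (hp : 1 ≤ p) (hη : 0 < η) {x : Eucl d}
    (hx : x ∈ T) :
    ∫⁻ y in T, ‖w y - w x‖ₑ ≤ ENNReal.ofReal h *
      ((∫⁻ t in Ioc (0 : ℝ) 1, ENNReal.ofReal (t ^ (-(d / p)))) *
        (ENNReal.ofReal η * volume T + ENNReal.ofReal (η ^ (1 - p)) *
          ∫⁻ y in T, ENNReal.ofReal (‖fderiv ℝ w y‖ ^ p))) := by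
  have hgc : Continuous fun y => ‖fderiv ℝ w y‖ := (hw.continuous_fderiv one_ne_zero).norm
  set Φ := ∫⁻ y in T, ENNReal.ofReal (‖fderiv ℝ w y‖ ^ p) with hΦ
  have hp0 : p ≠ 0 := by linarith
  calc ∫⁻ y in T, ‖w y - w x‖ₑ
      ≤ ∫⁻ y in T, ∫⁻ t in Ioc (0 : ℝ) 1,
          ENNReal.ofReal h * ENNReal.ofReal ‖fderiv ℝ w (x + t • (y - x))‖ :=
        setLIntegral_mono' hTm fun y hy => enorm_sub_le_lintegral_fderiv hw (hdiam x hx y hy)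
    _ = ∫⁻ t in Ioc (0 : ℝ) 1, ∫⁻ y in T,
          ENNReal.ofReal h * ENNReal.ofReal ‖fderiv ℝ w (x + t • (y - x))‖ := by
        refine lintegral_lintegral_swap (Measurable.aemeasurable ?_)
        refine (Continuous.measurable ?_).ennreal_ofReal.const_mul _
        exact hgc.comp (by fun_prop)
    _ ≤ ∫⁻ t in Ioc (0 : ℝ) 1, ENNReal.ofReal (t ^ (-(d / p))) * (ENNReal.ofReal h *
          (ENNReal.ofReal η * volume T + ENNReal.ofReal (η ^ (1 - p)) * Φ)) := by
        refine setLIntegral_mono' measurableSet_Ioc fun t ht => ?_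
        rw [lintegral_const_mul' _ _ ENNReal.ofReal_ne_top, mul_left_comm]
        gcongr
        -- The level `l = η t^{-d/p}` balances the two terms: after the factor `t^{-d}` from the
        -- homothety both carry the weight `t^{-d/p}`, which is integrable on `(0, 1]` when `d < p`.
        have hl : 0 < η * t ^ (-(d / p)) := mul_pos hη (Real.rpow_pos_of_pos ht.1 _)
        have hexp : (η * t ^ (-(d / p))) ^ (1 - p) * (t ^ d)⁻¹ =
            t ^ (-(d / p)) * η ^ (1 - p) := by
          rw [Real.mul_rpow hη.le (Real.rpow_nonneg ht.1.le _), ← Real.rpow_mul ht.1.le,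
            ← Real.rpow_natCast, ← Real.rpow_neg ht.1.le, mul_assoc, ← Real.rpow_add ht.1,
            mul_comm]
          congr 2
          field_simp
          ring
        calc ∫⁻ y in T, ENNReal.ofReal ‖fderiv ℝ w (x + t • (y - x))‖
            ≤ ∫⁻ y in T, (ENNReal.ofReal (η * t ^ (-(d / p))) +
                ENNReal.ofReal ((η * t ^ (-(d / p))) ^ (1 - p)) *
                  ENNReal.ofReal (‖fderiv ℝ w (x + t • (y - x))‖ ^ p)) := by
              refine lintegral_mono fun y => ?_
              rw [← ENNReal.ofReal_mul (by positivity), ← ENNReal.ofReal_add hl.le (by positivity)]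
              exact ENNReal.ofReal_le_ofReal (le_add_rpow_mul (norm_nonneg _) hl hp)
          _ = ENNReal.ofReal (η * t ^ (-(d / p))) * volume T +
                ENNReal.ofReal ((η * t ^ (-(d / p))) ^ (1 - p)) *
                  ∫⁻ y in T, ENNReal.ofReal (‖fderiv ℝ w (x + t • (y - x))‖ ^ p) := by
              rw [lintegral_add_left measurable_const, setLIntegral_const,
                lintegral_const_mul' _ _ ENNReal.ofReal_ne_top]
          _ ≤ ENNReal.ofReal (η * t ^ (-(d / p))) * volume T +
                ENNReal.ofReal ((η * t ^ (-(d / p))) ^ (1 - p)) *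
                  (ENNReal.ofReal (t ^ d)⁻¹ * Φ) := by
              gcongr
              exact setLIntegral_comp_homothety_le
                (fun y => ENNReal.ofReal (‖fderiv ℝ w y‖ ^ p)) hT hTm hx ht
          _ = ENNReal.ofReal (t ^ (-(d / p))) *
                (ENNReal.ofReal η * volume T + ENNReal.ofReal (η ^ (1 - p)) * Φ) := by
              rw [← mul_assoc, ← ENNReal.ofReal_mul (by positivity), hexp,
                ENNReal.ofReal_mul hη.le, ENNReal.ofReal_mul (Real.rpow_nonneg ht.1.le _)]
              ring
    _ = _ := by
        rw [lintegral_mul_const _ (by fun_prop)]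
        ring

/-- Integrate `|w x - w y| ≤ |w z - w x| + |w z - w y|` over `z ∈ T`. Here `d < p` makes the weight
integrable, so all quantities are finite. -/
lemma abs_sub_mul_measure_le {w : Eucl d → ℝ} (hw : ContDiff ℝ 1 w) {T : Set (Eucl d)}
    (hT : Convex ℝ T) (hTm : MeasurableSet T) (hTt : volume T ≠ ⊤) {h p η : ℝ} (hh : 0 ≤ h)
    (hdiam : ∀ x ∈ T, ∀ y ∈ T, ‖y - x‖ ≤ h) (hp : 1 ≤ p) (hdp : d < p) (hη : 0 < η)
    (hΦ : ∫⁻ y in T, ENNReal.ofReal (‖fderiv ℝ w y‖ ^ p) ≠ ⊤) {x y : Eucl d}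
    (hx : x ∈ T) (hy : y ∈ T) :
    |w x - w y| * volume.real T ≤ 2 * (h *
      ((∫⁻ t in Ioc (0 : ℝ) 1, ENNReal.ofReal (t ^ (-(d / p)))).toReal *
        (η * volume.real T + η ^ (1 - p) *
          (∫⁻ y in T, ENNReal.ofReal (‖fderiv ℝ w y‖ ^ p)).toReal))) := by
  have hA : ∫⁻ t in Ioc (0 : ℝ) 1, ENNReal.ofReal (t ^ (-(d / p))) ≠ ⊤ :=
    lintegral_rpow_neg_ne_top ((div_lt_one (by linarith)).2 hdp)
  set R := ENNReal.ofReal h *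
      ((∫⁻ t in Ioc (0 : ℝ) 1, ENNReal.ofReal (t ^ (-(d / p)))) *
        (ENNReal.ofReal η * volume T + ENNReal.ofReal (η ^ (1 - p)) *
          ∫⁻ y in T, ENNReal.ofReal (‖fderiv ℝ w y‖ ^ p))) with hR
  have hRt : R ≠ ⊤ := by finiteness
  have h1 : ‖w x - w y‖ₑ * volume T ≤ 2 * R := by
    calc ‖w x - w y‖ₑ * volume T = ∫⁻ _ in T, ‖w x - w y‖ₑ := by rw [setLIntegral_const]
      _ ≤ ∫⁻ z in T, (‖w z - w x‖ₑ + ‖w z - w y‖ₑ) := by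
          refine lintegral_mono fun z => ?_
          have : w x - w y = (w z - w y) - (w z - w x) := by ring
          rw [this, add_comm]
          exact enorm_sub_le
      _ = (∫⁻ z in T, ‖w z - w x‖ₑ) + ∫⁻ z in T, ‖w z - w y‖ₑ :=
          lintegral_add_left (hw.continuous.sub continuous_const).measurable.enorm _
      _ ≤ R + R := add_le_add (lintegral_enorm_sub_le hw hT hTm hdiam hp hη hx)
          (lintegral_enorm_sub_le hw hT hTm hdiam hp hη hy)
      _ = 2 * R := (two_mul R).symm
  have h2 := ENNReal.toReal_mono (by finiteness) h1
  rw [ENNReal.toReal_mul, ENNReal.toReal_mul, hR, ENNReal.toReal_mul, ENNReal.toReal_mul,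
    ENNReal.toReal_add (by finiteness) (by finiteness), ENNReal.toReal_mul, ENNReal.toReal_mul,
    ENNReal.toReal_ofReal hh, ENNReal.toReal_ofReal hη.le,
    ENNReal.toReal_ofReal (Real.rpow_nonneg hη.le _), toReal_enorm] at h2
  exact h2

/-- Morrey's estimate with the same parameter `η` on all cells: the volumes add up to at most that
of the closure, the integrals of `|∇w|^p` to at most `η^p`, and `η^{1-p} η^p = η`. The shape of the
cells does not enter `C`. -/
lemma IsPolygonalDomain.exists_sum_osc_le {Ω : Set (Eucl d)} (hΩ : IsPolygonalDomain Ω) {p : ℝ}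
    (hp : 1 ≤ p) (hdp : d < p) :
    ∃ C : ℝ, 0 ≤ C ∧ ∀ (K : Geometry.SimplicialComplex ℝ (Eucl d)) (hT : IsTriangulation Ω K)
      (h η : ℝ) (w : Eucl d → ℝ), 0 ≤ h → (∀ s ∈ cells K, Metric.diam (simplex s) ≤ h) →
      (∀ s ∈ cells K, 0 < volume.real (simplex s)) → ContDiff ℝ 1 w → 0 < η →
      eLpNorm (fun x => ‖fderiv ℝ w x‖) (ENNReal.ofReal p) (volume.restrict Ω) ≤
        ENNReal.ofReal η → ∃ b : Finset (Eucl d) → ℝ, (∀ s, 0 ≤ b s) ∧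
      (∀ s ∈ cells K, ∀ x ∈ simplex s, ∀ y ∈ simplex s, |w x - w y| ≤ b s) ∧
      ∑ s ∈ hT.cellFinset, volume.real (simplex s) * b s ≤ C * h * η := by
  set A := (∫⁻ t in Ioc (0 : ℝ) 1, ENNReal.ofReal (t ^ (-(d / p)))).toReal with hA
  have hA0 : 0 ≤ A := ENNReal.toReal_nonneg
  refine ⟨2 * A * (volume.real (closure Ω) + 1), by positivity,
    fun K hT h η w hh hdiam hvol hw hη hle => ?_⟩
  have hp0 : 0 < p := by linarith
  set Φ : Set (Eucl d) → ℝ≥0∞ := fun T => ∫⁻ y in T, ENNReal.ofReal (‖fderiv ℝ w y‖ ^ p) with hΦ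
  have hΦΩ : Φ (closure Ω) ≤ ENNReal.ofReal (η ^ p) := by
    simp only [hΦ]
    rw [hΩ.setLIntegral_closure]
    rw [eLpNorm_eq_lintegral_rpow_enorm_toReal (by simpa using hp0) ENNReal.ofReal_ne_top,
      one_div, ENNReal.rpow_inv_le_iff (by rwa [ENNReal.toReal_ofReal hp0.le]),
      ENNReal.toReal_ofReal hp0.le,
      ENNReal.ofReal_rpow_of_pos hη] at hle
    refine le_trans (le_of_eq (lintegral_congr fun y => ?_)) hle
    rw [Real.enorm_of_nonneg (norm_nonneg _), ENNReal.ofReal_rpow_of_nonneg (norm_nonneg _) hp0.le]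
  have hΦs : ∀ s ∈ hT.cellFinset, Φ (simplex s) ≠ ⊤ := fun s hs =>
    ((lintegral_mono_set (hT.simplex_subset (hT.mem_cellFinset.1 hs))).trans_lt
      (hΦΩ.trans_lt ENNReal.ofReal_lt_top)).ne
  have hsum : ∑ s ∈ hT.cellFinset, (Φ (simplex s)).toReal ≤ η ^ p := by
    rw [← ENNReal.toReal_sum hΦs]
    simp only [hΦ]
    rw [hT.sum_setLIntegral_eq]
    exact ENNReal.toReal_le_of_le_ofReal (by positivity) hΦΩ
  have hvolsum := IsTriangulation.sum_measureReal_le_of_cells hT.cellFinset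
    (fun s hs => hT.mem_cellFinset.1 hs) hΩ.isBounded.isCompact_closure.measure_lt_top.ne
    fun s hs => hT.simplex_subset (hT.mem_cellFinset.1 hs)
  have hηp : 0 ≤ η ^ (1 - p) := by positivity
  set B : Finset (Eucl d) → ℝ := fun s =>
    2 * (h * (A * (η * volume.real (simplex s) + η ^ (1 - p) * (Φ (simplex s)).toReal))) with hB
  have hB0 : ∀ s, 0 ≤ B s := fun s => by positivity
  refine ⟨fun s => B s / volume.real (simplex s), fun s => div_nonneg (hB0 s) measureReal_nonneg,
    fun s hs x hx y hy => ?_, ?_⟩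
  · rw [le_div_iff₀ (hvol s hs)]
    exact abs_sub_mul_measure_le hw (convex_convexHull ℝ _) (isCompact_simplex s).measurableSet
      (measure_simplex_ne_top s) hh (fun x hx y hy => (norm_sub_le_diam hy hx).trans (hdiam s hs))
      hp hdp hη (hΦs s (hT.mem_cellFinset.2 hs)) hx hy
  · calc ∑ s ∈ hT.cellFinset, volume.real (simplex s) * (B s / volume.real (simplex s))
        = ∑ s ∈ hT.cellFinset, B s := by
          refine Finset.sum_congr rfl fun s hs => ?_
          have := (hvol s (hT.mem_cellFinset.1 hs)).ne'
          field_simp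
      _ = 2 * A * h * (η * ∑ s ∈ hT.cellFinset, volume.real (simplex s) +
            η ^ (1 - p) * ∑ s ∈ hT.cellFinset, (Φ (simplex s)).toReal) := by
          rw [Finset.mul_sum, Finset.mul_sum, ← Finset.sum_add_distrib, Finset.mul_sum]
          refine Finset.sum_congr rfl fun s _ => ?_
          simp only [hB]
          ring
      _ ≤ 2 * A * h * (η * volume.real (closure Ω) + η ^ (1 - p) * η ^ p) := by gcongr
      _ = 2 * A * (volume.real (closure Ω) + 1) * h * η := by
          rw [← Real.rpow_add hη, sub_add_cancel, Real.rpow_one]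
          ring

end Morrey

end TVFEM

namespace TVFEM

/-! ### Nodal interpolation controlled by oscillations. -/

section Interpolation

variable {d : ℕ} {Ω : Set (Eucl d)} {K : Geometry.SimplicialComplex ℝ (Eucl d)}

/-- `v` is affine on every cell and takes the values of `w` at the vertices. -/
def IsNodal (K : Geometry.SimplicialComplex ℝ (Eucl d)) (w v : Eucl d → ℝ) : Prop :=
  ∀ s ∈ cells K, ∃ a : Eucl d →ᵃ[ℝ] ℝ, EqOn v a (simplex s) ∧ ∀ x ∈ s, a x = w x

lemma IsNodal.sub {w w' v v' : Eucl d → ℝ} (hv : IsNodal K w v) (hv' : IsNodal K w' v') :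
    IsNodal K (fun x => w x - w' x) fun x => v x - v' x := by
  intro s hs
  obtain ⟨a, ha, haw⟩ := hv s hs
  obtain ⟨a', ha', haw'⟩ := hv' s hs
  refine ⟨a - a', fun x hx => ?_, fun x hx => ?_⟩
  · simp [ha hx, ha' hx]
  · simp [haw x hx, haw' x hx]

lemma IsNodal.abs_le (hT : IsTriangulation Ω K) {w v : Eucl d → ℝ} {δ : ℝ} (hv : IsNodal K w v)
    (hw : ∀ x ∈ closure Ω, |w x| ≤ δ) {x : Eucl d} (hx : x ∈ closure Ω) : |v x| ≤ δ := by
  obtain ⟨s, hs, hxs⟩ := hT.exists_cell hx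
  obtain ⟨a, ha, haw⟩ := hv s hs
  rw [ha hxs, _root_.abs_le]
  refine affine_mem_Icc (fun y hy => ?_) hxs
  rw [haw y hy]
  exact _root_.abs_le.1 (hw y (hT.simplex_subset hs (vertex_mem_simplex hy)))

lemma IsNodal.isNodalInterpolant (hT : IsTriangulation Ω K) {w v : Eucl d → ℝ}
    (hv : IsNodal K w v) : IsNodalInterpolant Ω K w v := by
  refine ⟨⟨hT.continuousOn_of_cells fun s hs => ?_, fun s hs => ?_⟩, fun x hx => ?_⟩
  · obtain ⟨a, ha, -⟩ := hv s hs
    exact (a.continuous_of_finiteDimensional.continuousOn).congr ha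
  · obtain ⟨a, ha, -⟩ := hv s hs
    exact ⟨a, ha⟩
  · obtain ⟨t, ht, hxt⟩ := hT.pure {x} hx
    have hxt' : x ∈ t := hxt (Finset.mem_singleton_self x)
    obtain ⟨a, ha, haw⟩ := hv t ht
    rw [ha (vertex_mem_simplex hxt'), haw x hxt']

lemma IsNodal.abs_sub_le {w v : Eucl d → ℝ} (hv : IsNodal K w v)
    {s : Finset (Eucl d)} (hs : s ∈ cells K) {b : ℝ}
    (hosc : ∀ x ∈ simplex s, ∀ y ∈ simplex s, |w x - w y| ≤ b) {x : Eucl d} (hx : x ∈ simplex s) :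
    |v x - w x| ≤ b := by
  obtain ⟨a, ha, haw⟩ := hv s hs
  have h : a x ∈ Icc (w x - b) (w x + b) := by
    refine affine_mem_Icc (fun y hy => ?_) hx
    have := _root_.abs_le.1 (hosc y (vertex_mem_simplex hy) x hx)
    rw [haw y hy]
    constructor <;> linarith [this.1, this.2]
  rw [ha hx, _root_.abs_le]
  constructor <;> linarith [h.1, h.2]

lemma IsNodal.lipschitz {w v : Eucl d → ℝ} (hv : IsNodal K w v)
    {s : Finset (Eucl d)} (hs : s ∈ cells K) {b r : ℝ} {c : Eucl d} (hr : 0 < r)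
    (hball : Metric.closedBall c r ⊆ simplex s) (hb : 0 ≤ b)
    (hosc : ∀ x ∈ simplex s, ∀ y ∈ simplex s, |w x - w y| ≤ b) {x y : Eucl d}
    (hx : x ∈ simplex s) (hy : y ∈ simplex s) : |v x - v y| ≤ b / r * ‖x - y‖ := by
  obtain ⟨a, ha, haw⟩ := hv s hs
  have h : ‖gradForm a‖ ≤ b / r := norm_le_of_osc_le hr hball hb fun x hx y hy => by
    rw [gradForm_sub, haw x hx, haw y hy]
    exact (le_abs_self _).trans (hosc x (vertex_mem_simplex hx) y (vertex_mem_simplex hy))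
  rw [ha hx, ha hy, ← gradForm_sub, ← Real.norm_eq_abs]
  exact (gradForm a).le_of_opNorm_le h _

/-- Inverse estimate: on a cell the slope is at most the oscillation divided by the inradius, which
is at least `h / κ`. The resulting `1 / h` cancels the `h` in `exists_sum_osc_le`. -/
lemma IsNodal.TV_le (hΩ : IsOpen Ω) (hΩb : Bornology.IsBounded Ω) (hT : IsTriangulation Ω K)
    {κ h : ℝ} (hκ : 0 < κ) (hh : 0 < h)
    (hball : ∀ s ∈ cells K, ∃ (c : Eucl d) (r : ℝ), 0 < r ∧
      Metric.closedBall c r ⊆ simplex s ∧ h ≤ κ * r)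
    {w v : Eucl d → ℝ} (hv : IsNodal K w v) {b : Finset (Eucl d) → ℝ} (hb : ∀ s, 0 ≤ b s)
    (hosc : ∀ s ∈ cells K, ∀ x ∈ simplex s, ∀ y ∈ simplex s, |w x - w y| ≤ b s) :
    TV Ω v ≤ ENNReal.ofReal
      (d * κ / h * ∑ s ∈ hT.cellFinset, volume.real (simplex s) * b s) := by
  refine (hT.TV_le_of_lipschitz hΩ hΩb (B := fun s => κ / h * b s)
    (fun s => mul_nonneg (by positivity) (hb s)) fun s hs x hx y hy => ?_).trans (le_of_eq ?_)
  · obtain ⟨c, r, hr, hcb, hle⟩ := hball s hs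
    refine (hv.lipschitz hs hr hcb (hb s) (hosc s hs) hx hy).trans ?_
    refine mul_le_mul_of_nonneg_right ?_ (norm_nonneg _)
    rw [div_mul_eq_mul_div, div_le_div_iff₀ hr hh, mul_comm κ, mul_assoc]
    exact mul_le_mul_of_nonneg_left hle (hb s)
  · rw [Finset.mul_sum, Finset.mul_sum]
    congr 1
    refine Finset.sum_congr rfl fun s _ => ?_
    ring

lemma IsNodal.eLpNorm_sub_le (hT : IsTriangulation Ω K)
    {w v : Eucl d → ℝ} (hv : IsNodal K w v) {b : Finset (Eucl d) → ℝ} (hb : ∀ s, 0 ≤ b s)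
    (hosc : ∀ s ∈ cells K, ∀ x ∈ simplex s, ∀ y ∈ simplex s, |w x - w y| ≤ b s) :
    eLpNorm (fun x => v x - w x) 1 (volume.restrict Ω) ≤
      ENNReal.ofReal (∑ s ∈ hT.cellFinset, volume.real (simplex s) * b s) :=
  hT.eLpNorm_le_of_cells hb fun s hs _ hx => hv.abs_sub_le hs (hosc s hs) hx

lemma IsPolygonalDomain.setIntegral_closure (hΩ : IsPolygonalDomain Ω) (f : Eucl d → ℝ) :
    ∫ x in closure Ω, f x = ∫ x in Ω, f x := by
  refine setIntegral_congr_set ?_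
  refine (Filter.EventuallyLE.antisymm (subset_closure (s := Ω)).eventuallyLE ?_).symm
  rw [ae_le_set, ← hΩ.isOpen.frontier_eq]
  exact hΩ.measure_frontier

/-- A bound for the maximum of a function by its mean and its oscillation on the cells. -/
lemma IsTriangulation.abs_le_of_osc (hΩ : IsPolygonalDomain Ω) (hT : IsTriangulation Ω K)
    (hvol : ∀ s ∈ cells K, 0 < volume.real (simplex s)) {w : Eucl d → ℝ} (hw : Continuous w)
    {b : Finset (Eucl d) → ℝ} (hb : ∀ s, 0 ≤ b s)
    (hosc : ∀ s ∈ cells K, ∀ x ∈ simplex s, ∀ y ∈ simplex s, |w x - w y| ≤ b s)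
    {x : Eucl d} (hx : x ∈ closure Ω) :
    |w x| ≤ (∑ s ∈ hT.cellFinset, (volume.real (simplex s))⁻¹) *
      ((∫ y in Ω, |w y|) + ∑ s ∈ hT.cellFinset, volume.real (simplex s) * b s) := by
  obtain ⟨s, hs, hxs⟩ := hT.exists_cell hx
  have hsm := hT.mem_cellFinset.2 hs
  have hwi : ∀ {A : Set (Eucl d)}, IsCompact A → IntegrableOn (fun y => |w y|) A := fun hA =>
    hw.abs.continuousOn.integrableOn_compact hA
  have hB : 0 ≤ (∫ y in Ω, |w y|) + ∑ s ∈ hT.cellFinset, volume.real (simplex s) * b s :=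
    add_nonneg (integral_nonneg fun _ => abs_nonneg _)
      (Finset.sum_nonneg fun s _ => mul_nonneg measureReal_nonneg (hb s))
  have h1 : |w x| * volume.real (simplex s) ≤
      (∫ y in Ω, |w y|) + ∑ s ∈ hT.cellFinset, volume.real (simplex s) * b s := by
    calc |w x| * volume.real (simplex s) = ∫ _ in simplex s, |w x| := by
          rw [setIntegral_const, smul_eq_mul, mul_comm]
      _ ≤ ∫ y in simplex s, (|w y| + b s) := by
          refine setIntegral_mono_on (integrableOn_const (measure_simplex_ne_top s))
            ((hwi (isCompact_simplex s)).add (integrableOn_const (measure_simplex_ne_top s)))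
            (isCompact_simplex s).measurableSet fun y hy => ?_
          have h2 := hosc s hs x hxs y hy
          have h3 := abs_sub_abs_le_abs_sub (w x) (w y)
          linarith
      _ = (∫ y in simplex s, |w y|) + volume.real (simplex s) * b s := by
          rw [integral_add (hwi (isCompact_simplex s))
            (integrableOn_const (measure_simplex_ne_top s)), setIntegral_const, smul_eq_mul]
      _ ≤ _ := by
          rw [← hΩ.setIntegral_closure]
          refine add_le_add (setIntegral_mono_set
            (hwi hΩ.isBounded.isCompact_closure) (ae_of_all _ fun _ => abs_nonneg _)
            (hT.simplex_subset hs).eventuallyLE) ?_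
          exact Finset.single_le_sum (f := fun s => volume.real (simplex s) * b s)
            (fun s _ => mul_nonneg measureReal_nonneg (hb s)) hsm
  rw [← le_div_iff₀ (hvol s hs), div_eq_inv_mul] at h1
  -- Summing the inverse volumes is crude and depends on the triangulation, which is harmless when
  -- the triangulation is fixed.
  refine h1.trans (mul_le_mul_of_nonneg_right ?_ hB)
  exact Finset.single_le_sum (f := fun s => (volume.real (simplex s))⁻¹)
    (fun s _ => inv_nonneg.2 measureReal_nonneg) hsm

lemma volume_real_simplex_pos {s : Finset (Eucl d)} {c : Eucl d} {r : ℝ} (hr : 0 < r)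
    (hball : Metric.closedBall c r ⊆ simplex s) : 0 < volume.real (simplex s) :=
  ENNReal.toReal_pos ((Metric.measure_closedBall_pos volume c hr).trans_le
    (measure_mono hball)).ne' (measure_simplex_ne_top s)

lemma tendsto_eLpNorm_of_tendstoUniformlyOn (hΩ : IsOpen Ω) (hΩb : Bornology.IsBounded Ω)
    {l : Filter ℝ} {F : ℝ → Eucl d → ℝ} {f : Eucl d → ℝ}
    (hF : TendstoUniformlyOn F f l (closure Ω)) :
    Tendsto (fun ε => eLpNorm (fun x => F ε x - f x) 1 (volume.restrict Ω)) l (𝓝 0) := by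
  rw [ENNReal.tendsto_nhds_zero]
  intro δ hδ
  have h1 : Tendsto (fun r : ℝ => volume Ω * ENNReal.ofReal r) (𝓝[>] 0) (𝓝 0) := by
    have h := ENNReal.Tendsto.const_mul
      (ENNReal.tendsto_ofReal (tendsto_id (α := ℝ) (x := 𝓝 0)))
      (Or.inr hΩb.measure_lt_top.ne) (a := volume Ω)
    simp only [id, ENNReal.ofReal_zero, mul_zero] at h
    exact h.mono_left nhdsWithin_le_nhds
  obtain ⟨r, hr, hr0⟩ := ((ENNReal.tendsto_nhds_zero.1 h1 δ hδ).and
    self_mem_nhdsWithin).exists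
  filter_upwards [Metric.tendstoUniformlyOn_iff.1 hF r hr0] with ε hε
  refine le_trans ?_ hr
  have h2 : ∀ᵐ x ∂(volume.restrict Ω), ‖F ε x - f x‖ ≤ r := by
    filter_upwards [ae_restrict_mem hΩ.measurableSet] with x hx
    rw [← dist_eq_norm, dist_comm]
    exact (hε x (subset_closure hx)).le
  simpa using eLpNorm_le_of_ae_bound (p := 1) h2

end Interpolation

end TVFEM

namespace TVFEM

/-! ### Uniform convergence of the smoothings for `p > d`. -/

section Sobolev

variable {d : ℕ} {Ω : Set (Eucl d)} {q : Eucl d → ℝ} {qlo qhi : ℝ} {p : ℝ}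
  {K : ℝ → Geometry.SimplicialComplex ℝ (Eucl d)}

namespace InwardCover

variable {ι : Type} [Fintype ι] (c : InwardCover Ω ι)

lemma hasCompactSupport_smoothing (q : Eucl d → ℝ) (ε : ℝ) :
    HasCompactSupport (c.smoothing q ε) := by
  have h : IsCompact (⋃ j, tsupport (c.ψ j)) := isCompact_iUnion fun j => c.hasCompactSupport j
  refine HasCompactSupport.intro h fun x hx => ?_
  refine Finset.sum_eq_zero fun j _ => ?_
  have : x ∉ tsupport (c.ψ j) := fun hj => hx (mem_iUnion.2 ⟨j, hj⟩)
  rw [image_eq_zero_of_notMem_tsupport this, zero_mul]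

lemma exists_eLpNorm_fderiv_smoothing_le (hΩ : IsOpen Ω) (hΩb : Bornology.IsBounded Ω)
    (hp : 1 ≤ p) (hq : MemW1p Ω (ENNReal.ofReal p) q) :
    ∃ N : ℝ, 0 < N ∧ ∃ ε₁ ∈ Ioc 0 c.ε₀, ∀ ε ∈ Ioc 0 ε₁,
      eLpNorm (fun x => ‖fderiv ℝ (c.smoothing q ε) x‖) (ENNReal.ofReal p) (volume.restrict Ω) ≤
        ENNReal.ofReal N := by
  have hp1 : 1 ≤ ENNReal.ofReal p := by simpa using ENNReal.ofReal_le_ofReal hp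
  have : IsFiniteMeasure (volume.restrict Ω) := isFiniteMeasure_restrict.2 hΩb.measure_lt_top.ne
  have hqi : IntegrableOn q Ω := hq.1.integrable hp1
  obtain ⟨ε₁, hε₁, hsub⟩ := c.exists_eLpNorm_fderiv_smoothing_sub_le hΩ hΩb hp1
    ENNReal.ofReal_ne_top hq (η := 1) zero_lt_one
  have hcd : ∀ ε : ℝ, 0 < ε → ContDiff ℝ ∞ (c.smoothing q ε) := fun ε hε =>
    c.contDiff_smoothing hΩ hqi hε
  have hfc : ∀ ε : ℝ, 0 < ε → Continuous (fderiv ℝ (c.smoothing q ε)) := fun ε hε =>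
    (hcd ε hε).continuous_fderiv (by simp)
  have hmem : MemLp (fderiv ℝ (c.smoothing q ε₁)) (ENNReal.ofReal p) (volume.restrict Ω) :=
    ((hfc ε₁ hε₁.1).memLp_of_hasCompactSupport
      ((c.hasCompactSupport_smoothing q ε₁).fderiv (𝕜 := ℝ))).restrict Ω
  set E := eLpNorm (fderiv ℝ (c.smoothing q ε₁)) (ENNReal.ofReal p) (volume.restrict Ω) with hE
  have hEt : E ≠ ⊤ := hmem.eLpNorm_ne_top
  refine ⟨1 + E.toReal, by positivity, ε₁, hε₁, fun ε hε => ?_⟩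
  rw [ENNReal.ofReal_add zero_le_one ENNReal.toReal_nonneg, ENNReal.ofReal_one,
    ENNReal.ofReal_toReal hEt]
  have hdiff : ∀ x, fderiv ℝ (fun y => c.smoothing q ε y - c.smoothing q ε₁ y) x =
      fderiv ℝ (c.smoothing q ε) x - fderiv ℝ (c.smoothing q ε₁) x := fun x =>
    fderiv_fun_sub ((hcd ε hε.1).differentiable (by simp) x)
      ((hcd ε₁ hε₁.1).differentiable (by simp) x)
  have h1 := hsub ε hε ε₁ ⟨hε₁.1, le_rfl⟩
  simp only [hdiff] at h1
  rw [eLpNorm_norm] at h1 ⊢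
  have h2 : fderiv ℝ (c.smoothing q ε) =
      (fun x => fderiv ℝ (c.smoothing q ε) x - fderiv ℝ (c.smoothing q ε₁) x) +
        fderiv ℝ (c.smoothing q ε₁) := by
    ext1 x
    simp
  rw [h2]
  exact (eLpNorm_add_le ((hfc ε hε.1).sub (hfc ε₁ hε₁.1)).aestronglyMeasurable
    (hfc ε₁ hε₁.1).aestronglyMeasurable hp1).trans (add_le_add h1 le_rfl)

/-- The smoothed functions converge uniformly on the closure of the domain. -/
lemma uniformCauchySeqOn_smoothing (hΩ : IsPolygonalDomain Ω)
    (hK : IsRegularQuasiUniformFamily Ω K) (hq : MemQad Ω qlo qhi q) (hp : 1 ≤ p) (hdp : d < p)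
    (hW : MemW1p Ω (ENNReal.ofReal p) q) :
    UniformCauchySeqOn (c.smoothing q) (𝓝[>] 0) (closure Ω) := by
  have hΩo := hΩ.isOpen
  have hΩb := hΩ.isBounded
  have hp1 : 1 ≤ ENNReal.ofReal p := by simpa using ENNReal.ofReal_le_ofReal hp
  have hqi : IntegrableOn q Ω := hq.2.1
  have hTV : TV Ω q ≠ ⊤ := hq.2.2.ne
  obtain ⟨C₁, hC₁0, hC₁⟩ := c.exists_integral_abs_smoothing_sub_le hΩo hΩb hqi hTV
  obtain ⟨C, hC0, hC⟩ := hΩ.exists_sum_osc_le hp hdp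
  obtain ⟨κ, hκ, hball⟩ := hK.exists_ball
  -- One fixed triangulation suffices; the mesh size 1/2 is arbitrary.
  have hI : (1 / 2 : ℝ) ∈ Ioo (0 : ℝ) 1 := by norm_num
  have hT := hK.isTriangulation _ hI
  have hvol : ∀ s ∈ cells (K (1 / 2)), 0 < volume.real (simplex s) := fun s hs => by
    obtain ⟨x, r, hr, hb, -⟩ := hball _ hI s hs
    exact volume_real_simplex_pos hr hb
  set M := ∑ s ∈ hT.cellFinset, (volume.real (simplex s))⁻¹ with hM
  have hM0 : 0 ≤ M := Finset.sum_nonneg fun s _ => inv_nonneg.2 measureReal_nonneg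
  have hcd : ∀ ε : ℝ, 0 < ε → ContDiff ℝ ∞ (c.smoothing q ε) := fun ε hε =>
    c.contDiff_smoothing hΩo hqi hε
  intro u hu
  obtain ⟨δ, hδ, hδu⟩ := Metric.mem_uniformity_dist.1 hu
  -- With this bound on the gradients the oscillations contribute at most `δ / 2`; each of the two
  -- `L¹` errors contributes at most `δ / 8`.
  have hη : 0 < δ / (M * C + 1) := by positivity
  obtain ⟨ε₁, hε₁, hsub⟩ := c.exists_eLpNorm_fderiv_smoothing_sub_le hΩo hΩb hp1
    ENNReal.ofReal_ne_top hW (ENNReal.ofReal_pos.2 hη)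
  have hr : 0 < min ε₁ (δ / (8 * (M * C₁ + 1))) := lt_min hε₁.1 (by positivity)
  have hmemr := Ioc_mem_nhdsGT hr
  filter_upwards [prod_mem_prod hmemr hmemr] with m hm x hx
  have key : ∀ ε ∈ Ioc 0 (min ε₁ (δ / (8 * (M * C₁ + 1)))), ε ∈ Ioc 0 ε₁ ∧
      M * (∫ y in Ω, |c.smoothing q ε y - q y|) ≤ δ / 8 := by
    intro ε hε
    have h1 := hε.2.trans (min_le_left _ _)
    have h2 := hε.2.trans (min_le_right _ _)
    rw [le_div_iff₀ (by positivity)] at h2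
    refine ⟨⟨hε.1, h1⟩, ?_⟩
    have h3 := mul_le_mul_of_nonneg_left (hC₁ ε hε.1 (h1.trans hε₁.2)) hM0
    nlinarith [hε.1]
  obtain ⟨hm1, hm1'⟩ := key m.1 hm.1
  obtain ⟨hm2, hm2'⟩ := key m.2 hm.2
  have hsm : ∀ ε : ℝ, 0 < ε → IntegrableOn (fun y => |c.smoothing q ε y - q y|) Ω := fun ε hε =>
    ((InwardCover.integrableOn_of_continuous hΩb (hcd ε hε).continuous).sub hqi).abs
  obtain ⟨b, hb0, hb, hbsum⟩ := hC (K (1 / 2)) hT (1 / 2) (δ / (M * C + 1))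
    (fun y => c.smoothing q m.1 y - c.smoothing q m.2 y) (by norm_num)
    (hK.meshSize _ hI) hvol (((hcd _ hm1.1).sub (hcd _ hm2.1)).of_le (by simp)) hη
    (hsub _ hm1 _ hm2)
  have h1 := hT.abs_le_of_osc (w := fun y => c.smoothing q m.1 y - c.smoothing q m.2 y) hΩ hvol
    ((hcd _ hm1.1).continuous.sub (hcd _ hm2.1).continuous) hb0 hb hx
  have h2 : ∫ y in Ω, |c.smoothing q m.1 y - c.smoothing q m.2 y| ≤
      (∫ y in Ω, |c.smoothing q m.1 y - q y|) + ∫ y in Ω, |c.smoothing q m.2 y - q y| := by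
    rw [← integral_add (hsm _ hm1.1) (hsm _ hm2.1)]
    refine integral_mono (InwardCover.integrableOn_of_continuous hΩb
      ((hcd _ hm1.1).continuous.sub (hcd _ hm2.1).continuous)).abs
      ((hsm _ hm1.1).add (hsm _ hm2.1)) fun y => ?_
    rw [abs_sub_comm (c.smoothing q m.2 y)]
    exact abs_sub_le _ _ _
  refine hδu ?_
  rw [Real.dist_eq]
  have h3 : M * (C * (1 / 2) * (δ / (M * C + 1))) ≤ δ / 2 := by
    have h4 : M * C / (M * C + 1) ≤ 1 := div_le_one_of_le₀ (by linarith) (by positivity)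
    calc M * (C * (1 / 2) * (δ / (M * C + 1))) = M * C / (M * C + 1) * (δ / 2) := by ring
      _ ≤ 1 * (δ / 2) := by gcongr
      _ = δ / 2 := one_mul _
  calc |c.smoothing q m.1 x - c.smoothing q m.2 x|
      ≤ M * (((∫ y in Ω, |c.smoothing q m.1 y - q y|) + ∫ y in Ω, |c.smoothing q m.2 y - q y|) +
          C * (1 / 2) * (δ / (M * C + 1))) := h1.trans (by gcongr)
    _ < δ := by linarith

end InwardCover

end Sobolev

end TVFEM

namespace TVFEM

/-! ### Nodal interpolants of the continuous representative. -/

section Sobolev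

variable {d : ℕ} {Ω : Set (Eucl d)} {q : Eucl d → ℝ} {qlo qhi : ℝ} {p : ℝ}
  {K : ℝ → Geometry.SimplicialComplex ℝ (Eucl d)}

/-- On a fixed triangulation the interpolants `v h` of `qc` are uniform limits, as `ε → 0`, of the
interpolants `V h ε` of the smoothings. Bounds for the latter that are uniform in `ε` pass to the
limit, by `L¹` convergence and lower semicontinuity of the variation. -/
theorem exists_nodal_isApproximatingFamily (hΩ : IsPolygonalDomain Ω)
    (hK : IsRegularQuasiUniformFamily Ω K) (hq : MemQad Ω qlo qhi q) (hp : 1 ≤ p) (hdp : d < p)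
    (hW : MemW1p Ω (ENNReal.ofReal p) q) :
    ∃ qc : Eucl d → ℝ, ContinuousOn qc (closure Ω) ∧ q =ᵐ[volume.restrict Ω] qc ∧
      ∃ qh : ℝ → Eucl d → ℝ, (∀ h ∈ Ioo (0 : ℝ) 1, IsNodalInterpolant Ω (K h) qc (qh h)) ∧
        IsApproximatingFamily Ω qlo qhi K q qh := by
  have hΩo := hΩ.isOpen
  have hΩb := hΩ.isBounded
  have hp1 : 1 ≤ ENNReal.ofReal p := by simpa using ENNReal.ofReal_le_ofReal hp
  have hqi : IntegrableOn q Ω := hq.2.1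
  have hTV : TV Ω q ≠ ⊤ := hq.2.2.ne
  obtain ⟨ι, _, ⟨c⟩⟩ := exists_inwardCover hΩo hΩb hΩ.lipschitz
  obtain ⟨C₁, hC₁0, hC₁⟩ := c.exists_integral_abs_smoothing_sub_le hΩo hΩb hqi hTV
  obtain ⟨C₂, hC₂0, hC₂⟩ := c.exists_TV_smoothing_le hΩo hΩb hqi hTV
  obtain ⟨C, hC0, hC⟩ := hΩ.exists_sum_osc_le hp hdp
  obtain ⟨κ, hκ, hball⟩ := hK.exists_ball
  set Q := c.smoothing q with hQ
  have hcd : ∀ ε : ℝ, 0 < ε → ContDiff ℝ ∞ (Q ε) := fun ε hε =>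
    c.contDiff_smoothing hΩo hqi hε
  have hQi : ∀ ε : ℝ, 0 < ε → IntegrableOn (Q ε) Ω := fun ε hε =>
    InwardCover.integrableOn_of_continuous hΩb (hcd ε hε).continuous
  have hvol : ∀ h ∈ Ioo (0 : ℝ) 1, ∀ s ∈ cells (K h), 0 < volume.real (simplex s) :=
    fun h hh s hs => by
      obtain ⟨x, r, hr, hb, -⟩ := hball h hh s hs
      exact volume_real_simplex_pos hr hb
  have hcauchy := c.uniformCauchySeqOn_smoothing hΩ hK hq hp hdp hW
  have hex : ∀ x ∈ closure Ω, ∃ y, Tendsto (fun ε => Q ε x) (𝓝[>] 0) (𝓝 y) := fun x hx =>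
    CompleteSpace.complete (hcauchy.cauchy_map hx)
  choose! qc hqc using hex
  have hunif : TendstoUniformlyOn Q qc (𝓝[>] 0) (closure Ω) :=
    hcauchy.tendstoUniformlyOn_of_tendsto hqc
  have hpos : ∀ᶠ ε : ℝ in 𝓝[>] 0, 0 < ε := self_mem_nhdsWithin
  have hqcc : ContinuousOn qc (closure Ω) :=
    hunif.continuousOn (hpos.mono fun ε hε => (hcd ε hε).continuous.continuousOn).frequently
  have hqcI : ∀ x ∈ closure Ω, qc x ∈ Icc qlo qhi := fun x hx => by
    refine isClosed_Icc.mem_of_tendsto (hqc x hx) ?_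
    filter_upwards [Ioc_mem_nhdsGT c.pos] with ε hε
    exact c.smoothing_mem_Icc hΩo hqi hq.1.2 hε.1 hε.2 hx
  have hqci : IntegrableOn qc Ω :=
    (hqcc.integrableOn_compact hΩb.isCompact_closure).mono_set subset_closure
  have hlimqc := tendsto_eLpNorm_of_tendstoUniformlyOn hΩo hΩb hunif
  have hlimq : Tendsto (fun ε => eLpNorm (fun x => Q ε x - q x) 1 (volume.restrict Ω)) (𝓝[>] 0)
      (𝓝 0) := by
    have h1 : Tendsto (fun ε : ℝ => ENNReal.ofReal (C₁ * ε)) (𝓝[>] 0) (𝓝 0) := by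
      have h : Tendsto (fun ε : ℝ => ENNReal.ofReal (C₁ * ε)) (𝓝 0)
          (𝓝 (ENNReal.ofReal (C₁ * 0))) :=
        (ENNReal.continuous_ofReal.comp (continuous_const.mul continuous_id)).tendsto 0
      rw [mul_zero, ENNReal.ofReal_zero] at h
      exact h.mono_left nhdsWithin_le_nhds
    refine tendsto_of_tendsto_of_tendsto_of_le_of_le' tendsto_const_nhds h1
      (Eventually.of_forall fun _ => zero_le) ?_
    filter_upwards [Ioc_mem_nhdsGT c.pos] with ε hε
    rw [eLpNorm_eq_ofReal_integral (g := fun x => Q ε x - q x) ((hQi ε hε.1).sub hqi)]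
    exact ENNReal.ofReal_le_ofReal (hC₁ ε hε.1 hε.2)
  have hae : q =ᵐ[volume.restrict Ω] qc := by
    have h1 : eLpNorm (q - qc) 1 (volume.restrict Ω) ≤ 0 := by
      have h2 := hlimqc.add hlimq
      rw [add_zero] at h2
      refine ge_of_tendsto h2 ?_
      filter_upwards [hpos] with ε hε
      have e : q - qc = (fun x => Q ε x - qc x) - fun x => Q ε x - q x := by
        ext x
        simp
      rw [e]
      exact eLpNorm_sub_le ((hQi ε hε).sub hqci).aestronglyMeasurable
        ((hQi ε hε).sub hqi).aestronglyMeasurable le_rfl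
    rw [nonpos_iff_eq_zero, eLpNorm_eq_zero_iff (hqi.sub hqci).aestronglyMeasurable
      one_ne_zero] at h1
    filter_upwards [h1] with x hx
    exact sub_eq_zero.1 hx
  choose! v hv using fun h (hh : h ∈ Ioo (0 : ℝ) 1) =>
    (hK.isTriangulation h hh).exists_interpolant qc
  choose! V hV using fun h (hh : h ∈ Ioo (0 : ℝ) 1) (ε : ℝ) =>
    (hK.isTriangulation h hh).exists_interpolant (Q ε)
  have hvN : ∀ h ∈ Ioo (0 : ℝ) 1, IsNodal (K h) qc (v h) := hv
  have hVN : ∀ h ∈ Ioo (0 : ℝ) 1, ∀ ε, IsNodal (K h) (Q ε) (V h ε) := hV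
  have hint : ∀ h ∈ Ioo (0 : ℝ) 1, ∀ w v, IsNodal (K h) w v → IntegrableOn v Ω :=
    fun h hh w v hv => ((hv.isNodalInterpolant
      (hK.isTriangulation h hh)).1.1.integrableOn_compact hΩb.isCompact_closure).mono_set
        subset_closure
  have hmem : ∀ h ∈ Ioo (0 : ℝ) 1, MemQadh Ω qlo qhi (K h) (v h) := fun h hh =>
    (hK.isTriangulation h hh).memQadh_of_nodes hΩo (hv h hh) hqcI
  -- Nodal interpolation does not increase the maximum norm.
  have hlimV : ∀ h ∈ Ioo (0 : ℝ) 1, Tendsto (fun ε =>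
      eLpNorm (fun x => V h ε x - v h x) 1 (volume.restrict Ω)) (𝓝[>] 0) (𝓝 0) := by
    intro h hh
    refine tendsto_eLpNorm_of_tendstoUniformlyOn hΩo hΩb ?_
    rw [Metric.tendstoUniformlyOn_iff] at hunif ⊢
    intro r hr
    filter_upwards [hunif (r / 2) (by positivity)] with ε hε x hx
    rw [Real.dist_eq]
    refine (((hvN h hh).sub (hVN h hh ε)).abs_le (hK.isTriangulation h hh) (fun y hy => ?_)
      hx).trans_lt (half_lt_self hr)
    exact (hε y hy).le
  obtain ⟨N, hN, ε₁, hε₁, hNle⟩ := c.exists_eLpNorm_fderiv_smoothing_le hΩo hΩb hp hW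
  -- Insert `V h ε` and `Q ε` between `v h` and `q` and let `ε → 0`; what remains is the
  -- interpolation error of `Q ε`, bounded uniformly in `ε` through the gradient bound `N`.
  have hrate : ∀ h ∈ Ioo (0 : ℝ) 1, eLpNorm (fun x => v h x - q x) 1 (volume.restrict Ω) ≤
      ENNReal.ofReal (C * h * N) := by
    intro h hh
    have h2 := ((hlimV h hh).add (tendsto_const_nhds (x := ENNReal.ofReal (C * h * N)))).add hlimq
    rw [add_zero, zero_add] at h2
    refine ge_of_tendsto h2 ?_
    filter_upwards [Ioc_mem_nhdsGT hε₁.1] with ε hε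
    obtain ⟨b, hb0, hb, hbsum⟩ := hC (K h) (hK.isTriangulation h hh) h N (Q ε) hh.1.le
      (hK.meshSize h hh) (hvol h hh) ((hcd ε hε.1).of_le (by simp)) hN (hNle ε hε)
    have h3 := ((hVN h hh ε).eLpNorm_sub_le (hK.isTriangulation h hh) hb0 hb).trans
      (ENNReal.ofReal_le_ofReal hbsum)
    have hVi := hint h hh _ _ (hVN h hh ε)
    have hvi := hint h hh _ _ (hvN h hh)
    have e : (fun x => v h x - q x) = ((fun x => V h ε x - Q ε x) - fun x => V h ε x - v h x) +
        fun x => Q ε x - q x := by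
      ext x
      simp
    rw [e, add_comm (eLpNorm (fun x => V h ε x - v h x) 1 _)]
    refine (eLpNorm_add_le ((hVi.sub (hQi ε hε.1)).sub (hVi.sub hvi)).aestronglyMeasurable
      ((hQi ε hε.1).sub hqi).aestronglyMeasurable le_rfl).trans (add_le_add ?_ le_rfl)
    exact (eLpNorm_sub_le (hVi.sub (hQi ε hε.1)).aestronglyMeasurable
      (hVi.sub hvi).aestronglyMeasurable le_rfl).trans (add_le_add h3 le_rfl)
  have hlim : Tendsto (fun h => eLpNorm (fun x => v h x - q x) 1 (volume.restrict Ω)) (𝓝[>] 0)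
      (𝓝 0) := by
    have h1 : Tendsto (fun h : ℝ => ENNReal.ofReal (C * h * N)) (𝓝[>] 0) (𝓝 0) := by
      have h : Tendsto (fun h : ℝ => ENNReal.ofReal (C * h * N)) (𝓝 0)
          (𝓝 (ENNReal.ofReal (C * 0 * N))) :=
        (ENNReal.continuous_ofReal.comp (by fun_prop : Continuous fun h : ℝ =>
          C * h * N)).tendsto 0
      rw [mul_zero, zero_mul, ENNReal.ofReal_zero] at h
      exact h.mono_left nhdsWithin_le_nhds
    refine tendsto_of_tendsto_of_tendsto_of_le_of_le' tendsto_const_nhds h1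
      (Eventually.of_forall fun _ => zero_le) ?_
    filter_upwards [Ioo_mem_nhdsGT (zero_lt_one' ℝ)] with h hh using hrate h hh
  have hTVbound : ∀ δ : ℝ, 0 < δ → ∀ᶠ h in 𝓝[>] 0, TV Ω (v h) ≤ TV Ω q + ENNReal.ofReal δ := by
    intro δ hδ
    -- Chosen so that interpolating a function whose gradient has `L^p` norm at most `η` produces
    -- variation at most `δ / 3`, for every `h`.
    set η := δ / (3 * (d * κ * C + 1)) with hη
    have hη0 : 0 < η := by positivity
    have hηδ : d * κ * C * η ≤ δ / 3 := by
      have h4 : d * κ * C / (d * κ * C + 1) ≤ 1 :=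
        div_le_one_of_le₀ (by linarith) (by positivity)
      calc d * κ * C * η = d * κ * C / (d * κ * C + 1) * (δ / 3) := by
            rw [hη]
            field_simp
        _ ≤ 1 * (δ / 3) := by gcongr
        _ = δ / 3 := one_mul _
    obtain ⟨ε₂, hε₂, hsub⟩ := c.exists_eLpNorm_fderiv_smoothing_sub_le hΩo hΩb hp1
      ENNReal.ofReal_ne_top hW (ENNReal.ofReal_pos.2 hη0)
    have htv : ∀ᶠ ε in 𝓝[>] (0 : ℝ), C₂ * ε * (TV Ω q).toReal ≤ δ / 3 := by
      have h : Tendsto (fun ε : ℝ => C₂ * ε * (TV Ω q).toReal) (𝓝 0)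
          (𝓝 (C₂ * 0 * (TV Ω q).toReal)) :=
        (by fun_prop : Continuous fun ε : ℝ => C₂ * ε * (TV Ω q).toReal).tendsto 0
      rw [mul_zero, zero_mul] at h
      exact (h.mono_left nhdsWithin_le_nhds).eventually_le_const (by positivity)
    obtain ⟨ε, hεtv, hε⟩ := (htv.and (Ioc_mem_nhdsGT hε₂.1)).exists
    obtain ⟨D, hD0, hD⟩ := exists_lipschitz_of_contDiff
      ((hcd ε hε.1).fderiv_right (m := 1) (WithTop.coe_le_coe.2 le_top))
      ((c.hasCompactSupport_smoothing q ε).fderiv (𝕜 := ℝ))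
    have hsmall : ∀ᶠ h in 𝓝[>] (0 : ℝ),
        d * κ * (volume.real (closure Ω) * (D * h)) ≤ δ / 3 := by
      have h : Tendsto (fun h : ℝ => d * κ * (volume.real (closure Ω) * (D * h))) (𝓝 0)
          (𝓝 (d * κ * (volume.real (closure Ω) * (D * 0)))) :=
        (by fun_prop : Continuous fun h : ℝ =>
          d * κ * (volume.real (closure Ω) * (D * h))).tendsto 0
      rw [mul_zero, mul_zero, mul_zero] at h
      exact (h.mono_left nhdsWithin_le_nhds).eventually_le_const (by positivity)
    filter_upwards [hsmall, Ioo_mem_nhdsGT (zero_lt_one' ℝ)] with h hsm hh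
    have hT := hK.isTriangulation h hh
    have hh0 := hh.1
    have hVi := fun ε => hint h hh _ _ (hVN h hh ε)
    have hvolsum := IsTriangulation.sum_measureReal_le_of_cells hT.cellFinset
      (fun s hs => hT.mem_cellFinset.1 hs) hΩb.isCompact_closure.measure_lt_top.ne
      fun s hs => hT.simplex_subset (hT.mem_cellFinset.1 hs)
    -- The smoothing `Q ε` is now fixed and its gradient is Lipschitz, so the variation of its
    -- interpolation error is of order `h`.
    have hA : TV Ω (V h ε) ≤ TV Ω q + ENNReal.ofReal (δ / 3) + ENNReal.ofReal (δ / 3) := by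
      have h1 := (hT.interpolation_error hΩo hΩb hκ (hK.meshSize h hh) (fun s hs => by
        obtain ⟨x, r, hr, hb, hle⟩ := hball h hh s hs
        exact ⟨x, r, hr, hb, (hK.meshSize h hh s hs).trans hle⟩)
        ((hcd ε hε.1).of_le (by simp)) (τ := fun _ => D * h) (fun _ => by positivity)
        (fun s hs x hx y hy => (hD x y).trans (mul_le_mul_of_nonneg_left
          ((norm_sub_le_diam hx hy).trans (hK.meshSize h hh s hs)) hD0)) (hVN h hh ε)).1
      have h2 := hC₂ ε hε.1 (hε.2.trans hε₂.2)
      have e : V h ε = fun x => Q ε x + (V h ε x - Q ε x) := by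
        ext x
        ring
      conv_lhs => rw [e]
      refine (TV_add_le (hQi ε hε.1) ((hVi ε).sub (hQi ε hε.1))).trans (add_le_add ?_ ?_)
      · refine h2.trans ?_
        rw [add_mul, one_mul, ENNReal.ofReal_add ENNReal.toReal_nonneg
          (mul_nonneg (mul_nonneg hC₂0 hε.1.le) ENNReal.toReal_nonneg), ENNReal.ofReal_toReal hTV]
        gcongr
      · refine h1.trans (ENNReal.ofReal_le_ofReal (le_trans ?_ hsm))
        rw [← Finset.sum_mul]
        gcongr
    -- Stability: the interpolant of `Q ε' - Q ε` has variation at most `(d κ / h) * C h η`,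
    -- uniformly in `h`.
    have hB : ∀ᶠ ε' in 𝓝[>] 0, TV Ω (V h ε') ≤ TV Ω (V h ε) + ENNReal.ofReal (δ / 3) := by
      filter_upwards [Ioc_mem_nhdsGT hε₂.1] with ε' hε'
      obtain ⟨b, hb0, hb, hbsum⟩ := hC (K h) hT h η (fun y => Q ε' y - Q ε y) hh.1.le
        (hK.meshSize h hh) (hvol h hh) (((hcd _ hε'.1).sub (hcd _ hε.1)).of_le (by simp)) hη0
        (hsub _ hε' _ hε)
      have h1 := ((hVN h hh ε').sub (hVN h hh ε)).TV_le hΩo hΩb hT hκ hh0 (hball h hh) hb0 hb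
      have e : V h ε' = fun x => V h ε x + (V h ε' x - V h ε x) := by
        ext x
        ring
      conv_lhs => rw [e]
      refine (TV_add_le (hVi ε) ((hVi ε').sub (hVi ε))).trans (add_le_add le_rfl
        (h1.trans (ENNReal.ofReal_le_ofReal ?_)))
      calc d * κ / h * ∑ s ∈ hT.cellFinset, volume.real (simplex s) * b s
          ≤ d * κ / h * (C * h * η) := by gcongr
        _ = d * κ * C * η := by field_simp
        _ ≤ δ / 3 := hηδ
    have hlsc := TV_le_liminf (Eventually.of_forall hVi) (hint h hh _ _ (hvN h hh)) (hlimV h hh)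
    calc TV Ω (v h) ≤ limsup (fun ε' => TV Ω (V h ε')) (𝓝[>] 0) :=
          hlsc.trans liminf_le_limsup
      _ ≤ TV Ω (V h ε) + ENNReal.ofReal (δ / 3) := limsup_le_of_le (h := hB)
      _ ≤ TV Ω q + ENNReal.ofReal (δ / 3) + ENNReal.ofReal (δ / 3) + ENNReal.ofReal (δ / 3) :=
          add_le_add hA le_rfl
      _ = TV Ω q + ENNReal.ofReal δ := by
          have h3 : 0 ≤ δ / 3 := by positivity
          rw [add_assoc, add_assoc, ← ENNReal.ofReal_add h3 h3,
            ← ENNReal.ofReal_add h3 (by positivity)]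
          congr 2
          ring
  refine ⟨qc, hqcc, hae, v, fun h hh =>
    (hvN h hh).isNodalInterpolant (hK.isTriangulation h hh), hmem, fun h₀ hh₀ => ?_, ?_⟩
  · have hlog0 : 0 < |Real.log h₀| := abs_pos.2 (Real.log_neg hh₀.1 hh₀.2).ne
    -- The error is of order `h`, and `|log h| ≥ |log h₀|` for `h ≤ h₀`.
    refine ⟨(C * N + 1) / |Real.log h₀|, by positivity, fun h hh => ?_⟩
    have hlog : |Real.log h₀| ≤ |Real.log h| := by
      rw [abs_of_neg (Real.log_neg hh₀.1 hh₀.2),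
        abs_of_neg (Real.log_neg hh.1 (hh.2.trans_lt hh₀.2))]
      exact neg_le_neg (Real.log_le_log hh.1 hh.2)
    have hh0 := hh.1.le
    refine (hrate h ⟨hh.1, hh.2.trans_lt hh₀.2⟩).trans (ENNReal.ofReal_le_ofReal ?_)
    calc C * h * N ≤ (C * N + 1) * h := by linarith
      _ = (C * N + 1) / |Real.log h₀| * h * |Real.log h₀| := by field_simp
      _ ≤ (C * N + 1) / |Real.log h₀| * h * |Real.log h| := by gcongr
  · refine tendsto_of_le_liminf_of_limsup_le (TV_le_liminf ?_ hqi hlim) ?_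
    · filter_upwards [Ioo_mem_nhdsGT (zero_lt_one' ℝ)] with h hh using hint h hh _ _ (hvN h hh)
    · refine ENNReal.le_of_forall_pos_le_add fun δ hδ _ => ?_
      refine limsup_le_of_le (h := ?_)
      simpa using hTVbound δ hδ

lemma MemW1p.mono (hΩb : Bornology.IsBounded Ω) {p p' : ℝ≥0∞} (hpp : p ≤ p')
    (hW : MemW1p Ω p' q) : MemW1p Ω p q := by
  have : IsFiniteMeasure (volume.restrict Ω) := isFiniteMeasure_restrict.2 hΩb.measure_lt_top.ne
  refine ⟨hW.1.mono_exponent hpp, fun i => ?_⟩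
  obtain ⟨g, hg, hgw⟩ := hW.2 i
  exact ⟨g, hg.mono_exponent hpp, hgw⟩

/-- On a bounded domain the exponent may be lowered to a real one still above `d`; this covers `p =
∞`, where translations are not continuous in norm. -/
lemma MemW1p.exists_real (hΩb : Bornology.IsBounded Ω) (hd : 1 ≤ d) {p : ℝ≥0∞}
    (hp : (d : ℝ≥0∞) < p) (hW : MemW1p Ω p q) :
    ∃ r : ℝ, 1 ≤ r ∧ d < r ∧ MemW1p Ω (ENNReal.ofReal r) q := by
  have hd' : (1 : ℝ) ≤ d := by exact_mod_cast hd
  obtain ⟨r, hr, hrp⟩ := ENNReal.lt_iff_exists_nnreal_btwn.1 hp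
  have hr' : (d : ℝ) < r := by exact_mod_cast hr
  refine ⟨r, by linarith, hr', hW.mono hΩb ?_⟩
  rw [ENNReal.ofReal_coe_nnreal]
  exact hrp.le

end Sobolev

end TVFEM

theorem lemma4p3 (d : ℕ) (hd : d = 2 ∨ d = 3)
    (Ω : Set (EuclideanSpace ℝ (Fin d))) (hΩ : TVFEM.IsPolygonalDomain Ω)
    (K : ℝ → Geometry.SimplicialComplex ℝ (EuclideanSpace ℝ (Fin d)))
    (hK : TVFEM.IsRegularQuasiUniformFamily Ω K)
    (qlo qhi : ℝ) (hlo : 0 < qlo) (hhi : 0 < qhi)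
    (q : EuclideanSpace ℝ (Fin d) → ℝ) (hq : TVFEM.MemQad Ω qlo qhi q) :
    (∃ qh : ℝ → EuclideanSpace ℝ (Fin d) → ℝ,
      TVFEM.IsApproximatingFamily Ω qlo qhi K q qh) ∧
    (∀ p : ℝ≥0∞, (d : ℝ≥0∞) < p → TVFEM.MemW1p Ω p q →
      ∃ qc : EuclideanSpace ℝ (Fin d) → ℝ,
        ContinuousOn qc (closure Ω) ∧ q =ᵐ[volume.restrict Ω] qc ∧
        ∃ qh : ℝ → EuclideanSpace ℝ (Fin d) → ℝ,
          (∀ h ∈ Ioo (0 : ℝ) 1, TVFEM.IsNodalInterpolant Ω (K h) qc (qh h)) ∧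
          TVFEM.IsApproximatingFamily Ω qlo qhi K q qh) := by
  refine ⟨TVFEM.exists_isApproximatingFamily hΩ hK hq, fun p hp hW => ?_⟩
  obtain ⟨r, hr, hdr, hWr⟩ := hW.exists_real hΩ.isBounded (by omega) hp
  exact TVFEM.exists_nodal_isApproximatingFamily hΩ hK hq hr hdr hWr
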